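/- Let $S$ be a nonsingular complex curve (integral, separated, of finite type over $\mathbb{C}$, smooth of dimension $1$), let $X$ be a normal complex variety of dimension $3$, let $\pi\colon X\to S$ be a projective surjective morphism, and let $\mathcal{L}\cong\mathcal{O}_X(D)$ be a divisorial sheaf on $X$, with $D$ a Weil divisor. Put $$\mathcal{E}_n:=\pi_*\big((\omega_X\otimes\mathcal{L})^{[n]}\big),\qquad \mathcal{R}:=\bigoplus_{n\ge 0}\mathcal{E}_n ,$$ where $(\;)^{[n]}$ denotes the $n$-th reflexive power; $\mathcal{R}$ is a graded $\mathcal{O}_S$-algebra (the relative log canonical algebra of $(X,\pi,\mathcal{L})$). Assume that for every closed point $s\in S$ the graded algebra $\mathcal{R}_s\otimes_{\mathcal{O}_{S,s}}k(s)$ is isomorphic, as a graded algebra over $k(s)=\mathbb{C}$, to one of * (hyperelliptic case) $\mathbb{C}[x_1,x_2,x_3,z]/(z^2-f_6(x_1,x_2,x_3))$, where $\deg x_i=1$, $\deg z=3$ and $f_6$ is homogeneous of degree $6$; * (unigonal case) $\mathbb{C}[x_1,x_2,x_3,y,z]/(z^2-g_6(x_1,x_2,x_3,y),\ g_2(x_1,x_2,x_3))$,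 where $\deg x_i=1$, $\deg y=2$, $\deg z=3$, $g_6$ and $g_2$ are weighted homogeneous of degrees $6$ and $2$, and $g_6(0,0,0,1)\ne 0$. (This covers every threefold fibred by K3 surfaces of degree two all of whose fibres are hyperelliptic or unigonal in this sense.) Let $\mathcal{A}\subseteq\mathcal{R}$ be the graded $\mathcal{O}_S$-subalgebra generated by $\mathcal{E}_1$ and $\mathcal{E}_2$, let $\mathcal{A}_n$ be its part of degree $n$, and let $\sigma_2\colon\mathrm{Sym}^2(\mathcal{E}_1)\to\mathcal{E}_2$ be the map induced by multiplication in $\mathcal{R}$. Then there are exact sequences of sheaves of $\mathcal{O}_S$-modules (that is, sequences which are exact on the stalks at every point of $S$) $$(*)\quad \mathrm{Sym}^2(\mathcal{E}_1\wedge\mathcal{E}_1)\otimes\mathrm{Sym}^{n-2}(\mathcal{E}_2)\xrightarrow{\ i_n\ }\mathrm{Sym}^n(\mathcal{E}_2)\longrightarrow\mathcal{A}_{2n}\longrightarrow 0\qquad(n\ge 2),$$ $$(**)\quad \mathcal{E}_1\otimes(\mathcal{E}_1\wedge\mathcal{E}_1)\otimes\mathcal{A}_{2n-2}\xrightarrow{\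 j_n\ }\mathcal{E}_1\otimes\mathcal{A}_{2n}\longrightarrow\mathcal{A}_{2n+1}\longrightarrow 0\qquad(n\ge 1),$$ in which the maps to $\mathcal{A}_{2n}$ and $\mathcal{A}_{2n+1}$ are induced by multiplication in $\mathcal{A}$, and $i_n$, $j_n$ are the (well-defined) $\mathcal{O}_S$-linear maps given, for local sections $a,b,c,d,l$ of $\mathcal{E}_1$, by $$i_n\big((a\wedge b)(c\wedge d)\otimes r\big)=\big(\sigma_2(ac)\,\sigma_2(bd)-\sigma_2(ad)\,\sigma_2(bc)\big)\,r,$$ $$j_n\big(l\otimes(a\wedge b)\otimes r\big)=a\otimes\big(\sigma_2(bl)\,r\big)-b\otimes\big(\sigma_2(al)\,r\big).$$ Furthermore, for $n=2$ the sequence $(*)$ is also exact on the left, i.e. $i_2$ is injective. -/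

import Mathlib

open CategoryTheory CategoryTheory.Limits AlgebraicGeometry TopologicalSpace
open scoped TensorProduct DirectSum

namespace K3Fibration

/-! ## Algebra: a graded algebra, the subalgebra generated in degrees one and two -/

section Algebra

/-- The symmetric power `Sym^n M`, as the degree `n` part of the symmetric algebra of `M`. -/
abbrev SymPow (B M : Type*) [CommRing B] [AddCommGroup M] [Module B M] (n : ℕ) :
    Submodule B (SymmetricAlgebra B M) :=
  LinearMap.range (SymmetricAlgebra.ι B M) ^ n

/-- The product `a b` in `Sym^2 M`. -/
def SymPow.mk₂ (B : Type*) {M : Type*} [CommRing B] [AddCommGroup M] [Module B M] (a b : M) :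
    SymPow B M 2 :=
  ⟨SymmetricAlgebra.ι B M a * SymmetricAlgebra.ι B M b, by
    rw [SymPow, pow_two]
    exact Submodule.mul_mem_mul ⟨a, rfl⟩ ⟨b, rfl⟩⟩

/-- The element `a ∧ b` of the second exterior power. -/
def wedge (B : Type*) {M : Type*} [CommRing B] [AddCommGroup M] [Module B M] (a b : M) :
    ⋀[B]^2 M :=
  exteriorPower.ιMulti B 2 ![a, b]

variable {B P : Type*} [CommRing B] [CommRing P] [Algebra B P]
variable (E : ℕ → Submodule B P) [SetLike.GradedMonoid E]

theorem pow_le_graded (d n m : ℕ) (h : n * d = m) : E d ^ n ≤ E m := by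
  subst h
  induction n with
  | zero =>
    rw [pow_zero, Nat.zero_mul, Submodule.one_le]
    exact SetLike.GradedOne.one_mem
  | succ k ih =>
    rw [pow_succ, Nat.succ_mul]
    exact Submodule.mul_le.2 fun a ha b hb => SetLike.GradedMul.mul_mem (ih ha) hb

/-- The map `Sym^n(E_d) → E_m` (with `m = n d`) induced by multiplication. -/
noncomputable def symMult (d n m : ℕ) (h : n * d = m) : SymPow B (E d) n →ₗ[B] E m :=
  ((SymmetricAlgebra.lift (E d).subtype).toLinearMap.domRestrict _).codRestrict (E m) (by
    rintro ⟨x, hx⟩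
    refine pow_le_graded E d n m h ?_
    have h1 : SymmetricAlgebra.lift (E d).subtype x ∈
        (LinearMap.range (SymmetricAlgebra.ι B (E d)) ^ n).map
          (SymmetricAlgebra.lift (E d).subtype).toLinearMap := ⟨x, hx, rfl⟩
    have h2 : (SymmetricAlgebra.lift (E d).subtype).toLinearMap ∘ₗ SymmetricAlgebra.ι B (E d) =
        (E d).subtype := SymmetricAlgebra.lift_comp_ι _
    rw [Submodule.map_pow, ← LinearMap.range_comp, h2, Submodule.range_subtype] at h1
    exact h1)

/-- `σ₂ : Sym^2(E_1) → E_2`, induced by multiplication. -/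
noncomputable def sigmaTwo : SymPow B (E 1) 2 →ₗ[B] E 2 := symMult E 1 2 2 rfl

/-- The subalgebra `A` of the graded algebra `⨁ E_n` generated by `E_1` and `E_2`. -/
noncomputable def subalgebraA : Subalgebra B (⨁ n, E n) :=
  Algebra.adjoin B (Set.range (DirectSum.lof B ℕ (fun n => E n) 1) ∪
    Set.range (DirectSum.lof B ℕ (fun n => E n) 2))

/-- The graded part `A_n` of degree `n` of `A`, as a submodule of `E_n`. -/
noncomputable def gradedA (n : ℕ) : Submodule B (E n) :=
  (Subalgebra.toSubmodule (subalgebraA E)).comap (DirectSum.lof B ℕ (fun n => E n) n)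

theorem lof_mul_lof (i j k : ℕ) (h : i + j = k) (x : E i) (y : E j) (z : E k)
    (hz : (z : P) = x * y) :
    DirectSum.lof B ℕ (fun n => E n) k z =
      DirectSum.lof B ℕ (fun n => E n) i x * DirectSum.lof B ℕ (fun n => E n) j y := by
  subst h
  rw [DirectSum.lof_eq_of, DirectSum.lof_eq_of, DirectSum.lof_eq_of, DirectSum.of_mul_of]
  congr 1
  exact Subtype.ext hz

theorem lof_mem_subalgebraA (d : ℕ) (hd : d = 1 ∨ d = 2) (x : E d) :
    DirectSum.lof B ℕ (fun n => E n) d x ∈ subalgebraA E := by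
  rcases hd with rfl | rfl
  · exact Algebra.subset_adjoin (Or.inl ⟨x, rfl⟩)
  · exact Algebra.subset_adjoin (Or.inr ⟨x, rfl⟩)

theorem mul_mem_gradedA (d m k : ℕ) (hd : d = 1 ∨ d = 2) (h : d + m = k) (x : E d)
    (r : gradedA E m) (z : E k) (hz : (z : P) = x * (r : E m)) : z ∈ gradedA E k := by
  change DirectSum.lof B ℕ (fun n => E n) k z ∈ subalgebraA E
  rw [lof_mul_lof E d m k h x r z hz]
  exact mul_mem (lof_mem_subalgebraA E d hd x) r.2

/-- Multiplication `E_d × A_m → A_k` for `d = 1, 2` and `k = d + m`. -/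
noncomputable def mulA (d m k : ℕ) (hd : d = 1 ∨ d = 2) (h : d + m = k) :
    E d →ₗ[B] gradedA E m →ₗ[B] gradedA E k :=
  LinearMap.mk₂ B
    (fun x r =>
      ⟨⟨(x : P) * ((r : E m) : P), h ▸ SetLike.GradedMul.mul_mem x.2 (r : E m).2⟩,
        mul_mem_gradedA E d m k hd h x r _ rfl⟩)
    (fun _ _ _ => Subtype.ext (Subtype.ext (add_mul _ _ _)))
    (fun _ _ _ => Subtype.ext (Subtype.ext (smul_mul_assoc _ _ _)))
    (fun _ _ _ => Subtype.ext (Subtype.ext (mul_add _ _ _)))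
    (fun _ _ _ => Subtype.ext (Subtype.ext (mul_smul_comm _ _ _)))

theorem symMult_mem_gradedA (n m : ℕ) (h : n * 2 = m) (x : SymPow B (E 2) n) :
    symMult E 2 n m h x ∈ gradedA E m := by
  suffices H : ∀ (n m : ℕ) (_ : n * 2 = m) (x : SymmetricAlgebra B (E 2)), x ∈ SymPow B (E 2) n →
      ∃ y ∈ gradedA E m, (y : P) = SymmetricAlgebra.lift (E 2).subtype x by
    obtain ⟨y, hy, hyx⟩ := H n m h x.1 x.2
    have : symMult E 2 n m h x = y := Subtype.ext hyx.symm
    rwa [this]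
  intro n
  induction n with
  | zero =>
    rintro m h x hx
    obtain rfl : m = 0 := by omega
    rw [SymPow, pow_zero, Submodule.mem_one] at hx
    obtain ⟨c, rfl⟩ := hx
    refine ⟨c • ⟨1, SetLike.GradedOne.one_mem⟩, Submodule.smul_mem _ _ ?_, ?_⟩
    · exact one_mem (subalgebraA E)
    · rw [AlgHom.commutes, Algebra.algebraMap_eq_smul_one]
      rfl
  | succ k ih =>
    rintro m h x hx
    rw [SymPow, pow_succ'] at hx
    induction hx using Submodule.mul_induction_on' with
    | mem_mul_mem a ha b hb =>
      obtain ⟨a, rfl⟩ := ha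
      obtain ⟨y, hy, hyb⟩ := ih (k * 2) rfl b hb
      refine ⟨mulA E 2 (k * 2) m (Or.inr rfl) (by omega) a ⟨y, hy⟩, Subtype.property _, ?_⟩
      rw [map_mul, SymmetricAlgebra.lift_ι_apply, ← hyb]
      rfl
    | add a _ b _ ha hb =>
      obtain ⟨y, hy, hya⟩ := ha
      obtain ⟨z, hz, hzb⟩ := hb
      exact ⟨y + z, add_mem hy hz, by rw [map_add, ← hya, ← hzb]; rfl⟩

/-- The map `Sym^n(E_2) → A_{2n}` induced by the ring structure of `A`. -/
noncomputable def evenMap (n : ℕ) : SymPow B (E 2) n →ₗ[B] gradedA E (2 * n) :=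
  (symMult E 2 n (2 * n) (Nat.mul_comm n 2)).codRestrict _
    (symMult_mem_gradedA E n (2 * n) (Nat.mul_comm n 2))

/-- The map `E_1 ⊗ A_{2n} → A_{2n+1}` induced by the ring structure of `A`. -/
noncomputable def oddMap (n : ℕ) : E 1 ⊗[B] gradedA E (2 * n) →ₗ[B] gradedA E (2 * n + 1) :=
  TensorProduct.lift (mulA E 1 (2 * n) (2 * n + 1) (Or.inl rfl) (Nat.add_comm _ _))

/-- The map `i = i_n : Sym^2(E_1 ∧ E_1) ⊗ Sym^{n-2}(E_2) → Sym^n(E_2)` is given by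
`i((a ∧ b)(c ∧ d) ⊗ r) = (σ₂(ac) σ₂(bd) - σ₂(ad) σ₂(bc)) r`. Such elements span the source, so this
determines `i`. -/
def IsEvenRelationMap (n : ℕ)
    (i : SymPow B (⋀[B]^2 (E 1)) 2 ⊗[B] SymPow B (E 2) (n - 2) →ₗ[B] SymPow B (E 2) n) : Prop :=
  ∀ (a b c d : E 1) (r : SymPow B (E 2) (n - 2)),
    (i (SymPow.mk₂ B (wedge B a b) (wedge B c d) ⊗ₜ[B] r) : SymmetricAlgebra B (E 2)) =
      (SymmetricAlgebra.ι B (E 2) (sigmaTwo E (SymPow.mk₂ B a c)) *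
          SymmetricAlgebra.ι B (E 2) (sigmaTwo E (SymPow.mk₂ B b d)) -
        SymmetricAlgebra.ι B (E 2) (sigmaTwo E (SymPow.mk₂ B a d)) *
          SymmetricAlgebra.ι B (E 2) (sigmaTwo E (SymPow.mk₂ B b c))) * r

/-- The map `j = j_n : E_1 ⊗ (E_1 ∧ E_1) ⊗ A_{2n-2} → E_1 ⊗ A_{2n}` is given by
`j(l ⊗ (a ∧ b) ⊗ r) = a ⊗ σ₂(bl) r - b ⊗ σ₂(al) r`. Such elements span the source, so this
determines `j`. -/
def IsOddRelationMap (n : ℕ) (hn : 1 ≤ n)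
    (j : E 1 ⊗[B] (⋀[B]^2 (E 1) ⊗[B] gradedA E (2 * n - 2)) →ₗ[B]
      E 1 ⊗[B] gradedA E (2 * n)) : Prop :=
  ∀ (l a b : E 1) (r : gradedA E (2 * n - 2)),
    j (l ⊗ₜ[B] (wedge B a b ⊗ₜ[B] r)) =
      a ⊗ₜ[B] mulA E 2 (2 * n - 2) (2 * n) (Or.inr rfl) (by omega)
          (sigmaTwo E (SymPow.mk₂ B b l)) r -
        b ⊗ₜ[B] mulA E 2 (2 * n - 2) (2 * n) (Or.inr rfl) (by omega)
          (sigmaTwo E (SymPow.mk₂ B a l)) r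

variable (k : Type*) [Field k] [Algebra B k]

/-- The fibre `R ⊗_B k` of the graded algebra `R = ⨁ E_n`. -/
abbrev Fibre : Type _ := k ⊗[B] (⨁ n, E n)

/-- The part of degree `n` of the fibre. -/
noncomputable def fibreDegree (n : ℕ) : Submodule k (Fibre E k) :=
  LinearMap.range ((DirectSum.lof B ℕ (fun n => E n) n).baseChange k)

/-- Hyperelliptic case: the fibre is isomorphic, as a graded `k`-algebra, to
`k[x₁, x₂, x₃, z] / (z² - f₆(x₁, x₂, x₃))` with `deg x_i = 1`, `deg z = 3`. -/
def IsHyperelliptic : Prop :=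
  ∃ f₆ : MvPolynomial (Fin 3) k, f₆.IsHomogeneous 6 ∧
    ∃ e : (MvPolynomial (Fin 4) k ⧸
        Ideal.span {(MvPolynomial.X 3 ^ 2 - MvPolynomial.rename ![0, 1, 2] f₆ :
          MvPolynomial (Fin 4) k)}) ≃ₐ[k] Fibre E k,
      ∀ (n : ℕ) (p : MvPolynomial (Fin 4) k),
        p.IsWeightedHomogeneous (![1, 1, 1, 3] : Fin 4 → ℕ) n →
          e (Ideal.Quotient.mk _ p) ∈ fibreDegree E k n

/-- Unigonal case: the fibre is isomorphic, as a graded `k`-algebra, to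
`k[x₁, x₂, x₃, y, z] / (z² - g₆(x₁, x₂, x₃, y), g₂(x₁, x₂, x₃))` with `deg x_i = 1`, `deg y = 2`,
`deg z = 3` and `g₆(0, 0, 0, 1) ≠ 0`. -/
def IsUnigonal : Prop :=
  ∃ (g₆ : MvPolynomial (Fin 4) k) (g₂ : MvPolynomial (Fin 3) k),
    g₆.IsWeightedHomogeneous (![1, 1, 1, 2] : Fin 4 → ℕ) 6 ∧ g₂.IsHomogeneous 2 ∧
    MvPolynomial.eval ![0, 0, 0, 1] g₆ ≠ 0 ∧
    ∃ e : (MvPolynomial (Fin 5) k ⧸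
        Ideal.span {(MvPolynomial.X 4 ^ 2 - MvPolynomial.rename ![0, 1, 2, 3] g₆ :
          MvPolynomial (Fin 5) k), MvPolynomial.rename ![0, 1, 2] g₂}) ≃ₐ[k] Fibre E k,
      ∀ (n : ℕ) (p : MvPolynomial (Fin 5) k),
        p.IsWeightedHomogeneous (![1, 1, 1, 2, 3] : Fin 5 → ℕ) n →
          e (Ideal.Quotient.mk _ p) ∈ fibreDegree E k n

end Algebra

/-! ## Geometry: pluricanonical forms twisted by a divisor, and their direct images -/

section Geometry

/-- Projective space `ℙ^N` over `ℤ`. -/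
noncomputable def projSpace (N : ℕ) : Scheme.{0} :=
  letI : GradedAlgebra (MvPolynomial.homogeneousSubmodule (Fin (N + 1)) ℤ) :=
    MvPolynomial.gradedAlgebra
  Proj (MvPolynomial.homogeneousSubmodule (Fin (N + 1)) ℤ)

/-- A projective morphism: it factors as a closed immersion into some `S × ℙ^N`, followed by the
projection. -/
def IsProjective {X S : Scheme.{0}} (π : X ⟶ S) : Prop :=
  ∃ (N : ℕ) (g : X ⟶ projSpace N),
    IsClosedImmersion
      (pullback.lift π g (terminal.hom_ext _ _) :
        X ⟶ pullback (terminal.from S) (terminal.from (projSpace N)))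

/-- A Weil divisor on a scheme: a locally finite integral combination of points of
codimension one (equivalently, of their closures). -/
def WeilDivisor (X : Scheme.{0}) : Type :=
  {D : AlgebraicCycle X ℤ // ∀ x : X, D x ≠ 0 → Order.coheight x = 1}

variable {X : Scheme.{0}} [IsIntegral X] (p : X ⟶ Spec (CommRingCat.of ℂ))

/-- The function field of `X`, as a field extension of `ℂ` through the structure morphism `p`. -/
def FunField (_p : X ⟶ Spec (CommRingCat.of ℂ)) : Type := X.functionField

noncomputable instance : Field (FunField p) := inferInstanceAs (Field X.functionField)

noncomputable instance : Algebra ℂ (FunField p) :=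
  RingHom.toAlgebra
    ((Scheme.ΓSpecIso (CommRingCat.of ℂ)).inv ≫ p.appTop ≫
      X.presheaf.germ ⊤ (genericPoint X) trivial).hom

noncomputable instance (x : X) : Algebra (X.presheaf.stalk x) (FunField p) :=
  inferInstanceAs (Algebra (X.presheaf.stalk x) X.functionField)

/-- Rational 3-forms on `X`. -/
abbrev RatForm : Type := ⋀[FunField p]^3 (Ω[FunField p⁄ℂ])

/-- The algebra `⨁_n (Λ³ Ω)^{⊗ n}` of rational pluricanonical forms on the threefold `X`
(the symmetric algebra of a one-dimensional space is its tensor algebra). -/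
def RatPluriform : Type := SymmetricAlgebra (FunField p) (RatForm p)

noncomputable instance : CommRing (RatPluriform p) :=
  inferInstanceAs (CommRing (SymmetricAlgebra (FunField p) (RatForm p)))

noncomputable instance : Algebra (FunField p) (RatPluriform p) :=
  inferInstanceAs (Algebra (FunField p) (SymmetricAlgebra (FunField p) (RatForm p)))

noncomputable instance (x : X) : Algebra (X.presheaf.stalk x) (RatPluriform p) :=
  ((algebraMap (FunField p) (RatPluriform p)).comp
    (algebraMap (X.presheaf.stalk x) (FunField p))).toAlgebra

/-- The inclusion of the rational 3-forms as the part of degree one. -/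
noncomputable def ofForm : RatForm p →ₗ[FunField p] RatPluriform p :=
  SymmetricAlgebra.ι (FunField p) (RatForm p)

/-- The germ at `x` of the canonical sheaf `ω_X`, for `x` a regular point: the rational 3-forms
generated over `𝒪_{X,x}` by the `df₁ ∧ df₂ ∧ df₃` with `f_i ∈ 𝒪_{X,x}`. -/
def canonicalGerm (x : X) : Set (RatForm p) :=
  {w | ∃ (m : ℕ) (g : Fin m → X.presheaf.stalk x) (f : Fin m → Fin 3 → X.presheaf.stalk x),
    w = ∑ i, algebraMap _ (FunField p) (g i) • exteriorPower.ιMulti (FunField p) 3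
      (fun j => KaehlerDifferential.D ℂ (FunField p) (algebraMap _ (FunField p) (f i j)))}

/-- The germ of `𝒪_X(D)` at a point `x` of codimension one at which `X` is regular: the rational
functions of the form `g ϖ^{-D(x)}`, with `g ∈ 𝒪_{X,x}` and `ϖ` a uniformizer. -/
def divisorialGerm (D : WeilDivisor X) (x : X) : Set (FunField p) :=
  {f | ∃ ϖ g : X.presheaf.stalk x, Irreducible ϖ ∧
    f = algebraMap _ (FunField p) g * algebraMap _ (FunField p) ϖ ^ (-(D.1 x))}

/-- The germ of `ω_X ⊗ 𝒪_X(D)` at a point `x` of codimension one, inside the rational 3-forms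
(regarded as pluricanonical forms of degree one). -/
noncomputable def twistedCanonicalGerm (D : WeilDivisor X) (x : X) :
    Submodule (X.presheaf.stalk x) (RatPluriform p) :=
  Submodule.span _ {a | ∃ f ∈ divisorialGerm p D x, ∃ w ∈ canonicalGerm p x, a = ofForm p (f • w)}

/-- Sections over `V` of the reflexive power `(ω_X ⊗ 𝒪_X(D))^{[n]}` on a normal threefold `X`:
a reflexive sheaf of rank one on a normal scheme is determined in codimension one, so these are
the rational `n`-canonical forms which lie in the `n`-th power of the germ of `ω_X ⊗ 𝒪_X(D)` at
every point of codimension one of `V`. -/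
noncomputable def reflexivePowerSections (D : WeilDivisor X) (n : ℕ) (V : X.Opens) :
    AddSubgroup (RatPluriform p) :=
  ⨅ x : {x : X // x ∈ V ∧ Order.coheight x = 1},
    (twistedCanonicalGerm p D x.1 ^ n).toAddSubgroup

variable {S : Scheme.{0}} (q : S ⟶ Spec (CommRingCat.of ℂ)) (π : X ⟶ S)

/-- Sections over `U ⊆ S` of the direct image `E_n = π_* (ω_X ⊗ 𝒪_X(D))^{[n]}`. -/
noncomputable def directImageSections (D : WeilDivisor X) (n : ℕ) (U : S.Opens) :
    AddSubgroup (RatPluriform (π ≫ q)) :=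
  reflexivePowerSections (π ≫ q) D n (π ⁻¹ᵁ U)

theorem directImageSections_mono (D : WeilDivisor X) (n : ℕ) {U V : S.Opens} (h : V ≤ U) :
    directImageSections q π D n U ≤ directImageSections q π D n V := by
  intro a ha
  rw [directImageSections, reflexivePowerSections, AddSubgroup.mem_iInf] at ha ⊢
  rintro ⟨x, hx, hx1⟩
  exact ha ⟨x, h hx, hx1⟩

variable [Surjective π]

theorem generic_specializes (s : S) : π (genericPoint X) ⤳ s := by
  obtain ⟨x, rfl⟩ := π.surjective s
  exact ((genericPoint_spec X).specializes trivial).map π.continuous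

/-- The pullback `𝒪_{S,s} → K(X)` of germs of functions. -/
noncomputable def pullbackGerm (s : S) : S.presheaf.stalk s →+* FunField (π ≫ q) :=
  (S.presheaf.stalkSpecializes (generic_specializes π s) ≫ π.stalkMap (genericPoint X)).hom

/-- The rational pluricanonical forms on `X` as an algebra over `𝒪_{S,s}`. -/
noncomputable instance germAlgebra (s : S) :
    Algebra (S.presheaf.stalk s) (RatPluriform (π ≫ q)) :=
  ((algebraMap (FunField (π ≫ q)) (RatPluriform (π ≫ q))).comp (pullbackGerm q π s)).toAlgebra

theorem pullbackGerm_germ (U : S.Opens) (x : X) (hx : π x ∈ U) (s : S) (hs : s ∈ U)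
    (f : Γ(S, U)) :
    pullbackGerm q π s (S.presheaf.germ U s hs f) =
      algebraMap (X.presheaf.stalk x) (FunField (π ≫ q))
        (X.presheaf.germ (π ⁻¹ᵁ U) x hx (π.app U f)) := by
  have h1 : S.presheaf.germ U s hs ≫ S.presheaf.stalkSpecializes (generic_specializes π s) ≫
      π.stalkMap (genericPoint X) = π.app U ≫ X.presheaf.germ (π ⁻¹ᵁ U) x hx ≫
      X.presheaf.stalkSpecializes ((genericPoint_spec X).specializes trivial) := by
    rw [TopCat.Presheaf.germ_stalkSpecializes_assoc, Scheme.Hom.germ_stalkMap]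
    exact congrArg (π.app U ≫ ·) (TopCat.Presheaf.germ_stalkSpecializes X.presheaf hx
      ((genericPoint_spec X).specializes trivial)).symm
  exact congr($(h1).hom f)

theorem germ_smul_mem (D : WeilDivisor X) (n : ℕ) (U : S.Opens) (s : S) (hs : s ∈ U)
    (f : Γ(S, U)) (a : RatPluriform (π ≫ q)) (ha : a ∈ directImageSections q π D n U) :
    S.presheaf.germ U s hs f • a ∈ directImageSections q π D n U := by
  rw [directImageSections, reflexivePowerSections, AddSubgroup.mem_iInf] at ha ⊢
  rintro ⟨x, hx, hx1⟩
  have h := Submodule.smul_mem _ (X.presheaf.germ (π ⁻¹ᵁ U) x hx (π.app U f)) (ha ⟨x, hx, hx1⟩)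
  rw [Algebra.smul_def] at h ⊢
  rw [RingHom.algebraMap_toAlgebra, RingHom.comp_apply] at h ⊢
  rw [pullbackGerm_germ q π U x hx s hs f]
  exact h

/-- The stalk at `s` of the direct image `E_n = π_* (ω_X ⊗ 𝒪_X(D))^{[n]}`. -/
noncomputable def directImageStalk (D : WeilDivisor X) (s : S) (n : ℕ) :
    Submodule (S.presheaf.stalk s) (RatPluriform (π ≫ q)) where
  carrier := {a | ∃ U : S.Opens, s ∈ U ∧ a ∈ directImageSections q π D n U}
  zero_mem' := ⟨⊤, trivial, zero_mem _⟩
  add_mem' := by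
    rintro a b ⟨U, hU, ha⟩ ⟨V, hV, hb⟩
    exact ⟨U ⊓ V, ⟨hU, hV⟩, add_mem (directImageSections_mono q π D n inf_le_left ha)
      (directImageSections_mono q π D n inf_le_right hb)⟩
  smul_mem' := by
    rintro c a ⟨U, hU, ha⟩
    obtain ⟨V, hV, f, rfl⟩ := TopCat.Presheaf.exists_germ_eq S.presheaf c
    refine ⟨U ⊓ V, ⟨hU, hV⟩, ?_⟩
    have h : S.presheaf.germ V s hV f = S.presheaf.germ (U ⊓ V) s ⟨hU, hV⟩
        (S.presheaf.map (homOfLE inf_le_right).op f) :=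
      (TopCat.Presheaf.germ_res_apply _ _ _ _ _).symm
    rw [h]
    exact germ_smul_mem q π D n _ s _ _ a (directImageSections_mono q π D n inf_le_left ha)

/-- The stalk at `s` of the relative log canonical algebra `⨁ E_n` is a graded algebra. -/
instance directImageStalk_graded (D : WeilDivisor X) (s : S) :
    SetLike.GradedMonoid (directImageStalk q π D s) where
  one_mem := by
    refine ⟨⊤, trivial, ?_⟩
    rw [directImageSections, reflexivePowerSections, AddSubgroup.mem_iInf]
    rintro x
    change (1 : RatPluriform (π ≫ q)) ∈ twistedCanonicalGerm (π ≫ q) D x.1 ^ 0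
    rw [pow_zero]
    exact Submodule.one_le.1 le_rfl
  mul_mem := by
    rintro i j a b ⟨U, hU, ha⟩ ⟨V, hV, hb⟩
    have ha' := directImageSections_mono q π D i (inf_le_left : U ⊓ V ≤ U) ha
    have hb' := directImageSections_mono q π D j (inf_le_right : U ⊓ V ≤ V) hb
    refine ⟨U ⊓ V, ⟨hU, hV⟩, ?_⟩
    rw [directImageSections, reflexivePowerSections, AddSubgroup.mem_iInf] at ha' hb' ⊢
    intro x
    change a * b ∈ twistedCanonicalGerm (π ≫ q) D x.1 ^ (i + j)
    rw [pow_add]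
    exact Submodule.mul_mem_mul (ha' x) (hb' x)

/-- At every closed point `s` of `S`, the fibre `R ⊗ k(s)` of the relative log canonical algebra
`R = ⨁ E_n` is hyperelliptic or unigonal. -/
def HasGoodFibres (D : WeilDivisor X) : Prop :=
  ∀ s : S, IsClosed ({s} : Set S) →
    IsHyperelliptic (directImageStalk q π D s) (IsLocalRing.ResidueField (S.presheaf.stalk s)) ∨
    IsUnigonal (directImageStalk q π D s) (IsLocalRing.ResidueField (S.presheaf.stalk s))

end Geometry

end K3Fibration

open K3Fibration

/-! Fix a point s and let B be the local ring of S there. Everything rests on one structural fact,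
recorded in `IsPresentation`: there are x₁, x₂, x₃ generating `E 1` and y which, together with the
products x_a x_b, generates `E 2`, and every weighted homogeneous relation between them is a
multiple of a single form G of weight two. So A is B[x₁, x₂, x₃, y]/(G) with y in degree two. On a
hyperelliptic fibre y = 0 and G = y; on a unigonal fibre G = g₂.

The presentation is lifted from a closed fibre to the stalk by Nakayama's lemma
(`IsPresentation.exists_of_fibre`). This needs a principal maximal ideal (a smooth curve is locally
étale over a line), torsion-freeness (the stalks lie in a vector space over the function field K of
X) and finite generation of E_1 and E_2. It passes to non-closed points by localization
(`IsPresentation.of_span`).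

Finite generation is proved with valuation rings. Let l be a K-linear functional with values in K.
On each member V of a finite affine cover of π⁻¹(U), Hartogs' theorem gives one c_V ≠ 0 with c_V
l(a) regular for all sections a of E_n over U. By the valuative criterion a valuation ring
containing the functions on U contains those on some V, so l(a) lies in the sum of the c_V⁻¹
multiples of every such ring. The integral closure of a Rees-type algebra then confines l(a) to a
finitely generated module (`exists_fg_of_forall_valuationSubring`).

Given a presentation, exactness in the middle comes from a partial inverse of multiplication. Modulo
the minors, the rule that trades x_a x_b for the class of x_a x_b in Sym(E_2) is independent of how
the letters of a monomial are paired (`exists_section`). It turns multiplication by a quadratic form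
into multiplication by its value in E_2, so it kills G and all its multiples, that is, all
relations. Hence an element of Sym^n(E_2) with zero image in A lies in the ideal of the minors
(`IsPresentation.even_kernel`). The odd case is the same argument with values in a quotient of
Sym(E_2)³ (`IsPresentation.odd_kernel`).

For the injectivity of i₂, E_2 is generated by seven elements whose linear relations are multiples
of one linear form. A combination of minors vanishing in Sym(E_2) is divisible by that form; but it
vanishes on the quadratic monomials, and a product of linear forms does so only if it is zero
(`minorComb_eq_zero_of_mem`). -/

/-! ### Commutative algebra: integral closure, valuation rings, Hartogs. -/

open Polynomial in
/-- The integral closure of a finitely generated domain over a field of characteristic zero, in its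
fraction field, is a Noetherian module. -/
theorem isNoetherian_integralClosure (k C L : Type*) [Field k] [CharZero k] [CommRing C]
    [IsDomain C] [Algebra k C] [Algebra.FiniteType k C] [Field L] [Algebra C L]
    [IsFractionRing C L] : IsNoetherian C (integralClosure C L) := by
  -- Noether normalization makes `C` finite over a polynomial ring `A`. Then `L` is finite, and in
  -- characteristic zero separable, over the fraction field of the normal ring `A`.
  obtain ⟨s, g, hinj, hfin⟩ := exists_finite_inj_algHom_of_fg k C
  let A := MvPolynomial (Fin s) k
  let : Algebra A C := g.toRingHom.toAlgebra
  let : Algebra A L := ((algebraMap C L).comp g.toRingHom).toAlgebra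
  have : IsScalarTower A C L := .of_algebraMap_eq' rfl
  have : Module.Finite A C := hfin
  have hAC : FaithfulSMul A C := (faithfulSMul_iff_algebraMap_injective A C).2 hinj
  have hAL : FaithfulSMul A L := (faithfulSMul_iff_algebraMap_injective A L).2
    ((IsFractionRing.injective C L).comp hinj)
  let K := FractionRing A
  let : Algebra K L := FractionRing.liftAlgebra A L
  have : IsScalarTower A K L := inferInstance
  have : Algebra.IsIntegral A C := inferInstance
  have : IsLocalization (Algebra.algebraMapSubmonoid C (nonZeroDivisors A)) L := inferInstance
  have : FiniteDimensional K L := Module.Finite.of_isLocalization A C (nonZeroDivisors A)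
  have : CharZero K := charZero_of_injective_algebraMap (R := A)
    (IsFractionRing.injective A K)
  have : IsNoetherian A (integralClosure A L) :=
    IsIntegralClosure.isNoetherian A K L (integralClosure A L)
  -- `C` is integral over `A`, so the closure of `C` embeds in that of `A`.
  let e : integralClosure C L →ₗ[A] integralClosure A L :=
    LinearMap.codRestrict (Subalgebra.toSubmodule (integralClosure A L))
      ((Submodule.subtype (Subalgebra.toSubmodule (integralClosure C L))).restrictScalars A)
      (fun x => isIntegral_trans (R := A) (A := C) x.1 x.2)
  have : IsNoetherian A (integralClosure C L) := isNoetherian_of_injective e (by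
    intro x y h
    exact Subtype.ext congr(($h).1))
  exact isNoetherian_of_tower A this

open Polynomial in
/-- Let `K` be a finitely generated field and `B` a finitely generated algebra, over a field `k` of
characteristic zero. The elements of `K` which lie in `∑ g V` (`g ∈ s`) for every valuation ring
`V` of `K` containing `B` are contained in a finitely generated `B`-module. -/
theorem exists_fg_of_forall_valuationSubring (k B A K : Type*) [Field k] [CharZero k] [CommRing B]
    [Algebra k B] [Algebra.FiniteType k B] [Field K] [Algebra k K] [Algebra B K]
    [IsScalarTower k B K] [CommRing A] [IsDomain A] [Algebra k A] [Algebra.FiniteType k A]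
    [Algebra A K] [IsScalarTower k A K] [IsFractionRing A K] (s : Finset K) :
    ∃ N : Submodule B K, N.FG ∧ ∀ f : K,
      (∀ V : ValuationSubring K, (∀ b : B, algebraMap B K b ∈ V) → ∃ g ∈ s, ∃ v ∈ V, f = v * g) →
        f ∈ N := by
  classical
  obtain ⟨tA, htA⟩ := (inferInstance : Algebra.FiniteType k A).out
  obtain ⟨tB, htB⟩ := (inferInstance : Algebra.FiniteType k B).out
  let L := FractionRing K[X]
  let ψ : K[X] →ₐ[k] L := IsScalarTower.toAlgHom k K[X] L
  have hψ : Function.Injective ψ := IsFractionRing.injective K[X] L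
  -- `X` records the degree, as in a Rees algebra: `B` sits in degree zero and the elements of `s`
  -- in degree one. The generators `X` and `a X` serve only to make `L` the fraction field of `R`.
  let G : Finset L := {ψ X} ∪ s.image (fun g => ψ (C g * X)) ∪
    tA.image (fun a => ψ (C (algebraMap A K a) * X)) ∪
    tB.image (fun b => ψ (C (algebraMap B K b)))
  let R : Subalgebra k L := Algebra.adjoin k (G : Set L)
  have : Algebra.FiniteType k R :=
    (Subalgebra.fg_iff_finiteType R).1 (Subalgebra.fg_adjoin_finset G)
  have hX : ψ X ∈ R := Algebra.subset_adjoin (by simp [G])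
  have hs : ∀ g ∈ s, ψ (C g * X) ∈ R := fun g hg => Algebra.subset_adjoin (by
    simp only [G, Finset.coe_union, Finset.coe_image]
    exact Or.inl (Or.inl (Or.inr ⟨g, hg, rfl⟩)))
  have hB : ∀ b, ψ (C (algebraMap B K b)) ∈ R := by
    let φ : B →ₐ[k] L := ψ.comp ((IsScalarTower.toAlgHom k K K[X]).comp
      (IsScalarTower.toAlgHom k B K))
    have h : (⊤ : Subalgebra k B) ≤ R.comap φ := by
      rw [← htB, Algebra.adjoin_le_iff]
      intro b hb
      refine Algebra.subset_adjoin ?_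
      simp only [G, Finset.coe_union, Finset.coe_image]
      exact Or.inr ⟨b, hb, rfl⟩
    exact fun b => h (Algebra.mem_top (x := b))
  have hX0 : ψ X ≠ 0 := fun h => X_ne_zero (hψ (h.trans (map_zero ψ).symm))
  -- the fraction field of `R` is `L`
  have : FaithfulSMul R L := (faithfulSMul_iff_algebraMap_injective R L).2
    Subtype.val_injective
  have hfracK : ∀ a : K, ψ (C a) ∈ IntermediateField.adjoin k (R : Set L) := by
    set F := IntermediateField.adjoin k (R : Set L)
    have hRF : ∀ z ∈ R, z ∈ F := fun z hz => IntermediateField.subset_adjoin k _ hz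
    let φ : A →ₐ[k] L := ψ.comp ((IsScalarTower.toAlgHom k K K[X]).comp
      (IsScalarTower.toAlgHom k A K))
    have hA : (⊤ : Subalgebra k A) ≤ F.toSubalgebra.comap φ := by
      rw [← htA, Algebra.adjoin_le_iff]
      intro a ha
      have h1 : ψ (C (algebraMap A K a) * X) ∈ F := hRF _ (Algebra.subset_adjoin (by
        simp only [G, Finset.coe_union, Finset.coe_image]
        exact Or.inl (Or.inr ⟨a, ha, rfl⟩)))
      have h2 := F.div_mem h1 (hRF _ hX)
      rw [map_mul, mul_div_cancel_right₀ _ hX0] at h2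
      exact h2
    intro a
    obtain ⟨u, v, hv, rfl⟩ := IsFractionRing.div_surjective (A := A) a
    rw [show ψ (C (algebraMap A K u / algebraMap A K v)) = φ u / φ v from
      map_div₀ ((ψ.toRingHom).comp C) _ _]
    exact F.div_mem (hA Algebra.mem_top) (hA Algebra.mem_top)
  have : IsFractionRing R L := by
    refine IsFractionRing.of_field R L fun z => ?_
    have hz : z ∈ IntermediateField.adjoin k (R : Set L) := by
      set F := IntermediateField.adjoin k (R : Set L)
      have hp : ∀ p : K[X], ψ p ∈ F := by
        intro p
        induction p using Polynomial.induction_on' with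
        | add p q hp hq => rw [map_add]; exact F.add_mem hp hq
        | monomial n a =>
          rw [← C_mul_X_pow_eq_monomial, map_mul, map_pow]
          exact F.mul_mem (hfracK a) (F.pow_mem (IntermediateField.subset_adjoin k _ hX) n)
      obtain ⟨u, v, hv, rfl⟩ := IsFractionRing.div_surjective (A := K[X]) z
      exact F.div_mem (hp u) (hp v)
    rw [IntermediateField.mem_adjoin_iff_div] at hz
    obtain ⟨u, hu, v, hv, rfl⟩ := hz
    rw [Algebra.adjoin_eq] at hu hv
    exact ⟨⟨u, hu⟩, ⟨v, hv⟩, rfl⟩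
  have hnoeth := isNoetherian_integralClosure k R L
  -- coefficients of elements of `R`
  have hcoeff : ∀ z ∈ R, ∃ p : K[X], z = ψ p ∧ p.coeff 0 ∈ (IsScalarTower.toAlgHom k B K).range := by
    let D : Subalgebra k K[X] := (IsScalarTower.toAlgHom k B K).range.comap
      ((Polynomial.aeval (0 : K)).restrictScalars k : K[X] →ₐ[k] K)
    have hD : ∀ p : K[X], p ∈ D ↔ p.coeff 0 ∈ (IsScalarTower.toAlgHom k B K).range := by
      intro p
      rw [Polynomial.coeff_zero_eq_aeval_zero]
      exact Iff.rfl
    have h : R ≤ D.map ψ := by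
      refine Algebra.adjoin_le ?_
      intro z hz
      simp only [G, Finset.coe_union, Finset.coe_image, Finset.coe_singleton] at hz
      rcases hz with ((hz | ⟨g, hg, rfl⟩) | ⟨g, hg, rfl⟩) | ⟨b, hb, rfl⟩
      · rw [Set.mem_singleton_iff] at hz
        subst hz
        exact ⟨X, (hD _).2 (by simp), rfl⟩
      · exact ⟨_, (hD _).2 (by simp), rfl⟩
      · exact ⟨_, (hD _).2 (by simp), rfl⟩
      · exact ⟨_, (hD _).2 (by simp), rfl⟩
    intro z hz
    obtain ⟨p, hp, rfl⟩ := h hz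
    exact ⟨p, rfl, (hD p).1 hp⟩
  -- the elements in question are integral in degree one
  have hint : ∀ f : K, (∀ V : ValuationSubring K, (∀ b : B, algebraMap B K b ∈ V) →
      ∃ g ∈ s, ∃ v ∈ V, f = v * g) → ψ (C f * X) ∈ integralClosure R L := by
    intro f hf
    by_contra hn
    have hn' : ψ (C f * X) ∉ (integralClosure R L).toSubring := hn
    have : IsIntegrallyClosedIn (integralClosure R L).toSubring L :=
      inferInstanceAs (IsIntegrallyClosedIn (integralClosure R L) L)
    -- A non-integral element is missed by some valuation ring `V` of `L` containing `R`. Its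
    -- restriction to `K` contains `B`, so f = v g there, and f X = v (g X) lies in `V` after all.
    obtain ⟨V, hRV, hV⟩ := Subring.exists_le_valuationSubring_of_isIntegrallyClosedIn hn'
    have hRV' : ∀ z ∈ R, z ∈ V := fun z hz =>
      hRV ((integralClosure R L).algebraMap_mem ⟨z, hz⟩)
    obtain ⟨g, hg, v, hv, rfl⟩ := hf (V.comap ((ψ.toRingHom).comp C)) (fun b => hRV' _ (hB b))
    refine hV ?_
    rw [C_mul, mul_assoc, map_mul]
    exact V.mul_mem _ _ hv (hRV' _ (hs g hg))
  let W : Set (integralClosure R L) := {z | ∃ f : K, (z : L) = ψ (C f * X)}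
  obtain ⟨t, htW, ht⟩ := (Submodule.fg_span_iff_fg_span_finset_subset W).1
    (IsNoetherian.noetherian (Submodule.span R W))
  have htW' : ∀ z : t, ∃ f : K, (z.1 : L) = ψ (C f * X) := fun z => htW z.2
  choose F hF using htW'
  refine ⟨Submodule.span B (Set.range F), Submodule.fg_span (Set.finite_range F), fun f hf => ?_⟩
  have hfW : (⟨_, hint f hf⟩ : integralClosure R L) ∈ Submodule.span R (t : Set _) := by
    rw [← ht]
    exact Submodule.subset_span ⟨f, rfl⟩
  -- Compare coefficients of `X`: the generators are pure of degree one and the multipliers from `R`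
  -- have constant term in `B`, so only `B`-multiples of the `F i` appear.
  suffices H : ∀ z ∈ Submodule.span R (t : Set (integralClosure R L)),
      ∃ p : K[X], (z : L) = ψ p ∧ p.coeff 0 = 0 ∧
        p.coeff 1 ∈ Submodule.span B (Set.range F) by
    obtain ⟨p, hp, -, hp1⟩ := H _ hfW
    rw [← hψ hp] at hp1
    simpa using hp1
  intro z hz
  induction hz using Submodule.span_induction with
  | mem z hz =>
    refine ⟨_, hF ⟨z, hz⟩, by simp, ?_⟩
    simp only [coeff_C_mul, coeff_X_one, mul_one]
    exact Submodule.subset_span ⟨⟨z, hz⟩, rfl⟩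
  | zero => exact ⟨0, by simp, by simp, by simp⟩
  | add z w _ _ hz hw =>
    obtain ⟨p, hp, hp0, hp1⟩ := hz
    obtain ⟨q, hq, hq0, hq1⟩ := hw
    refine ⟨p + q, by rw [map_add, ← hp, ← hq]; rfl, by simp [hp0, hq0], ?_⟩
    rw [coeff_add]
    exact add_mem hp1 hq1
  | smul r z _ hz =>
    obtain ⟨p, hp, hp0, hp1⟩ := hz
    obtain ⟨q, hq, b, hb⟩ := hcoeff r.1 r.2
    refine ⟨q * p, by rw [map_mul, ← hp, ← hq]; rfl, by simp [mul_coeff_zero, hp0], ?_⟩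
    rw [mul_coeff_one, hp0, mul_zero, add_zero, ← hb]
    have := Submodule.smul_mem _ b hp1
    rwa [Algebra.smul_def] at this

/-- Algebraic Hartogs: on a Noetherian normal domain, a fraction which is regular at all primes of
height one is regular. -/
theorem exists_algebraMap_eq_of_forall_height_eq_one {A K : Type*} [CommRing A] [IsDomain A]
    [IsNoetherianRing A] [IsIntegrallyClosed A] [Field K] [Algebra A K] [IsFractionRing A K]
    (f : K) (hf : ∀ (p : Ideal A) [p.IsPrime], p.height = 1 →
      ∃ u v : A, v ∉ p ∧ f * algebraMap A K v = algebraMap A K u) :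
    ∃ a : A, algebraMap A K a = f := by
  by_contra hn
  obtain ⟨a, b, hb, rfl⟩ := IsFractionRing.div_surjective (A := A) f
  have hb0 : b ≠ 0 := nonZeroDivisors.ne_zero hb
  have hbK : algebraMap A K b ≠ 0 := by simpa using hb0
  have hinj := IsFractionRing.injective A K
  let M := A ⧸ Ideal.span {b}
  have ha : (Ideal.Quotient.mk (Ideal.span {b}) a : M) ≠ 0 := by
    rw [Ne, Ideal.Quotient.eq_zero_iff_mem, Ideal.mem_span_singleton]
    rintro ⟨c, rfl⟩
    exact hn ⟨c, by rw [map_mul, mul_div_cancel_left₀ _ hbK]⟩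
  -- An associated prime p = (b : c) containing (b : a). It will turn out to have height one;
  -- regularity of a / b at p then yields v outside p with v a ∈ (b), which is absurd.
  obtain ⟨p, hp, hle⟩ := exists_le_isAssociatedPrime_of_isNoetherianRing A
    (Ideal.Quotient.mk (Ideal.span {b}) a : M) ha
  obtain ⟨hprime, c, hc⟩ := isAssociatedPrime_iff.1 hp
  obtain ⟨c, rfl⟩ := Ideal.Quotient.mk_surjective c
  have hmem : ∀ (r d : A), r • (Ideal.Quotient.mk (Ideal.span {b}) d : M) = 0 ↔ b ∣ r * d := by
    intro r d
    rw [← Ideal.mem_span_singleton, ← Ideal.Quotient.eq_zero_iff_mem, map_mul]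
    exact Iff.rfl
  have hpc : ∀ r, r ∈ p ↔ b ∣ r * c := by
    intro r
    rw [hc, Submodule.mem_colon_singleton, Submodule.mem_bot, hmem]
  have hpa : ∀ r, b ∣ r * a → r ∈ p := by
    intro r hr
    exact hle (Submodule.mem_colon_singleton.2 ((Submodule.mem_bot _).2 ((hmem r a).2 hr)))
  set g : K := algebraMap A K c / algebraMap A K b with hg
  have hgp : ∀ z ∈ p, ∃ w : A, algebraMap A K w = g * algebraMap A K z := by
    intro z hz
    obtain ⟨w, hw⟩ := (hpc z).1 hz
    refine ⟨w, ?_⟩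
    rw [hg, div_mul_eq_mul_div, eq_div_iff hbK, ← map_mul, ← map_mul, mul_comm w, ← hw, mul_comm]
  have hbp : b ∈ p := (hpc b).2 (dvd_mul_right _ _)
  -- Determinant trick: if g p ⊆ p, then g = c / b is integral, so it lies in `A`, and p = (b : c)
  -- is the unit ideal.
  obtain ⟨y, hy, w, hw, hwp⟩ : ∃ y ∈ p, ∃ w : A, algebraMap A K w = g * algebraMap A K y ∧ w ∉ p := by
    by_contra! H
    have hint : IsIntegral A g := by
      refine isIntegral_of_smul_mem_submodule (N := Submodule.map (Algebra.linearMap A K) p) ?_ ?_ g ?_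
      · intro h
        have : algebraMap A K b ∈ Submodule.map (Algebra.linearMap A K) p := ⟨b, hbp, rfl⟩
        rw [h] at this
        exact hbK this
      · exact (IsNoetherian.noetherian p).map _
      · rintro _ ⟨z, hz, rfl⟩
        obtain ⟨w, hw⟩ := hgp z hz
        exact ⟨w, H z hz w hw, hw⟩
    obtain ⟨d, hd⟩ := IsIntegrallyClosed.isIntegral_iff.1 hint
    refine hprime.ne_top ((Ideal.eq_top_iff_one _).2 ((hpc 1).2 ⟨d, hinj ?_⟩))
    rw [one_mul, map_mul, hd, hg, mul_div_cancel₀ _ hbK]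
  -- Since w z = u y with w outside p, the element y generates p locally; Krull's theorem then
  -- bounds the height.
  have hmin : p ∈ (Ideal.span {y}).minimalPrimes := by
    refine ⟨⟨hprime, by simpa [Ideal.span_le] using hy⟩, ?_⟩
    rintro q ⟨hq, hyq⟩ hqp z hz
    obtain ⟨u, hu⟩ := hgp z hz
    have h1 : w * z = u * y := hinj (by rw [map_mul, map_mul, hw, hu]; ring)
    have h2 : w * z ∈ q := by
      rw [h1]
      exact q.mul_mem_left _ (hyq (Ideal.mem_span_singleton_self y))
    exact (hq.mem_or_mem h2).resolve_left fun h => hwp (hqp h)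
  have hht : p.height = 1 := by
    refine le_antisymm (Ideal.height_le_one_of_isPrincipal_of_mem_minimalPrimes _ p hmin) ?_
    rw [Order.one_le_iff_ne_zero, Ne, Ideal.height_eq_zero_iff_eq_bot]
    rintro rfl
    exact hb0 hbp
  obtain ⟨u, v, hv, huv⟩ := hf p hht
  refine hv (hpa v ⟨u, hinj ?_⟩)
  rw [map_mul, map_mul, ← huv]
  field_simp

theorem finite_setOf_height_eq_one {A : Type*} [CommRing A] [IsDomain A] [IsNoetherianRing A]
    {h : A} (h0 : h ≠ 0) : {p : PrimeSpectrum A | p.asIdeal.height = 1 ∧ h ∈ p.asIdeal}.Finite := by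
  have hfin := Ideal.finite_minimalPrimes_of_isNoetherianRing A (Ideal.span {h})
  refine Set.Finite.of_finite_image (f := PrimeSpectrum.asIdeal) (hfin.subset ?_)
    (fun p _ q _ e => PrimeSpectrum.ext e)
  rintro _ ⟨p, ⟨h1, h2⟩, rfl⟩
  refine Ideal.mem_minimalPrimes_of_height_le (by simpa [Ideal.span_le] using h2) ?_
  rw [h1, Order.one_le_iff_ne_zero]
  rw [Ne, Ideal.height_eq_zero_iff_eq_bot, Ideal.span_singleton_eq_bot]
  exact h0

namespace K3Fibration

/-! ### Points of codimension one on an affine open. -/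

section AffineOpen

variable {X : Scheme.{0}}

theorem exists_germ_mul_eq {V : X.Opens} (hV : IsAffineOpen V) {x : X} (hx : x ∈ V)
    (f : X.presheaf.stalk x) :
    ∃ a b : Γ(X, V), IsUnit (X.presheaf.germ V x hx b) ∧
      f * X.presheaf.germ V x hx b = X.presheaf.germ V x hx a := by
  let := X.presheaf.algebra_section_stalk (⟨x, hx⟩ : V)
  have := hV.isLocalization_stalk ⟨x, hx⟩
  obtain ⟨⟨a, b⟩, h⟩ := IsLocalization.surj (hV.primeIdealOf ⟨x, hx⟩).asIdeal.primeCompl f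
  exact ⟨a, b, IsLocalization.map_units (X.presheaf.stalk x) b, h⟩

theorem mem_primeIdealOf_iff {V : X.Opens} (hV : IsAffineOpen V) {x : X} (hx : x ∈ V) (a : Γ(X, V)) :
    a ∈ (hV.primeIdealOf ⟨x, hx⟩).asIdeal ↔ ¬ IsUnit (X.presheaf.germ V x hx a) := by
  let := X.presheaf.algebra_section_stalk (⟨x, hx⟩ : V)
  have := hV.isLocalization_stalk ⟨x, hx⟩
  have h := IsLocalization.AtPrime.isUnit_to_map_iff (X.presheaf.stalk x)
    (hV.primeIdealOf ⟨x, hx⟩).asIdeal a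
  rw [← not_iff_not, not_not]
  exact h.symm

theorem height_primeIdealOf {V : X.Opens} (hV : IsAffineOpen V) {x : X} (hx : x ∈ V) :
    (hV.primeIdealOf ⟨x, hx⟩).asIdeal.height = Order.coheight x := by
  let := X.presheaf.algebra_section_stalk (⟨x, hx⟩ : V)
  have := hV.isLocalization_stalk ⟨x, hx⟩
  have h := IsLocalization.AtPrime.ringKrullDim_eq_height (hV.primeIdealOf ⟨x, hx⟩).asIdeal
    (X.presheaf.stalk x)
  rw [ringKrullDim_stalk_eq_coheight] at h
  exact (WithBot.coe_injective h).symm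

theorem exists_primeIdealOf_eq {V : X.Opens} (hV : IsAffineOpen V) (P : PrimeSpectrum Γ(X, V)) :
    ∃ (x : X) (hx : x ∈ V), hV.primeIdealOf ⟨x, hx⟩ = P := by
  refine ⟨(hV.isoSpec.inv P).1, (hV.isoSpec.inv P).2, ?_⟩
  change (hV.isoSpec.inv ≫ hV.isoSpec.hom) P = P
  rw [Iso.inv_hom_id]
  rfl

variable [AlgebraicGeometry.IsIntegral X]

theorem isIntegrallyClosed_of_isAffineOpen {V : X.Opens} (hV : IsAffineOpen V) [Nonempty V]
    (hnormal : ∀ x : X, IsIntegrallyClosed (X.presheaf.stalk x)) :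
    IsIntegrallyClosed Γ(X, V) := by
  refine IsIntegrallyClosed.of_localization_maximal fun P _ _ => ?_
  obtain ⟨x, hx, h⟩ := exists_primeIdealOf_eq hV ⟨P, inferInstance⟩
  let := X.presheaf.algebra_section_stalk (⟨x, hx⟩ : V)
  have := hV.isLocalization_stalk ⟨x, hx⟩
  rw [h] at this
  exact IsIntegrallyClosed.of_equiv (IsLocalization.algEquiv P.primeCompl (X.presheaf.stalk x)
    (Localization.AtPrime P)).toRingEquiv

/-- A rational function on a normal scheme is regular on an affine open if it is regular in
codimension one. -/
theorem exists_germToFunctionField_eq {V : X.Opens} (hV : IsAffineOpen V) [Nonempty V]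
    [IsNoetherianRing Γ(X, V)]
    (hnormal : ∀ x : X, IsIntegrallyClosed (X.presheaf.stalk x)) (f : X.functionField)
    (hf : ∀ x ∈ V, Order.coheight x = 1 →
      f ∈ (algebraMap (X.presheaf.stalk x) X.functionField).range) :
    ∃ a, X.germToFunctionField V a = f := by
  have := isIntegrallyClosed_of_isAffineOpen hV hnormal
  have := functionField_isFractionRing_of_isAffineOpen X V hV
  refine exists_algebraMap_eq_of_forall_height_eq_one (A := Γ(X, V)) f fun p hp hp1 => ?_
  obtain ⟨x, hx, h⟩ := exists_primeIdealOf_eq hV ⟨p, hp⟩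
  have hx1 : Order.coheight x = 1 := by rw [← height_primeIdealOf hV hx, h, hp1]
  obtain ⟨g, rfl⟩ := hf x hx hx1
  obtain ⟨a, b, hb, hab⟩ := exists_germ_mul_eq hV hx g
  refine ⟨a, b, fun hbp => ?_, ?_⟩
  · have : b ∈ (hV.primeIdealOf ⟨x, hx⟩).asIdeal := by rw [h]; exact hbp
    exact (mem_primeIdealOf_iff hV hx b).1 this hb
  · have := congr(algebraMap (X.presheaf.stalk x) X.functionField $hab)
    rw [map_mul, Scheme.algebraMap_germ_eq_germToFunctionField,
      Scheme.algebraMap_germ_eq_germToFunctionField] at this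
    exact this

theorem finite_setOf_coheight_eq_one {V : X.Opens} (hV : IsAffineOpen V) [Nonempty V]
    [IsNoetherianRing Γ(X, V)] {h : Γ(X, V)}
    (h0 : h ≠ 0) :
    {x : X | Order.coheight x = 1 ∧ ∃ hx : x ∈ V, ¬ IsUnit (X.presheaf.germ V x hx h)}.Finite := by
  refine ((finite_setOf_height_eq_one h0).image (fun P => hV.fromSpec P)).subset ?_
  rintro x ⟨hx1, hx, hu⟩
  refine ⟨hV.primeIdealOf ⟨x, hx⟩, ⟨?_, (mem_primeIdealOf_iff hV hx h).2 hu⟩, ?_⟩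
  · rw [height_primeIdealOf hV hx, hx1]
  · exact hV.fromSpec_primeIdealOf ⟨x, hx⟩

end AffineOpen

theorem isDiscreteValuationRing_stalk {X : Scheme.{0}} [AlgebraicGeometry.IsIntegral X]
    [IsLocallyNoetherian X]
    (hnormal : ∀ x : X, IsIntegrallyClosed (X.presheaf.stalk x)) (x : X)
    (hx : Order.coheight x = 1) : IsDiscreteValuationRing (X.presheaf.stalk x) := by
  have := hnormal x
  have hd := ringKrullDim_stalk_eq_coheight x
  rw [hx] at hd
  have h0 : ¬ IsField (X.presheaf.stalk x) := by
    intro h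
    rw [ringKrullDim_eq_zero_of_isField h] at hd
    exact absurd hd (by decide)
  have : IsDedekindRing (X.presheaf.stalk x) :=
    { maximalOfPrime := fun {p} hp0 hp => by
        have := krullDimLE_of_coheight_le hx.le
        exact Ring.krullDimLE_one_iff_of_isPrime_bot.1 this p hp0 hp
      toIsIntegralClosure := (isIntegrallyClosed_iff_isIntegralClosure _).1 (hnormal x) }
  have hdd : IsDedekindDomain (X.presheaf.stalk x) := { }
  exact ((IsDiscreteValuationRing.TFAE (X.presheaf.stalk x) h0).out 0 2).2 hdd

/-! ### Differential forms: finite sets of generators. -/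

/-- `φ` is linear over `K` while the coefficients lie in `O`, which acts through `K`. The induction
is on the set of slots whose entry is not yet in `S`. -/
theorem multilinear_mem_span {O K M P ι : Type*} [CommRing O] [CommRing K] [Algebra O K]
    [AddCommGroup M] [Module K M] [Module O M] [IsScalarTower O K M] [AddCommGroup P] [Module K P]
    [Module O P] [IsScalarTower O K P] [Fintype ι] [DecidableEq ι]
    (φ : MultilinearMap K (fun _ : ι => M) P) (S : Set M) (v : ι → M)
    (hv : ∀ j, v j ∈ Submodule.span O S) :
    φ v ∈ Submodule.span O (φ '' {u | ∀ j, u j ∈ S}) := by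
  suffices H : ∀ (s : Finset ι) (v : ι → M), (∀ j, v j ∈ Submodule.span O S) →
      (∀ j ∉ s, v j ∈ S) → φ v ∈ Submodule.span O (φ '' {u | ∀ j, u j ∈ S}) from
    H Finset.univ v hv fun j hj => absurd (Finset.mem_univ j) hj
  intro s
  induction s using Finset.induction_on with
  | empty => exact fun v _ h => Submodule.subset_span ⟨v, fun j => h j (by simp), rfl⟩
  | insert i s hi ih =>
    intro v hv h
    suffices H : ∀ m ∈ Submodule.span O S, φ (Function.update v i m) ∈
        Submodule.span O (φ '' {u | ∀ j, u j ∈ S}) by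
      have := H _ (hv i)
      rwa [Function.update_eq_self] at this
    intro m hm
    induction hm using Submodule.span_induction with
    | mem m hm =>
      refine ih _ (fun j => ?_) (fun j hj => ?_)
      · rcases eq_or_ne j i with rfl | hji
        · simpa using Submodule.subset_span hm
        · simpa [hji] using hv j
      · rcases eq_or_ne j i with rfl | hji
        · simpa using hm
        · simpa [hji] using h j (by simp [hji, hj])
    | zero => rw [MultilinearMap.map_update_zero]; exact zero_mem _
    | add a b _ _ ha hb => rw [MultilinearMap.map_update_add]; exact add_mem ha hb
    | smul r a _ ha =>
      rw [← algebraMap_smul K r a, MultilinearMap.map_update_smul, algebraMap_smul]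
      exact Submodule.smul_mem _ _ ha

/-- By the Leibniz rule the differential of a polynomial in the generators is a combination of their
differentials with coefficients from `A`, which `hO` places in `O`. Below, `O` is a stalk or the
function field itself. -/
theorem D_algebraMap_mem_span {k A K O : Type*} [CommRing k] [CommRing A] [CommRing O] [Field K]
    [Algebra k A] [Algebra k K] [Algebra A K] [IsScalarTower k A K] [Algebra O K]
    (t : Set A) (ht : Algebra.adjoin k t = ⊤)
    (hO : ∀ a : A, algebraMap A K a ∈ (algebraMap O K).range) (a : A) :
    KaehlerDifferential.D k K (algebraMap A K a) ∈
      Submodule.span O ((fun a => KaehlerDifferential.D k K (algebraMap A K a)) '' t) := by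
  have ha : a ∈ Algebra.adjoin k t := ht ▸ Algebra.mem_top
  induction ha using Algebra.adjoin_induction with
  | mem x hx => exact Submodule.subset_span ⟨x, hx, rfl⟩
  | algebraMap r =>
    rw [← IsScalarTower.algebraMap_apply, Derivation.map_algebraMap]
    exact zero_mem _
  | add x y _ _ hx hy => rw [map_add, map_add]; exact add_mem hx hy
  | mul x y _ _ hx hy =>
    obtain ⟨x', hx'⟩ := hO x
    obtain ⟨y', hy'⟩ := hO y
    rw [map_mul, Derivation.leibniz, ← hx', ← hy', algebraMap_smul, algebraMap_smul, hx', hy']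
    exact add_mem (Submodule.smul_mem _ _ hy) (Submodule.smul_mem _ _ hx)

/-- The quotient rule df = v⁻¹ (du - f dv) for f = u / v, with both coefficients in `O`. -/
theorem D_mem_span_of_mul_eq {k K O : Type*} [CommRing k] [CommRing O] [Field K] [Algebra k K]
    [Algebra O K] (N : Submodule O Ω[K⁄k])
    {f u v : K} (hf : f ∈ (algebraMap O K).range) (hv : v⁻¹ ∈ (algebraMap O K).range) (hv0 : v ≠ 0)
    (h : f * v = u) (hu' : KaehlerDifferential.D k K u ∈ N)
    (hv' : KaehlerDifferential.D k K v ∈ N) :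
    KaehlerDifferential.D k K f ∈ N := by
  obtain ⟨f', hf'⟩ := hf
  obtain ⟨v', hv1⟩ := hv
  have h1 : KaehlerDifferential.D k K u = f • KaehlerDifferential.D k K v +
      v • KaehlerDifferential.D k K f := by rw [← h, Derivation.leibniz]
  have h2 : KaehlerDifferential.D k K f = v' • (KaehlerDifferential.D k K u -
      f' • KaehlerDifferential.D k K v) := by
    rw [← algebraMap_smul K v', ← algebraMap_smul K f', hv1, hf', h1, add_sub_cancel_left, smul_smul,
      inv_mul_cancel₀ hv0, one_smul]
  rw [h2]
  exact N.smul_mem _ (N.sub_mem hu' (N.smul_mem _ hv'))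

section Forms

variable {X : Scheme.{0}} [AlgebraicGeometry.IsIntegral X] (p : X ⟶ Spec (CommRingCat.of ℂ))

instance (x : X) : IsScalarTower (X.presheaf.stalk x) (FunField p) (RatPluriform p) :=
  .of_algebraMap_eq' rfl

instance (x : X) : IsFractionRing (X.presheaf.stalk x) (FunField p) :=
  inferInstanceAs (IsFractionRing (X.presheaf.stalk x) X.functionField)

/-- The rational `3`-forms `df₁ ∧ df₂ ∧ df₃`, where the `f_i` range over a set of functions. -/
def formsOf (S : Set (FunField p)) : Set (RatPluriform p) :=
  {y | ∃ f : Fin 3 → FunField p, (∀ j, f j ∈ S) ∧ y = ofForm p (exteriorPower.ιMulti (FunField p) 3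
    fun j => KaehlerDifferential.D ℂ (FunField p) (f j))}

theorem finite_formsOf {S : Set (FunField p)} (hS : S.Finite) : (formsOf p S).Finite := by
  have := hS.to_subtype
  refine (Set.finite_range fun f : Fin 3 → S => ofForm p (exteriorPower.ιMulti (FunField p) 3
    fun j => KaehlerDifferential.D ℂ (FunField p) (f j))).subset ?_
  rintro _ ⟨f, hf, rfl⟩
  exact ⟨fun j => ⟨f j, hf j⟩, rfl⟩

/-- `ofForm` of a decomposable form as a multilinear map. -/
noncomputable def formMultilinear :
    MultilinearMap (FunField p) (fun _ : Fin 3 => Ω[FunField p⁄ℂ]) (RatPluriform p) :=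
  (ofForm p).compMultilinearMap (exteriorPower.ιMulti (FunField p) 3).toMultilinearMap

theorem mem_span_formsOf {O : Type*} [CommRing O] [Algebra O (FunField p)]
    [Module O (RatPluriform p)] [IsScalarTower O (FunField p) (RatPluriform p)]
    (S : Set (FunField p)) (v : Fin 3 → Ω[FunField p⁄ℂ])
    (hv : ∀ j, v j ∈ Submodule.span O (KaehlerDifferential.D ℂ (FunField p) '' S)) :
    formMultilinear p v ∈ Submodule.span O (formsOf p S) := by
  refine Submodule.span_mono ?_ (multilinear_mem_span (formMultilinear p) _ v hv)
  rintro _ ⟨u, hu, rfl⟩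
  choose f hf hfu using hu
  refine ⟨f, hf, ?_⟩
  simp only [hfu]
  rfl

theorem range_ofForm_le_span (S : Set (FunField p))
    (hS : ∀ f : FunField p, KaehlerDifferential.D ℂ (FunField p) f ∈
      Submodule.span (FunField p) (KaehlerDifferential.D ℂ (FunField p) '' S)) :
    LinearMap.range (ofForm p) ≤ Submodule.span (FunField p) (formsOf p S) := by
  rw [LinearMap.range_eq_map, ← exteriorPower.ιMulti_span, Submodule.map_span, Submodule.span_le]
  rintro _ ⟨_, ⟨v, rfl⟩, rfl⟩
  refine mem_span_formsOf p S v fun j => ?_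
  have h : (⊤ : Submodule (FunField p) Ω[FunField p⁄ℂ]) ≤
      Submodule.span (FunField p) (KaehlerDifferential.D ℂ (FunField p) '' S) := by
    rw [← KaehlerDifferential.span_range_derivation, Submodule.span_le]
    rintro _ ⟨f, rfl⟩
    exact hS f
  exact h trivial

theorem formsOf_subset (S : Set (FunField p)) : formsOf p S ⊆ LinearMap.range (ofForm p) := by
  rintro _ ⟨f, -, rfl⟩
  exact ⟨_, rfl⟩

end Forms
section ComplexScheme

/-- The ring of sections of a complex scheme as a complex algebra. -/
@[reducible]
noncomputable def sectionsAlgebra {X : Scheme.{0}} (p : X ⟶ Spec (CommRingCat.of ℂ))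
    (V : X.Opens) : Algebra ℂ Γ(X, V) :=
  ((Scheme.ΓSpecIso (CommRingCat.of ℂ)).inv ≫ p.appLE ⊤ V le_top).hom.toAlgebra

theorem finiteType_sections {X : Scheme.{0}} (p : X ⟶ Spec (CommRingCat.of ℂ))
    [LocallyOfFiniteType p] {V : X.Opens} (hV : IsAffineOpen V) :
    letI := sectionsAlgebra p V
    Algebra.FiniteType ℂ Γ(X, V) := by
  let := sectionsAlgebra p V
  have h := p.finiteType_appLE (isAffineOpen_top (Spec (CommRingCat.of ℂ))) hV le_top
  have h1 : RingHom.FiniteType ((Scheme.ΓSpecIso (CommRingCat.of ℂ)).inv.hom) :=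
    RingHom.FiniteType.of_surjective _
      (ConcreteCategory.bijective_of_isIso (Scheme.ΓSpecIso (CommRingCat.of ℂ)).inv).2
  exact h.comp h1

theorem isNoetherianRing_sections {X : Scheme.{0}} (p : X ⟶ Spec (CommRingCat.of ℂ))
    [LocallyOfFiniteType p] {V : X.Opens} (hV : IsAffineOpen V) :
    IsNoetherianRing Γ(X, V) := by
  let := sectionsAlgebra p V
  have := finiteType_sections p hV
  exact Algebra.FiniteType.isNoetherianRing ℂ _

variable {X : Scheme.{0}} [AlgebraicGeometry.IsIntegral X] (p : X ⟶ Spec (CommRingCat.of ℂ))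

noncomputable instance (V : X.Opens) [Nonempty V] : Algebra Γ(X, V) (FunField p) :=
  inferInstanceAs (Algebra Γ(X, V) X.functionField)

theorem isScalarTower_sections (V : X.Opens) [Nonempty V] :
    letI := sectionsAlgebra p V
    IsScalarTower ℂ Γ(X, V) (FunField p) := by
  let := sectionsAlgebra p V
  refine .of_algebraMap_eq' ?_
  have : (Scheme.ΓSpecIso (CommRingCat.of ℂ)).inv ≫ p.appTop ≫
      X.presheaf.germ ⊤ (genericPoint X) trivial =
      ((Scheme.ΓSpecIso (CommRingCat.of ℂ)).inv ≫ p.appLE ⊤ V le_top) ≫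
        X.germToFunctionField V := by
    simp only [Category.assoc, Scheme.Hom.appLE, TopCat.Presheaf.germ_res]
    rfl
  exact congr(($this).hom)

theorem algebraMap_stalk_germ {V : X.Opens} [Nonempty V] {x : X} (hx : x ∈ V) (a : Γ(X, V)) :
    algebraMap (X.presheaf.stalk x) (FunField p) (X.presheaf.germ V x hx a) =
      algebraMap Γ(X, V) (FunField p) a :=
  Scheme.algebraMap_germ_eq_germToFunctionField X hx a

theorem isFractionRing_sections {V : X.Opens} (hV : IsAffineOpen V) [Nonempty V] :
    IsFractionRing Γ(X, V) (FunField p) :=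
  functionField_isFractionRing_of_isAffineOpen X V hV

/-- The finite set of forms generating the canonical germs at the points of an affine open. -/
theorem exists_finite_forms [LocallyOfFiniteType p] {V : X.Opens} (hV : IsAffineOpen V)
    [Nonempty V] : ∃ Θ : Set (RatPluriform p), Θ.Finite ∧
      LinearMap.range (ofForm p) = Submodule.span (FunField p) Θ ∧
      ∀ x ∈ V, ∀ w ∈ canonicalGerm p x,
        ofForm p w ∈ Submodule.span (X.presheaf.stalk x) Θ := by
  let := sectionsAlgebra p V
  have := isScalarTower_sections p V
  have hfrac := isFractionRing_sections p hV
  obtain ⟨t, ht⟩ := (finiteType_sections p hV).out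
  let S : Set (FunField p) := algebraMap Γ(X, V) (FunField p) '' t
  have himg : (fun a => KaehlerDifferential.D ℂ (FunField p) (algebraMap Γ(X, V) (FunField p) a)) ''
      t = KaehlerDifferential.D ℂ (FunField p) '' S := (Set.image_image _ _ _).symm
  refine ⟨formsOf p S, finite_formsOf p (t.finite_toSet.image _), ?_, ?_⟩
  · refine le_antisymm (range_ofForm_le_span p S fun f => ?_)
      (Submodule.span_le.2 (formsOf_subset p S))
    have hA := D_algebraMap_mem_span (K := FunField p) (O := FunField p) (t : Set Γ(X, V)) ht
      (fun a => ⟨_, rfl⟩)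
    rw [himg] at hA
    obtain ⟨u, v, hv, rfl⟩ := IsFractionRing.div_surjective (A := Γ(X, V)) f
    have hv0 : algebraMap Γ(X, V) (FunField p) v ≠ 0 := by
      simpa using nonZeroDivisors.ne_zero hv
    exact D_mem_span_of_mul_eq _ (u := algebraMap Γ(X, V) (FunField p) u) ⟨_, rfl⟩ ⟨_, rfl⟩ hv0
      (div_mul_cancel₀ _ hv0) (hA u) (hA v)
  · rintro x hx w ⟨m, g, f, rfl⟩
    have hA := D_algebraMap_mem_span (O := X.presheaf.stalk x) (t : Set Γ(X, V)) ht
      (fun a => ⟨_, algebraMap_stalk_germ p hx a⟩)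
    rw [himg] at hA
    rw [map_sum]
    refine Submodule.sum_mem _ fun i _ => ?_
    rw [map_smul, algebraMap_smul]
    refine Submodule.smul_mem _ _ ?_
    refine mem_span_formsOf p S _ fun j => ?_
    -- A germ at `x` is u / v with sections u, v over `V` and v a unit at `x`, so the generators of
    -- the ring of sections serve all `x` in `V` at once.
    obtain ⟨u, v, hv, huv⟩ := exists_germ_mul_eq hV hx (f i j)
    refine D_mem_span_of_mul_eq _ (u := algebraMap Γ(X, V) (FunField p) u)
      (v := algebraMap Γ(X, V) (FunField p) v) ⟨_, rfl⟩ ?_ ?_ ?_ (hA u) (hA v)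
    · obtain ⟨v', hv'⟩ := hv
      refine ⟨(v'⁻¹ : (X.presheaf.stalk x)ˣ), ?_⟩
      rw [map_units_inv, hv', algebraMap_stalk_germ]
    · rw [← algebraMap_stalk_germ p hx]
      exact (hv.map _).ne_zero
    · rw [← algebraMap_stalk_germ p hx, ← algebraMap_stalk_germ p hx, ← map_mul, huv]

/-- Every rational function is a fraction of germs at `x`, so the quotient rule applies.
Consequently any rational form can be multiplied into the germ at `x`. -/
theorem range_ofForm_le_span_canonicalGerm (x : X) :
    LinearMap.range (ofForm p) ≤
      Submodule.span (FunField p) (ofForm p '' canonicalGerm p x) := by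
  refine (range_ofForm_le_span p (Set.range (algebraMap (X.presheaf.stalk x) (FunField p)))
    fun f => ?_).trans (Submodule.span_mono ?_)
  · obtain ⟨u, v, hv, rfl⟩ := IsFractionRing.div_surjective (A := X.presheaf.stalk x) f
    have hv0 : algebraMap (X.presheaf.stalk x) (FunField p) v ≠ 0 := by
      simpa using nonZeroDivisors.ne_zero hv
    exact D_mem_span_of_mul_eq _ ⟨_, rfl⟩ ⟨_, rfl⟩ hv0 (div_mul_cancel₀ _ hv0)
      (Submodule.subset_span ⟨_, ⟨u, rfl⟩, rfl⟩) (Submodule.subset_span ⟨_, ⟨v, rfl⟩, rfl⟩)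
  · rintro _ ⟨f, hf, rfl⟩
    choose g hg using hf
    refine ⟨_, ⟨1, fun _ => 1, fun _ => g, rfl⟩, ?_⟩
    simp [hg]

end ComplexScheme
-- Zeros and poles of twisted pluricanonical forms.
section ComplexScheme

variable {X : Scheme.{0}} [AlgebraicGeometry.IsIntegral X] (p : X ⟶ Spec (CommRingCat.of ℂ))

theorem finite_support_inter {X : Scheme.{0}} (D : WeilDivisor X) {V : X.Opens} (hV : IsAffineOpen V) :
    {x : X | x ∈ V ∧ D.1 x ≠ 0}.Finite :=
  D.1.locallyFiniteSupport.finite_inter_support_of_isCompact hV.isCompact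

/-- A nonzero function clearing the poles of `𝒪_X(D)` on an affine open. -/
theorem exists_clear_divisor [IsLocallyNoetherian X]
    (hnormal : ∀ x : X, IsIntegrallyClosed (X.presheaf.stalk x)) (D : WeilDivisor X)
    {V : X.Opens} (hV : IsAffineOpen V) [Nonempty V] :
    ∃ c : Γ(X, V), c ≠ 0 ∧ ∀ x ∈ V, Order.coheight x = 1 → ∀ f ∈ divisorialGerm p D x,
      algebraMap Γ(X, V) (FunField p) c * f ∈
        (algebraMap (X.presheaf.stalk x) (FunField p)).range := by
  classical
  have hfin := finite_support_inter D hV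
  have hfrac := isFractionRing_sections p hV
  have hh : ∀ x : X, ∃ h : Γ(X, V), h ≠ 0 ∧ ∀ (hx : x ∈ V), Order.coheight x = 1 →
      ¬ IsUnit (X.presheaf.germ V x hx h) := by
    intro x
    by_cases hx : x ∈ V ∧ Order.coheight x = 1
    · have hp : (hV.primeIdealOf ⟨x, hx.1⟩).asIdeal ≠ ⊥ :=
        Ideal.ne_bot_of_height_eq_one ((height_primeIdealOf hV hx.1).trans hx.2)
      obtain ⟨h, hmem, h0⟩ := Submodule.exists_mem_ne_zero_of_ne_bot hp
      exact ⟨h, h0, fun _ _ => (mem_primeIdealOf_iff hV hx.1 h).1 hmem⟩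
    · exact ⟨1, one_ne_zero, fun h1 h2 => absurd ⟨h1, h2⟩ hx⟩
  choose h h0 hu using hh
  -- `h x` vanishes at `x`, so the factor belonging to `x` absorbs a pole of order `D x`; when `D x`
  -- is negative there is no pole to absorb and the factor is harmless.
  refine ⟨∏ x ∈ hfin.toFinset, h x ^ (D.1 x).natAbs,
    Finset.prod_ne_zero_iff.2 fun x _ => pow_ne_zero _ (h0 x), ?_⟩
  rintro x hx hx1 _ ⟨ϖ, g, hϖ, rfl⟩
  have hdvr := isDiscreteValuationRing_stalk hnormal x hx1
  have hϖ0 : algebraMap (X.presheaf.stalk x) (FunField p) ϖ ≠ 0 := by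
    simpa using hϖ.ne_zero
  have hdvd : ϖ ^ (D.1 x).natAbs ∣
      X.presheaf.germ V x hx (∏ y ∈ hfin.toFinset, h y ^ (D.1 y).natAbs) := by
    by_cases hD : D.1 x = 0
    · simp [hD]
    · have hmem : x ∈ hfin.toFinset := by simpa using ⟨hx, hD⟩
      rw [← Finset.mul_prod_erase _ _ hmem, map_mul, map_pow]
      refine dvd_mul_of_dvd_left (pow_dvd_pow_of_dvd ?_ _) _
      have h1 : X.presheaf.germ V x hx (h x) ∈ IsLocalRing.maximalIdeal (X.presheaf.stalk x) :=
        hu x hx hx1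
      rwa [hϖ.maximalIdeal_eq, Ideal.mem_span_singleton] at h1
  obtain ⟨r, hr⟩ := hdvd
  rw [← algebraMap_stalk_germ p hx, hr]
  have hpow : algebraMap (X.presheaf.stalk x) (FunField p) ϖ ^ (D.1 x).natAbs *
      algebraMap (X.presheaf.stalk x) (FunField p) ϖ ^ (-(D.1 x)) =
      algebraMap (X.presheaf.stalk x) (FunField p) ϖ ^ ((D.1 x).natAbs - D.1 x).toNat := by
    rw [← zpow_natCast, ← zpow_add₀ hϖ0, ← zpow_natCast]
    congr 1
    omega
  refine ⟨r * g * ϖ ^ ((D.1 x).natAbs - D.1 x).toNat, ?_⟩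
  rw [map_mul, map_mul, map_pow, ← hpow, map_mul, map_pow]
  ring

-- A single denominator serves all codimension-one points of `V`. A power of the function clearing
-- 𝒪(D) moves the n-th power of the germ into the span of `Θ ^ n`, for one finite set `Θ` of forms,
-- and a common denominator of `l` on that finite set does the rest.
open scoped Pointwise in
theorem exists_denominator [LocallyOfFiniteType p]
    (hnormal : ∀ x : X, IsIntegrallyClosed (X.presheaf.stalk x)) (D : WeilDivisor X)
    {V : X.Opens} (hV : IsAffineOpen V) [Nonempty V] (n : ℕ)
    (l : RatPluriform p →ₗ[FunField p] FunField p) :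
    ∃ c : Γ(X, V), c ≠ 0 ∧ ∀ x ∈ V, Order.coheight x = 1 →
      ∀ a ∈ twistedCanonicalGerm p D x ^ n, algebraMap Γ(X, V) (FunField p) c * l a ∈
        (algebraMap (X.presheaf.stalk x) (FunField p)).range := by
  have := LocallyOfFiniteType.isLocallyNoetherian p
  have hfrac := isFractionRing_sections p hV
  obtain ⟨c, hc0, hc⟩ := exists_clear_divisor p hnormal D hV
  obtain ⟨Θ, hΘ, -, hΘV⟩ := exists_finite_forms p hV
  have hfin : (Θ ^ n).Finite := by
    induction n with
    | zero => rw [pow_zero]; exact Set.finite_one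
    | succ n ih => rw [pow_succ]; exact ih.mul hΘ
  obtain ⟨d, hd⟩ := IsLocalization.exist_integer_multiples_of_finset
    (nonZeroDivisors Γ(X, V)) (hfin.image l).toFinset
  refine ⟨d * c ^ n, mul_ne_zero (nonZeroDivisors.ne_zero d.2) (pow_ne_zero n hc0), ?_⟩
  intro x hx hx1 a ha
  have h1 : ∀ a ∈ twistedCanonicalGerm p D x,
      X.presheaf.germ V x hx c • a ∈ Submodule.span (X.presheaf.stalk x) Θ := by
    intro a ha
    induction ha using Submodule.span_induction with
    | mem a ha =>
      obtain ⟨f, hf, w, hw, rfl⟩ := ha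
      obtain ⟨g, hg⟩ := hc x hx hx1 f hf
      have : X.presheaf.germ V x hx c • ofForm p (f • w) = g • ofForm p w := by
        rw [map_smul, ← algebraMap_smul (FunField p) (X.presheaf.germ V x hx c),
          ← algebraMap_smul (FunField p) g, hg, smul_smul, algebraMap_stalk_germ]
      rw [this]
      exact Submodule.smul_mem _ _ (hΘV x hx w hw)
    | zero => rw [smul_zero]; exact zero_mem _
    | add a b _ _ ha hb => rw [smul_add]; exact add_mem ha hb
    | smul r a _ ha => rw [smul_comm]; exact Submodule.smul_mem _ _ ha
  have h2 : ∀ (m : ℕ), ∀ a ∈ twistedCanonicalGerm p D x ^ m,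
      X.presheaf.germ V x hx c ^ m • a ∈ Submodule.span (X.presheaf.stalk x) Θ ^ m := by
    intro m
    induction m with
    | zero => intro a ha; simpa using ha
    | succ m ih =>
      intro a ha
      rw [pow_succ] at ha
      induction ha using Submodule.mul_induction_on' with
      | mem_mul_mem a ha b hb =>
        rw [pow_succ, pow_succ, mul_smul_mul_comm]
        exact Submodule.mul_mem_mul (ih a ha) (h1 b hb)
      | add a _ b _ ha hb => rw [smul_add]; exact add_mem ha hb
  have h3 := h2 n a ha
  rw [Submodule.span_pow] at h3
  have h4 : ∀ y ∈ Submodule.span (X.presheaf.stalk x) (Θ ^ n),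
      algebraMap Γ(X, V) (FunField p) d * l y ∈
        (algebraMap (X.presheaf.stalk x) (FunField p)).range := by
    intro y hy
    induction hy using Submodule.span_induction with
    | mem y hy =>
      obtain ⟨z, hz⟩ := hd (l y) (by simpa using ⟨y, hy, rfl⟩)
      refine ⟨X.presheaf.germ V x hx z, ?_⟩
      rw [algebraMap_stalk_germ, hz, Algebra.smul_def]
    | zero => rw [map_zero, mul_zero]; exact zero_mem _
    | add a b _ _ ha hb => rw [map_add, mul_add]; exact add_mem ha hb
    | smul r a _ ha =>
      rw [← algebraMap_smul (FunField p) r a, map_smul, smul_eq_mul, mul_left_comm]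
      exact mul_mem ⟨r, rfl⟩ ha
  have h5 := h4 _ h3
  rw [← algebraMap_smul (FunField p) (X.presheaf.germ V x hx c ^ n) a, map_smul, map_pow,
    algebraMap_stalk_germ, smul_eq_mul] at h5
  rwa [map_mul, map_pow, mul_assoc]

theorem twistedCanonicalGerm_le (D : WeilDivisor X) (x : X) {a : RatPluriform p}
    (ha : a ∈ twistedCanonicalGerm p D x) : a ∈ LinearMap.range (ofForm p) := by
  induction ha using Submodule.span_induction with
  | mem a ha =>
    obtain ⟨f, hf, w, hw, rfl⟩ := ha
    exact ⟨_, rfl⟩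
  | zero => exact zero_mem _
  | add a b _ _ ha hb => exact add_mem ha hb
  | smul r a _ ha =>
    rw [← algebraMap_smul (FunField p) r a]
    exact Submodule.smul_mem _ _ ha

theorem twistedCanonicalGerm_pow_le (D : WeilDivisor X) (x : X) (n : ℕ)
    {a : RatPluriform p} (ha : a ∈ twistedCanonicalGerm p D x ^ n) :
    a ∈ LinearMap.range (ofForm p) ^ n := by
  induction n generalizing a with
  | zero =>
    rw [pow_zero, Submodule.mem_one] at ha ⊢
    obtain ⟨y, rfl⟩ := ha
    exact ⟨algebraMap _ _ y, rfl⟩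
  | succ n ih =>
    rw [pow_succ] at ha ⊢
    induction ha using Submodule.mul_induction_on' with
    | mem_mul_mem a ha b hb =>
      exact Submodule.mul_mem_mul (ih ha) (twistedCanonicalGerm_le p D x hb)
    | add a _ b _ ha hb => exact add_mem ha hb

open scoped Pointwise in
/-- Multiplying by a high power of a function vanishing at a point of codimension one removes the
pole of a rational pluricanonical form. -/
theorem exists_pow_smul_mem_twistedCanonicalGerm [IsLocallyNoetherian X]
    (hnormal : ∀ x : X, IsIntegrallyClosed (X.presheaf.stalk x)) (D : WeilDivisor X) (x : X)
    (hx : Order.coheight x = 1) (n : ℕ) {a : RatPluriform p}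
    (ha : a ∈ LinearMap.range (ofForm p) ^ n) (h : X.presheaf.stalk x) (hh : ¬ IsUnit h) :
    ∃ N : ℕ, ∀ m, N ≤ m → h ^ m • a ∈ twistedCanonicalGerm p D x ^ n := by
  have hdvr := isDiscreteValuationRing_stalk hnormal x hx
  obtain ⟨ϖ, hϖ⟩ := IsDiscreteValuationRing.exists_irreducible (X.presheaf.stalk x)
  have hϖ0 : algebraMap (X.presheaf.stalk x) (FunField p) ϖ ≠ 0 := by
    simpa using hϖ.ne_zero
  set M := twistedCanonicalGerm p D x
  have h1 : LinearMap.range (ofForm p) ≤ Submodule.span (FunField p) (M : Set (RatPluriform p)) := by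
    refine (range_ofForm_le_span_canonicalGerm p x).trans (Submodule.span_le.2 ?_)
    rintro _ ⟨w, hw, rfl⟩
    set f := algebraMap (X.presheaf.stalk x) (FunField p) ϖ ^ (-(D.1 x))
    have hf0 : f ≠ 0 := zpow_ne_zero _ hϖ0
    have hf : f ∈ divisorialGerm p D x := ⟨ϖ, 1, hϖ, by rw [map_one, one_mul]⟩
    have hM : ofForm p (f • w) ∈ Submodule.span (FunField p) (M : Set (RatPluriform p)) :=
      Submodule.subset_span (Submodule.subset_span ⟨f, hf, w, hw, rfl⟩)
    have := Submodule.smul_mem _ f⁻¹ hM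
    rwa [map_smul, smul_smul, inv_mul_cancel₀ hf0, one_smul] at this
  have h2 : a ∈ Submodule.span (FunField p) ((M ^ n : Submodule _ _) : Set (RatPluriform p)) := by
    have h3 := pow_le_pow_left' h1 n ha
    rw [Submodule.span_pow] at h3
    exact Submodule.span_mono (Submodule.pow_subset_pow _) h3
  -- `a` lies in the span of the germ over the function field; clear the denominators of its
  -- coefficients.
  have h4 : ∃ v : X.presheaf.stalk x, v ≠ 0 ∧ v • a ∈ M ^ n := by
    clear ha
    induction h2 using Submodule.span_induction with
    | mem a ha => exact ⟨1, one_ne_zero, by rwa [one_smul]⟩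
    | zero => exact ⟨1, one_ne_zero, by rw [smul_zero]; exact zero_mem _⟩
    | add a b _ _ ha hb =>
      obtain ⟨v, hv, hva⟩ := ha
      obtain ⟨w, hw, hwb⟩ := hb
      refine ⟨v * w, mul_ne_zero hv hw, ?_⟩
      rw [smul_add]
      refine add_mem ?_ ?_
      · rw [mul_comm, mul_smul]; exact Submodule.smul_mem _ _ hva
      · rw [mul_smul]; exact Submodule.smul_mem _ _ hwb
    | smul r a _ ha =>
      obtain ⟨v, hv, hva⟩ := ha
      obtain ⟨s, t, ht, rfl⟩ := IsFractionRing.div_surjective (A := X.presheaf.stalk x) r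
      have ht0 : algebraMap (X.presheaf.stalk x) (FunField p) t ≠ 0 := by
        simpa using nonZeroDivisors.ne_zero ht
      refine ⟨t * v, mul_ne_zero (nonZeroDivisors.ne_zero ht) hv, ?_⟩
      have : (t * v) • (algebraMap (X.presheaf.stalk x) (FunField p) s /
          algebraMap (X.presheaf.stalk x) (FunField p) t) • a = s • v • a := by
        rw [← algebraMap_smul (FunField p) (t * v), ← algebraMap_smul (FunField p) s,
          ← algebraMap_smul (FunField p) v, smul_smul, smul_smul, map_mul]
        congr 1
        field_simp
      rw [this]
      exact Submodule.smul_mem _ _ hva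
  obtain ⟨v, hv, hva⟩ := h4
  -- `v` is a unit times `ϖ ^ k`, and `ϖ` divides the non-unit `h`, so `v` divides `h ^ m` from `m =
  -- k` on.
  obtain ⟨k, hk⟩ := IsDiscreteValuationRing.associated_pow_irreducible hv hϖ
  have hϖh : ϖ ∣ h := by
    have h1 : h ∈ IsLocalRing.maximalIdeal (X.presheaf.stalk x) := hh
    rwa [hϖ.maximalIdeal_eq, Ideal.mem_span_singleton] at h1
  refine ⟨k, fun m hm => ?_⟩
  obtain ⟨r, hr⟩ : v ∣ h ^ m := hk.dvd.trans ((pow_dvd_pow_of_dvd hϖh k).trans (pow_dvd_pow h hm))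
  rw [hr, mul_comm, mul_smul]
  exact Submodule.smul_mem _ _ hva

/-- Sections are intersections over points of codimension one, and an empty intersection would be
everything; this is where the dimension of X enters. If the sections on an affine open form a field,
X is a single point. Otherwise a minimal prime over a nonzero non-unit has height one by Krull's
theorem. -/
theorem exists_coheight_eq_one [LocallyOfFiniteType p] (hdim : topologicalKrullDim X = 3)
    (V : X.Opens) (hV : (V : Set X).Nonempty) : ∃ x ∈ V, Order.coheight x = 1 := by
  obtain ⟨x, hx⟩ := hV
  obtain ⟨_, ⟨W, hW, rfl⟩, hxW, hWV⟩ := X.isBasis_affineOpens.exists_subset_of_mem_open hx V.isOpen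
  have hW : IsAffineOpen W := hW
  have : Nonempty W := ⟨⟨x, hxW⟩⟩
  have := isNoetherianRing_sections p hW
  by_cases hfield : IsField Γ(X, W)
  · exfalso
    have hss : ∀ y ∈ W, y = x := by
      intro y hy
      have h1 : hW.primeIdealOf ⟨y, hy⟩ = hW.primeIdealOf ⟨x, hxW⟩ := by
        let := hfield.toField
        exact PrimeSpectrum.ext ((Ideal.eq_bot_of_prime _).trans (Ideal.eq_bot_of_prime _).symm)
      have := congr(hW.fromSpec $h1)
      rwa [hW.fromSpec_primeIdealOf, hW.fromSpec_primeIdealOf] at this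
    have : JacobsonSpace X := LocallyOfFiniteType.jacobsonSpace p
    obtain ⟨y, hy, hyc⟩ := nonempty_inter_closedPoints ⟨x, hxW⟩ W.isOpen.isLocallyClosed
    obtain rfl := hss y hy
    have hgen : genericPoint X ∈ W :=
      ((genericPoint_spec X).mem_open_set_iff W.isOpen).2 ⟨y, trivial, hy⟩
    have huniv : (Set.univ : Set X) = {y} := by
      rw [← (genericPoint_spec X).def, hss _ hgen]
      exact IsClosed.closure_eq hyc
    have hsub : Subsingleton X := ⟨fun a b => by
      have ha : a ∈ ({y} : Set X) := huniv ▸ trivial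
      have hb : b ∈ ({y} : Set X) := huniv ▸ trivial
      exact ha.trans hb.symm⟩
    have : Subsingleton (IrreducibleCloseds X) := ⟨fun a b => by
      refine IrreducibleCloseds.ext ?_
      rw [Subsingleton.eq_univ_of_nonempty a.isIrreducible.nonempty,
        Subsingleton.eq_univ_of_nonempty b.isIrreducible.nonempty]⟩
    have h0 : topologicalKrullDim X ≤ 0 := Order.krullDim_nonpos_of_subsingleton
    rw [hdim] at h0
    exact absurd h0 (by decide)
  · obtain ⟨a, ha0, hau⟩ := Ring.exists_not_isUnit_of_not_isField hfield
    obtain ⟨P, hP⟩ := Ideal.nonempty_minimalPrimes (I := Ideal.span {a}) (by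
      rwa [Ne, Ideal.span_singleton_eq_top])
    have hprime : P.IsPrime := hP.1.1
    have hht : P.height = 1 := by
      refine le_antisymm (Ideal.height_le_one_of_isPrincipal_of_mem_minimalPrimes _ P hP) ?_
      rw [Order.one_le_iff_ne_zero, Ne, Ideal.height_eq_zero_iff_eq_bot]
      rintro rfl
      exact ha0 (hP.1.2 (Ideal.mem_span_singleton_self a))
    obtain ⟨y, hy, h⟩ := exists_primeIdealOf_eq hW ⟨P, hprime⟩
    exact ⟨y, hWV hy, by rw [← height_primeIdealOf hW hy, h, hht]⟩

end ComplexScheme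
-- Properness and the valuative criterion.
-- `Proj` is proper over the spectrum of the degree-zero part, which here consists of the integer
-- constants, and Spec ℤ is terminal.
theorem isProper_terminal_from_projSpace (N : ℕ) : IsProper (terminal.from (projSpace N)) := by
  let : GradedAlgebra (MvPolynomial.homogeneousSubmodule (Fin (N + 1)) ℤ) :=
    MvPolynomial.gradedAlgebra
  let 𝒜 := MvPolynomial.homogeneousSubmodule (Fin (N + 1)) ℤ
  have htower : @IsScalarTower ℤ (𝒜 0) (MvPolynomial (Fin (N + 1)) ℤ)
      (Ring.toIntAlgebra (𝒜 0)).toSMul Algebra.toSMul Algebra.toSMul :=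
    .of_algebraMap_eq' (RingHom.ext_int _ _)
  have hft : Algebra.FiniteType (𝒜 0) (MvPolynomial (Fin (N + 1)) ℤ) :=
    @Algebra.FiniteType.of_restrictScalars_finiteType ℤ (𝒜 0) _ _ _ _
      (Ring.toIntAlgebra (𝒜 0)) _ _ htower inferInstance
  have hbij : Function.Bijective (Int.castRingHom (𝒜 0)) := by
    constructor
    · intro a b hab
      have h := congr((($hab : 𝒜 0) : MvPolynomial (Fin (N + 1)) ℤ))
      change ((algebraMap (𝒜 0) (MvPolynomial (Fin (N + 1)) ℤ)).comp (Int.castRingHom _)) a =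
        ((algebraMap (𝒜 0) (MvPolynomial (Fin (N + 1)) ℤ)).comp (Int.castRingHom _)) b at h
      rw [RingHom.ext_int ((algebraMap (𝒜 0) (MvPolynomial (Fin (N + 1)) ℤ)).comp _)
        MvPolynomial.C] at h
      exact MvPolynomial.C_injective _ _ h
    · rintro ⟨f, hf⟩
      have h0 := MvPolynomial.totalDegree_eq_zero_iff_eq_C.1
        ((MvPolynomial.totalDegree_zero_iff_isHomogeneous _ ).2 hf)
      refine ⟨f.coeff 0, Subtype.ext ?_⟩
      change ((algebraMap (𝒜 0) (MvPolynomial (Fin (N + 1)) ℤ)).comp (Int.castRingHom _))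
        (f.coeff 0) = f
      rw [RingHom.ext_int ((algebraMap (𝒜 0) (MvPolynomial (Fin (N + 1)) ℤ)).comp _)
        MvPolynomial.C, ← h0]
  have hterm : IsTerminal (Spec (CommRingCat.of (𝒜 0))) :=
    specZIsTerminal.ofIso (Scheme.Spec.mapIso (RingEquiv.ofBijective _ hbij).toCommRingCatIso.op).symm
  have hiso : IsIso (terminal.from (Spec (CommRingCat.of (𝒜 0)))) :=
    isIso_of_isTerminal hterm terminalIsTerminal _
  have h : terminal.from (projSpace N) =
      Proj.toSpecZero 𝒜 ≫ terminal.from (Spec (CommRingCat.of (𝒜 0))) := terminal.hom_ext _ _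
  rw [h]
  have : IsProper (Proj.toSpecZero 𝒜) := inferInstance
  exact MorphismProperty.comp_mem _ _ _ this inferInstance

theorem IsProjective.isProper {X S : Scheme.{0}} {π : X ⟶ S} (h : IsProjective π) :
    IsProper π := by
  obtain ⟨N, g, hg⟩ := h
  have := isProper_terminal_from_projSpace N
  have h1 := pullback.lift_fst π g (terminal.hom_ext _ _ :
    π ≫ terminal.from S = g ≫ terminal.from (projSpace N))
  rw [← h1]
  infer_instance

/-- Sections over some member of an affine cover of `π⁻¹(U)` are contained in any given valuation
ring containing the sections over `U`. -/
theorem exists_sections_le_valuationSubring {X S : Scheme.{0}} [AlgebraicGeometry.IsIntegral X]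
    (π : X ⟶ S) [UniversallyClosed π] {U : S.Opens} (hU : IsAffineOpen U)
    (hgen : π (genericPoint X) ∈ U) {ι : Type*} (V : ι → X.Opens) (hV : ∀ i, IsAffineOpen (V i))
    (hcov : ∀ x, π x ∈ U → ∃ i, x ∈ V i) (A : ValuationSubring X.functionField)
    (hA : ∀ b : Γ(S, U), π.stalkMap (genericPoint X) (S.presheaf.germ U _ hgen b) ∈ A) :
    ∃ i, ∃ _ : Nonempty (V i), ∀ a : Γ(X, V i), X.germToFunctionField (V i) a ∈ A := by
  let φ : Γ(S, U) ⟶ CommRingCat.of A := CommRingCat.ofHom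
    (RingHom.codRestrict (S.presheaf.germ U _ hgen ≫ π.stalkMap (genericPoint X)).hom A.toSubring hA)
  let j : CommRingCat.of A ⟶ X.functionField := CommRingCat.ofHom (algebraMap A X.functionField)
  have hφj : φ ≫ j = S.presheaf.germ U _ hgen ≫ π.stalkMap (genericPoint X) := rfl
  have hcomm : X.fromSpecStalk (genericPoint X) ≫ π = Spec.map j ≫ Spec.map φ ≫ hU.fromSpec := by
    rw [← Scheme.SpecMap_stalkMap_fromSpecStalk, ← Category.assoc, ← Spec.map_comp, hφj,
      ← hU.fromSpecStalk_eq_fromSpecStalk hgen, IsAffineOpen.fromSpecStalk, Spec.map_comp,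
      Category.assoc]
  -- The generic point of X and the map Spec A → U form a valuative square over π; existence of a
  -- lift extends the generic point to Spec A → X.
  let sq : ValuativeCommSq π :=
    { R := A
      K := X.functionField
      i₁ := X.fromSpecStalk (genericPoint X)
      i₂ := Spec.map φ ≫ hU.fromSpec
      commSq := ⟨hcomm⟩ }
  have hex : ValuativeCriterion.Existence π := by
    have : UniversallyClosed π := inferInstance
    rw [UniversallyClosed.eq_valuativeCriterion] at this
    exact this.1
  obtain ⟨⟨l, hl1, hl2⟩⟩ := (hex sq).exists_lift
  change Spec.map j ≫ l = X.fromSpecStalk (genericPoint X) at hl1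
  change l ≫ π = Spec.map φ ≫ hU.fromSpec at hl2
  let ξ : Spec (CommRingCat.of A) := IsLocalRing.closedPoint A
  have hξ : π (l ξ) ∈ U := by
    rw [← Scheme.Hom.comp_apply, hl2, Scheme.Hom.comp_apply]
    have : hU.fromSpec (Spec.map φ ξ) ∈ Set.range hU.fromSpec := ⟨_, rfl⟩
    rwa [hU.range_fromSpec] at this
  obtain ⟨i, hi⟩ := hcov _ hξ
  have : Nonempty (V i) := ⟨⟨_, hi⟩⟩
  refine ⟨i, this, ?_⟩
  -- All points of Spec A specialize to the closed point, so the lift stays in any open set that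
  -- contains the image of that point.
  have hrange : Set.range l ⊆ Set.range (hV i).fromSpec := by
    rw [(hV i).range_fromSpec]
    rintro _ ⟨y, rfl⟩
    have : y ⤳ ξ := IsLocalRing.specializes_closedPoint y
    exact (this.map l.continuous).mem_open (V i).isOpen hi
  let l' := IsOpenImmersion.lift (hV i).fromSpec l hrange
  have hl' : l' ≫ (hV i).fromSpec = l := IsOpenImmersion.lift_fac _ _ _
  obtain ⟨ψ, hψ⟩ := Spec.map_surjective l'
  have hψj : ψ ≫ j = X.germToFunctionField (V i) := by
    apply Spec.map_injective
    rw [← cancel_mono (hV i).fromSpec, Spec.map_comp, Category.assoc, hψ, hl', hl1]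
    rw [← (hV i).fromSpecStalk_eq_fromSpecStalk, IsAffineOpen.fromSpecStalk]
  intro a
  rw [← hψj]
  exact (ψ a).2

/-! ### Finite generation of the direct images. -/

section DirectImage

variable {X S : Scheme.{0}} (q : S ⟶ Spec (CommRingCat.of ℂ))
  (π : X ⟶ S)

theorem exists_finite_affine_cover [QuasiCompact π] {U : S.Opens} (hU : IsAffineOpen U) :
    ∃ s : Set X.affineOpens, s.Finite ∧ ((π ⁻¹ᵁ U : X.Opens) : Set X) = ⋃ i ∈ s, (i : Set X) :=
  isCompact_and_isOpen_iff_finite_and_eq_biUnion_affineOpens.1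
    ⟨QuasiCompact.isCompact_preimage _ U.isOpen hU.isCompact, (π ⁻¹ᵁ U).isOpen⟩

variable [AlgebraicGeometry.IsIntegral X]

theorem genericPoint_mem [Surjective π] {U : S.Opens} {s : S} (hs : s ∈ U) : π (genericPoint X) ∈ U :=
  (generic_specializes π s).mem_open U.isOpen hs

/-- Pullback of functions on `U ⊆ S` to rational functions on `X`. -/
noncomputable def pullbackSection (U : S.Opens) (hU : π (genericPoint X) ∈ U) :
    Γ(S, U) →+* FunField (π ≫ q) :=
  (S.presheaf.germ U _ hU ≫ π.stalkMap (genericPoint X)).hom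

theorem pullbackGerm_germ_eq [Surjective π] (U : S.Opens) (s : S) (hs : s ∈ U) (f : Γ(S, U)) :
    pullbackGerm q π s (S.presheaf.germ U s hs f) =
      pullbackSection q π U (genericPoint_mem π hs) f := by
  have h : S.presheaf.germ U s hs ≫ S.presheaf.stalkSpecializes (generic_specializes π s) ≫
      π.stalkMap (genericPoint X) =
      S.presheaf.germ U _ (genericPoint_mem π hs) ≫ π.stalkMap (genericPoint X) := by
    rw [TopCat.Presheaf.germ_stalkSpecializes_assoc]
  exact congr($(h).hom f)

theorem pullbackSection_eq {U : S.Opens} (hU : π (genericPoint X) ∈ U) {V : X.Opens} [Nonempty V]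
    (hV : V ≤ π ⁻¹ᵁ U) (f : Γ(S, U)) :
    pullbackSection q π U hU f = algebraMap Γ(X, V) (FunField (π ≫ q)) (π.appLE U V hV f) := by
  have h : S.presheaf.germ U _ hU ≫ π.stalkMap (genericPoint X) =
      π.appLE U V hV ≫ X.germToFunctionField V := by
    simp only [Scheme.Hom.germ_stalkMap, Scheme.Hom.appLE, Category.assoc, TopCat.Presheaf.germ_res]
  exact congr($(h).hom f)

theorem isScalarTower_pullbackSection (U : S.Opens) (hU : π (genericPoint X) ∈ U) :
    letI := sectionsAlgebra q U
    letI := (pullbackSection q π U hU).toAlgebra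
    IsScalarTower ℂ Γ(S, U) (FunField (π ≫ q)) := by
  let := sectionsAlgebra q U
  let := (pullbackSection q π U hU).toAlgebra
  refine .of_algebraMap_eq' ?_
  have h : (Scheme.ΓSpecIso (CommRingCat.of ℂ)).inv ≫ (π ≫ q).appTop ≫
      X.presheaf.germ ⊤ (genericPoint X) trivial =
      ((Scheme.ΓSpecIso (CommRingCat.of ℂ)).inv ≫ q.appLE ⊤ U le_top) ≫
        S.presheaf.germ U _ hU ≫ π.stalkMap (genericPoint X) := by
    simp only [Category.assoc, Scheme.Hom.appLE, TopCat.Presheaf.germ_res_assoc,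
      Scheme.Hom.comp_appTop]
    rw [Scheme.Hom.germ_stalkMap]
    rfl
  exact congr(($h).hom)

/-- The condition at one point of codimension one already forces a form to be homogeneous of degree
`n`. -/
theorem directImageSections_le [LocallyOfFiniteType (π ≫ q)] (hdim : topologicalKrullDim X = 3)
    (D : WeilDivisor X) (n : ℕ) (U : S.Opens) (hU : π (genericPoint X) ∈ U)
    {a : RatPluriform (π ≫ q)} (ha : a ∈ directImageSections q π D n U) :
    a ∈ LinearMap.range (ofForm (π ≫ q)) ^ n := by
  obtain ⟨x, hx, hx1⟩ := exists_coheight_eq_one (π ≫ q) hdim (π ⁻¹ᵁ U) ⟨genericPoint X, hU⟩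
  rw [directImageSections, reflexivePowerSections, AddSubgroup.mem_iInf] at ha
  exact twistedCanonicalGerm_pow_le (π ≫ q) D x n (ha ⟨x, hx, hx1⟩)

/-- `exists_denominator` clears the poles in codimension one, and Hartogs' theorem makes the result
regular on all of `V`. -/
theorem exists_denominator_directImageSections [LocallyOfFiniteType (π ≫ q)]
    (hnormal : ∀ x : X, IsIntegrallyClosed (X.presheaf.stalk x)) (D : WeilDivisor X) (n : ℕ)
    (U : S.Opens) (l : RatPluriform (π ≫ q) →ₗ[FunField (π ≫ q)] FunField (π ≫ q))
    {V : X.Opens} (hV : IsAffineOpen V) [Nonempty V] (hVU : V ≤ π ⁻¹ᵁ U) :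
    ∃ c : FunField (π ≫ q), c ≠ 0 ∧ ∀ a ∈ directImageSections q π D n U, c * l a ∈
        (algebraMap Γ(X, V) (FunField (π ≫ q))).range := by
  have := isFractionRing_sections (π ≫ q) hV
  have := isNoetherianRing_sections (π ≫ q) hV
  obtain ⟨c, hc0, hc⟩ := exists_denominator (π ≫ q) hnormal D hV n l
  refine ⟨algebraMap Γ(X, V) (FunField (π ≫ q)) c, ?_, fun a ha => ?_⟩
  · exact (map_ne_zero_iff _ (IsFractionRing.injective Γ(X, V) (FunField (π ≫ q)))).2 hc0
  obtain ⟨b, hb⟩ := exists_germToFunctionField_eq hV hnormal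
    (algebraMap Γ(X, V) (FunField (π ≫ q)) c * l a) (fun x hx hx1 => by
      refine hc x hx hx1 a ?_
      rw [directImageSections, reflexivePowerSections, AddSubgroup.mem_iInf] at ha
      exact ha ⟨x, hVU hx, hx1⟩)
  exact ⟨b, hb⟩

/-- By properness, a valuation ring containing the functions on `U` contains those on some member
`V` of the cover, so l(a) = c_V⁻¹ (c_V l(a)) with the second factor in the valuation ring. This is
the hypothesis of `exists_fg_of_forall_valuationSubring` for the finite set of the c_V⁻¹. -/
theorem exists_fg_functional [LocallyOfFiniteType q] [LocallyOfFiniteType (π ≫ q)]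
    (hproj : IsProjective π)
    (hnormal : ∀ x : X, IsIntegrallyClosed (X.presheaf.stalk x)) (D : WeilDivisor X) (n : ℕ)
    {U : S.Opens} (hU : IsAffineOpen U) (hgen : π (genericPoint X) ∈ U)
    (l : RatPluriform (π ≫ q) →ₗ[FunField (π ≫ q)] FunField (π ≫ q)) :
    letI := (pullbackSection q π U hgen).toAlgebra
    ∃ T : Set (FunField (π ≫ q)), T.Finite ∧ ∀ a ∈ directImageSections q π D n U,
      l a ∈ Submodule.span Γ(S, U) T := by
  classical
  have := hproj.isProper
  let i1 := sectionsAlgebra q U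
  let i2 := (pullbackSection q π U hgen).toAlgebra
  have i3 := isScalarTower_pullbackSection q π U hgen
  have i4 := finiteType_sections q hU
  obtain ⟨s, hs, hcov⟩ := exists_finite_affine_cover π hU
  have hsU : ∀ V ∈ s, V.1 ≤ π ⁻¹ᵁ U := fun V hVs x hx => by
    change x ∈ ((π ⁻¹ᵁ U : X.Opens) : Set X)
    rw [hcov]
    exact Set.mem_biUnion hVs hx
  have hc : ∀ V : s, ∃ c : FunField (π ≫ q), c ≠ 0 ∧ (∀ _ : Nonempty V.1.1,
      ∀ a ∈ directImageSections q π D n U, c * l a ∈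
        (algebraMap Γ(X, V.1.1) (FunField (π ≫ q))).range) := by
    rintro ⟨V, hVs⟩
    by_cases hVn : Nonempty V.1
    · obtain ⟨c, hc0, hc⟩ := exists_denominator_directImageSections q π hnormal D n U l V.2
        (hsU V hVs)
      exact ⟨c, hc0, fun _ => hc⟩
    · exact ⟨1, one_ne_zero, fun h2 => absurd h2 hVn⟩
  choose c hc0 hc using hc
  have hval : ∀ A : ValuationSubring (FunField (π ≫ q)),
      (∀ b : Γ(S, U), algebraMap Γ(S, U) (FunField (π ≫ q)) b ∈ A) →
      ∃ V : s, ∃ _ : Nonempty V.1.1,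
        ∀ a : Γ(X, V.1.1), algebraMap Γ(X, V.1.1) (FunField (π ≫ q)) a ∈ A :=
    exists_sections_le_valuationSubring π hU hgen (fun V : s => V.1.1) (fun V => V.1.2)
      (fun x hx => by
        have hx' : x ∈ ((π ⁻¹ᵁ U : X.Opens) : Set X) := hx
        rw [hcov] at hx'
        obtain ⟨V, hVs, hxV⟩ := Set.mem_iUnion₂.1 hx'
        exact ⟨⟨V, hVs⟩, hxV⟩)
  have hgenX : genericPoint X ∈ ((π ⁻¹ᵁ U : X.Opens) : Set X) := hgen
  rw [hcov] at hgenX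
  obtain ⟨V₀, hV₀s, hV₀⟩ := Set.mem_iUnion₂.1 hgenX
  have hne : Nonempty V₀.1 := ⟨⟨_, hV₀⟩⟩
  let i5 := sectionsAlgebra (π ≫ q) V₀
  have i6 := isScalarTower_sections (π ≫ q) V₀
  have i7 := finiteType_sections (π ≫ q) V₀.2
  have i8 := isFractionRing_sections (π ≫ q) V₀.2
  have : Finite s := hs
  have := Fintype.ofFinite s
  obtain ⟨N, ⟨T, hT⟩, hN⟩ := exists_fg_of_forall_valuationSubring ℂ Γ(S, U) Γ(X, V₀)
    (FunField (π ≫ q)) (Finset.univ.image fun V : s => (c V)⁻¹)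
  refine ⟨T, T.finite_toSet, fun a ha => ?_⟩
  rw [hT]
  refine hN _ fun A hA => ?_
  obtain ⟨V, hVn, hV⟩ := hval A hA
  obtain ⟨b, hb⟩ := hc V hVn a ha
  refine ⟨(c V)⁻¹, Finset.mem_image_of_mem _ (Finset.mem_univ V), c V * l a, ?_, ?_⟩
  · rw [← hb]
    exact hV b
  · rw [mul_comm, ← mul_assoc, inv_mul_cancel₀ (hc0 V), one_mul]

end DirectImage

/-- The coordinates in a `K`-basis of `W` extend to functionals on `P`. If each takes values in a
finitely generated `B`-module, the products of the generators with the basis vectors span `E`. -/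
theorem exists_finite_span_of_functionals {B K P : Type*} [CommRing B] [Field K] [Algebra B K]
    [AddCommGroup P] [Module K P] [Module B P] [IsScalarTower B K P] (W : Submodule K P)
    [FiniteDimensional K W] (E : Set P) (hE : E ⊆ W)
    (h : ∀ l : P →ₗ[K] K, ∃ T : Set K, T.Finite ∧ ∀ a ∈ E, l a ∈ Submodule.span B T) :
    ∃ T : Set P, T.Finite ∧ ∀ a ∈ E, a ∈ Submodule.span B T := by
  classical
  let b := Module.finBasis K W
  have hl : ∀ k, ∃ l : P →ₗ[K] K, l ∘ₗ W.subtype = b.coord k := fun k =>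
    LinearMap.exists_extend _
  choose l hl using hl
  choose T hT hTE using fun k => h (l k)
  refine ⟨⋃ k, (fun t : K => t • (b k : P)) '' T k, Set.finite_iUnion fun k => (hT k).image _,
    fun a ha => ?_⟩
  have hsum : a = ∑ k, l k a • (b k : P) := by
    have h1 := congrArg W.subtype (b.sum_repr ⟨a, hE ha⟩)
    rw [map_sum] at h1
    refine h1.symm.trans (Finset.sum_congr rfl fun k _ => ?_)
    rw [map_smul]
    congr 1
    exact (LinearMap.congr_fun (hl k) ⟨a, hE ha⟩).symm
  rw [hsum]
  refine Submodule.sum_mem _ fun k _ => ?_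
  have h1 : l k a • (b k : P) ∈ (Submodule.span B (T k)).map
      ((LinearMap.toSpanSingleton K P (b k : P)).restrictScalars B) := ⟨_, hTE k a ha, rfl⟩
  rw [Submodule.map_span] at h1
  exact Submodule.span_mono (Set.subset_iUnion_of_subset k subset_rfl) h1

section DirectImage

variable {X S : Scheme.{0}} [AlgebraicGeometry.IsIntegral X] (q : S ⟶ Spec (CommRingCat.of ℂ))
  (π : X ⟶ S)

/-- The rational pluricanonical forms on `X` as an algebra over the functions on `U ⊆ S`. -/
@[reducible]
noncomputable def pluriformAlgebra (U : S.Opens) (hU : π (genericPoint X) ∈ U) :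
    Algebra Γ(S, U) (RatPluriform (π ≫ q)) :=
  ((algebraMap (FunField (π ≫ q)) (RatPluriform (π ≫ q))).comp
    (pullbackSection q π U hU)).toAlgebra

theorem finiteDimensional_range_ofForm_pow [LocallyOfFiniteType (π ≫ q)] (n : ℕ) :
    FiniteDimensional (FunField (π ≫ q))
      ↥(LinearMap.range (ofForm (π ≫ q)) ^ n) := by
  obtain ⟨_, ⟨V, hV, rfl⟩, hxV, -⟩ := X.isBasis_affineOpens.exists_subset_of_mem_open
    (Set.mem_univ (genericPoint X)) isOpen_univ
  have : Nonempty V := ⟨⟨_, hxV⟩⟩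
  obtain ⟨Θ, hΘ, hspan, -⟩ := exists_finite_forms (π ≫ q) hV
  rw [hspan]
  exact Module.Finite.iff_fg.2 ((Submodule.fg_span hΘ).pow n)

theorem exists_finite_span_directImageSections [LocallyOfFiniteType q]
    [LocallyOfFiniteType (π ≫ q)] (hproj : IsProjective π)
    (hnormal : ∀ x : X, IsIntegrallyClosed (X.presheaf.stalk x))
    (hdim : topologicalKrullDim X = 3) (D : WeilDivisor X) (n : ℕ)
    {U : S.Opens} (hU : IsAffineOpen U) (hgen : π (genericPoint X) ∈ U) :
    letI := pluriformAlgebra q π U hgen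
    ∃ T : Set (RatPluriform (π ≫ q)), T.Finite ∧ ∀ a ∈ directImageSections q π D n U,
      a ∈ Submodule.span Γ(S, U) T := by
  let i1 := (pullbackSection q π U hgen).toAlgebra
  let i2 := pluriformAlgebra q π U hgen
  have i3 : IsScalarTower Γ(S, U) (FunField (π ≫ q)) (RatPluriform (π ≫ q)) :=
    .of_algebraMap_eq' rfl
  have := finiteDimensional_range_ofForm_pow q π n
  exact exists_finite_span_of_functionals (LinearMap.range (ofForm (π ≫ q)) ^ n) _
    (fun a ha => directImageSections_le q π hdim D n U hgen ha)
    (fun l => exists_fg_functional q π hproj hnormal D n hU hgen l)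

variable [Surjective π]

/-- Choose f, a unit at s, whose nonvanishing locus lies in the domain of the given section. Where f
does not vanish there is nothing to do; over f = 0 there are only finitely many points of
codimension one, and a high power of f removes the poles at all of them. -/
theorem exists_germ_smul_mem_directImageSections [LocallyOfFiniteType (π ≫ q)] [QuasiCompact π]
    (hnormal : ∀ x : X, IsIntegrallyClosed (X.presheaf.stalk x))
    (hdim : topologicalKrullDim X = 3) (D : WeilDivisor X) (n : ℕ)
    {U : S.Opens} (hU : IsAffineOpen U) {s : S} (hs : s ∈ U)
    {a : RatPluriform (π ≫ q)} (ha : a ∈ directImageStalk q π D s n) :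
    ∃ h : Γ(S, U), IsUnit (S.presheaf.germ U s hs h) ∧
      S.presheaf.germ U s hs h • a ∈ directImageSections q π D n U := by
  classical
  have := LocallyOfFiniteType.isLocallyNoetherian (π ≫ q)
  obtain ⟨V', hsV', ha⟩ := ha
  obtain ⟨f, hfV, hsf⟩ := hU.exists_basicOpen_le ⟨s, hsV'⟩ hs
  have hfu : IsUnit (S.presheaf.germ U s hs f) := (S.mem_basicOpen f s hs).1 hsf
  have haW := directImageSections_le q π hdim D n V' (genericPoint_mem π hsV') ha
  obtain ⟨c, hc, hcov⟩ := exists_finite_affine_cover π hU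
  let F : Set X := {x | Order.coheight x = 1 ∧ ∃ hx : x ∈ π ⁻¹ᵁ U,
    ¬ IsUnit (X.presheaf.germ (π ⁻¹ᵁ U) x hx (π.app U f))}
  have hF : F.Finite := by
    refine (hc.biUnion (t := fun V : X.affineOpens => {x : X | x ∈ V.1 ∧ x ∈ F})
      fun V hV => ?_).subset ?_
    · have hVU : V.1 ≤ π ⁻¹ᵁ U := fun x hx => by
        change x ∈ ((π ⁻¹ᵁ U : X.Opens) : Set X)
        rw [hcov]
        exact Set.mem_biUnion hV hx
      rcases isEmpty_or_nonempty V.1 with he | hne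
      · convert Set.finite_empty
        ext x
        simp only [Set.mem_ofPred_eq, Set.mem_empty_iff_false, iff_false, not_and]
        exact fun hx => (he.false ⟨x, hx⟩).elim
      have := isNoetherianRing_sections (π ≫ q) V.2
      have h0 : π.appLE U V.1 hVU f ≠ 0 := by
        intro h0
        have h1 := pullbackSection_eq q π (genericPoint_mem π hs) hVU f
        rw [h0, map_zero, ← pullbackGerm_germ_eq q π U s hs f] at h1
        exact (hfu.map (pullbackGerm q π s)).ne_zero h1
      refine (finite_setOf_coheight_eq_one V.2 h0).subset ?_
      rintro x ⟨hxV, hx1, hx, hu⟩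
      refine ⟨hx1, hxV, ?_⟩
      rw [Scheme.Hom.appLE, CommRingCat.comp_apply, TopCat.Presheaf.germ_res_apply]
      exact hu
    · intro x hx
      have h1 : x ∈ ((π ⁻¹ᵁ U : X.Opens) : Set X) := hx.2.1
      rw [hcov] at h1
      obtain ⟨V, hV, hxV⟩ := Set.mem_iUnion₂.1 h1
      exact Set.mem_biUnion hV ⟨hxV, hx⟩
  have hN : ∀ x : X, ∃ N : ℕ, ∀ (h1 : x ∈ F), ∀ m ≥ N,
      (X.presheaf.germ (π ⁻¹ᵁ U) x h1.2.1 (π.app U f)) ^ m • a ∈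
        twistedCanonicalGerm (π ≫ q) D x ^ n := by
    intro x
    by_cases hx : x ∈ F
    · obtain ⟨N, hN⟩ := exists_pow_smul_mem_twistedCanonicalGerm (π ≫ q) hnormal D x hx.1 n haW
        (X.presheaf.germ (π ⁻¹ᵁ U) x hx.2.1 (π.app U f)) hx.2.2
      exact ⟨N, fun _ => hN⟩
    · exact ⟨0, fun h => absurd h hx⟩
  choose N hN using hN
  refine ⟨f ^ (hF.toFinset.sup N), ?_, ?_⟩
  · rw [map_pow]
    exact hfu.pow _
  rw [directImageSections, reflexivePowerSections, AddSubgroup.mem_iInf] at ha ⊢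
  rintro ⟨x, hx, hx1⟩
  have key : S.presheaf.germ U s hs (f ^ (hF.toFinset.sup N)) • a =
      (X.presheaf.germ (π ⁻¹ᵁ U) x hx (π.app U f)) ^ (hF.toFinset.sup N) • a := by
    rw [Algebra.smul_def, Algebra.smul_def, RingHom.algebraMap_toAlgebra,
      RingHom.algebraMap_toAlgebra, RingHom.comp_apply, RingHom.comp_apply,
      pullbackGerm_germ q π U x hx s hs, map_pow, map_pow]
  rw [key]
  by_cases hxF : x ∈ F
  · exact hN x hxF _ (Finset.le_sup (hF.mem_toFinset.2 hxF))
  · have hu : IsUnit (X.presheaf.germ (π ⁻¹ᵁ U) x hx (π.app U f)) := by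
      by_contra h
      exact hxF ⟨hx1, hx, h⟩
    have hxV' : x ∈ π ⁻¹ᵁ V' := by
      have h1 : x ∈ X.basicOpen (π.app U f) := (X.mem_basicOpen _ x hx).2 hu
      rw [← Scheme.preimage_basicOpen] at h1
      exact hfV h1
    exact Submodule.smul_mem _ _ (ha ⟨x, hxV', hx1⟩)

end DirectImage
-- Stalks of the direct images and specialization.
section DirectImage

variable {X S : Scheme.{0}} [AlgebraicGeometry.IsIntegral X] (q : S ⟶ Spec (CommRingCat.of ℂ))
  (π : X ⟶ S) [Surjective π]

/-- A germ becomes a section over all of `U` after multiplication by a unit of the local ring at s.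
-/
theorem directImageStalk_eq_span [LocallyOfFiniteType (π ≫ q)] [QuasiCompact π]
    (hnormal : ∀ x : X, IsIntegrallyClosed (X.presheaf.stalk x))
    (hdim : topologicalKrullDim X = 3) (D : WeilDivisor X) (n : ℕ)
    {U : S.Opens} (hU : IsAffineOpen U) {s : S} (hs : s ∈ U) :
    directImageStalk q π D s n = Submodule.span (S.presheaf.stalk s)
      (directImageSections q π D n U : Set (RatPluriform (π ≫ q))) := by
  refine le_antisymm (fun a ha => ?_) (Submodule.span_le.2 fun a ha => ⟨U, hs, ha⟩)
  obtain ⟨h, hu, hh⟩ := exists_germ_smul_mem_directImageSections q π hnormal hdim D n hU hs ha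
  obtain ⟨u, hu⟩ := hu
  rw [← hu] at hh
  have := Submodule.smul_mem _ (↑u⁻¹ : S.presheaf.stalk s) (Submodule.subset_span
    (R := S.presheaf.stalk s) hh)
  rwa [smul_smul, Units.inv_mul, one_smul] at this

theorem fg_directImageStalk [LocallyOfFiniteType q] [LocallyOfFiniteType (π ≫ q)]
    (hproj : IsProjective π)
    (hnormal : ∀ x : X, IsIntegrallyClosed (X.presheaf.stalk x))
    (hdim : topologicalKrullDim X = 3) (D : WeilDivisor X) (n : ℕ) (s : S) :
    (directImageStalk q π D s n).FG := by
  have := hproj.isProper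
  have := LocallyOfFiniteType.isLocallyNoetherian q
  obtain ⟨_, ⟨U, hU, rfl⟩, hsU, -⟩ := S.isBasis_affineOpens.exists_subset_of_mem_open
    (Set.mem_univ s) isOpen_univ
  have hU : IsAffineOpen U := hU
  let i1 := pluriformAlgebra q π U (genericPoint_mem π hsU)
  obtain ⟨T, hT, hspan⟩ := exists_finite_span_directImageSections q π hproj hnormal hdim D n hU
    (genericPoint_mem π hsU)
  have hle : directImageStalk q π D s n ≤ Submodule.span (S.presheaf.stalk s) T := by
    rw [directImageStalk_eq_span q π hnormal hdim D n hU hsU, Submodule.span_le]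
    intro a ha
    have h := hspan a ha
    clear ha
    induction h using Submodule.span_induction with
    | mem a ha => exact Submodule.subset_span ha
    | zero => exact zero_mem _
    | add a b _ _ h1 h2 => exact add_mem h1 h2
    | smul c a _ h =>
      have key : c • a = S.presheaf.germ U s hsU c • a := by
        rw [Algebra.smul_def, Algebra.smul_def, RingHom.algebraMap_toAlgebra,
          RingHom.algebraMap_toAlgebra, RingHom.comp_apply, RingHom.comp_apply,
          pullbackGerm_germ_eq q π U s hsU]
      rw [key]
      exact Submodule.smul_mem _ _ h
  have : Module.Finite (S.presheaf.stalk s) (Submodule.span (S.presheaf.stalk s) T) :=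
    Module.Finite.iff_fg.2 (Submodule.fg_span hT)
  exact Submodule.FG.of_le (Submodule.fg_span hT) hle

/-- A ring homomorphism between stalks along a specialization, as an algebra structure. -/
@[reducible]
noncomputable def stalkAlgebra {s' s : S} (h : s' ⤳ s) :
    Algebra (S.presheaf.stalk s) (S.presheaf.stalk s') :=
  (S.presheaf.stalkSpecializes h).hom.toAlgebra

theorem isScalarTower_stalkAlgebra {s' s : S} (h : s' ⤳ s) :
    letI := stalkAlgebra h
    IsScalarTower (S.presheaf.stalk s) (S.presheaf.stalk s') (RatPluriform (π ≫ q)) := by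
  let := stalkAlgebra h
  refine .of_algebraMap_eq' ?_
  have h1 : S.presheaf.stalkSpecializes (generic_specializes π s) ≫ π.stalkMap (genericPoint X) =
      S.presheaf.stalkSpecializes h ≫ S.presheaf.stalkSpecializes (generic_specializes π s') ≫
        π.stalkMap (genericPoint X) := by
    rw [TopCat.Presheaf.stalkSpecializes_comp_assoc]
  refine RingHom.ext fun x => ?_
  exact congrArg (algebraMap (FunField (π ≫ q)) (RatPluriform (π ≫ q))) congr($(h1).hom x)

/-- An affine neighbourhood of s also contains s', and its sections generate both stalks. -/
theorem directImageStalk_eq_span_of_specializes [LocallyOfFiniteType (π ≫ q)] [QuasiCompact π]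
    (hnormal : ∀ x : X, IsIntegrallyClosed (X.presheaf.stalk x))
    (hdim : topologicalKrullDim X = 3) (D : WeilDivisor X) (n : ℕ) {s' s : S} (h : s' ⤳ s) :
    directImageStalk q π D s' n = Submodule.span (S.presheaf.stalk s')
      (directImageStalk q π D s n : Set (RatPluriform (π ≫ q))) := by
  obtain ⟨_, ⟨U, hU, rfl⟩, hsU, -⟩ := S.isBasis_affineOpens.exists_subset_of_mem_open
    (Set.mem_univ s) isOpen_univ
  have hU : IsAffineOpen U := hU
  have hs'U : s' ∈ U := h.mem_open U.isOpen hsU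
  refine le_antisymm ?_ (Submodule.span_le.2 ?_)
  · rw [directImageStalk_eq_span q π hnormal hdim D n hU hs'U]
    exact Submodule.span_mono fun a ha => ⟨U, hsU, ha⟩
  · rintro a ⟨V, hV, ha⟩
    exact ⟨V, h.mem_open V.isOpen hV, ha⟩

theorem exists_stalkAlgebra_mul_eq {s' s : S} (h : s' ⤳ s) (c : S.presheaf.stalk s') :
    letI := stalkAlgebra h
    ∃ a b : S.presheaf.stalk s, IsUnit (algebraMap _ (S.presheaf.stalk s') b) ∧
      c * algebraMap _ (S.presheaf.stalk s') b = algebraMap _ (S.presheaf.stalk s') a := by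
  obtain ⟨_, ⟨U, hU, rfl⟩, hsU, -⟩ := S.isBasis_affineOpens.exists_subset_of_mem_open
    (Set.mem_univ s) isOpen_univ
  have hU : IsAffineOpen U := hU
  obtain ⟨a, b, hb, hab⟩ := exists_germ_mul_eq hU (h.mem_open U.isOpen hsU) c
  have key : ∀ f : Γ(S, U), (S.presheaf.stalkSpecializes h).hom (S.presheaf.germ U s hsU f) =
      S.presheaf.germ U s' (h.mem_open U.isOpen hsU) f := fun f =>
    congr($(TopCat.Presheaf.germ_stalkSpecializes S.presheaf hsU h).hom f)
  refine ⟨S.presheaf.germ U s hsU a, S.presheaf.germ U s hsU b, ?_, ?_⟩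
  · rw [RingHom.algebraMap_toAlgebra, key]
    exact hb
  · rw [RingHom.algebraMap_toAlgebra, key, key]
    exact hab

theorem stalkSpecializes_genericPoint_injective [AlgebraicGeometry.IsIntegral S] (s : S)
    {y : S} (hy : y = genericPoint S) (h : y ⤳ s) :
    Function.Injective (S.presheaf.stalkSpecializes h).hom := by
  subst hy
  exact IsFractionRing.injective (S.presheaf.stalk s) S.functionField

theorem pullbackGerm_injective [AlgebraicGeometry.IsIntegral S] (s : S) :
    Function.Injective (pullbackGerm q π s) := by
  have hy : π (genericPoint X) = genericPoint S :=
    ((genericPoint_spec S).eq (by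
      have h := (genericPoint_spec X).image π.continuous
      rwa [Set.image_univ, π.surjective.range_eq, closure_univ] at h)).symm
  have hinj := stalkSpecializes_genericPoint_injective s hy (generic_specializes π s)
  have hfield : IsField (S.presheaf.stalk (π (genericPoint X))) := by
    rw [hy]
    exact (inferInstance : Field S.functionField).toIsField
  let := hfield.toField
  have h2 : Function.Injective (π.stalkMap (genericPoint X)).hom :=
    (RingHom.injective_iff_ker_eq_bot _).2 ((Ideal.eq_bot_or_top _).resolve_right
      (RingHom.ker_ne_top _))
  exact h2.comp hinj

/-- The rational forms are a vector space over the function field of X, into which the local ring of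
S injects because π is dominant. -/
theorem isTorsionFree_stalk [AlgebraicGeometry.IsIntegral S] (s : S) (b : S.presheaf.stalk s)
    (a : RatPluriform (π ≫ q)) (h : b • a = 0) : b = 0 ∨ a = 0 := by
  rw [or_iff_not_imp_left]
  intro hb
  have h1 : pullbackGerm q π s b ≠ 0 := (map_ne_zero_iff _ (pullbackGerm_injective q π s)).2 hb
  rw [Algebra.smul_def, RingHom.algebraMap_toAlgebra, RingHom.comp_apply, ← Algebra.smul_def] at h
  have := congrArg ((pullbackGerm q π s b)⁻¹ • ·) h
  simpa [smul_smul, inv_mul_cancel₀ h1] using this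

theorem exists_isClosed_specializes [CompactSpace S] (s' : S) :
    ∃ s : S, IsClosed ({s} : Set S) ∧ s' ⤳ s := by
  obtain ⟨s, hs, hc⟩ := isClosed_closure.exists_closed_singleton
    (closure_nonempty_iff.2 (Set.singleton_nonempty s'))
  exact ⟨s, hc, specializes_iff_mem_closure.2 hs⟩

end DirectImage
-- Local rings of a smooth curve.
-- `A` is étale over the polynomial ring R[t], a principal ideal domain. Unramifiedness says that
-- the maximal ideal is generated by the prime of R[t] below it, hence by one element.
theorem isPrincipal_maximalIdeal_of_isStandardSmooth {R A : Type} [Field R] [CommRing A]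
    {f : R →+* A} (hf : f.IsStandardSmoothOfRelativeDimension 1) (P : Ideal A) [P.IsPrime]
    (L : Type) [CommRing L] [Algebra A L] [IsLocalization.AtPrime L P] [IsLocalRing L] :
    (IsLocalRing.maximalIdeal L).IsPrincipal := by
  obtain ⟨g, -, hg⟩ := hf.exists_etale_mvPolynomial
  have hg1 := RingHom.Etale.respectsIso.2 g
    (MvPolynomial.uniqueAlgEquiv R (Fin 1)).symm.toRingEquiv hg
  set g' : Polynomial R →+* A := g.comp
    (MvPolynomial.uniqueAlgEquiv R (Fin 1)).symm.toRingEquiv.toRingHom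
  have hg' : g'.Etale := hg1
  algebraize [g']
  let p : Ideal (Polynomial R) := P.comap (algebraMap (Polynomial R) A)
  have : P.LiesOver p := ⟨rfl⟩
  let := Localization.AtPrime.algebraOfLiesOver p P
  have h := ((Algebra.isUnramifiedAt_iff_map_eq (Polynomial R) p P).1 inferInstance).2
  have h1 : (IsLocalRing.maximalIdeal (Localization.AtPrime P)).IsPrincipal := by
    rw [← h]
    obtain ⟨t, ht⟩ := IsPrincipalIdealRing.principal p
    rw [ht, Ideal.submodule_span_eq, Ideal.map_span, Set.image_singleton]
    exact ⟨_, rfl⟩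
  let e : Localization.AtPrime P ≃ₐ[A] L := IsLocalization.algEquiv P.primeCompl _ _
  have h2 : (IsLocalRing.maximalIdeal (Localization.AtPrime P)).map e.toRingEquiv =
      IsLocalRing.maximalIdeal L :=
    IsLocalRing.eq_maximalIdeal (Ideal.map_isMaximal_of_equiv _)
  rw [← h2]
  obtain ⟨t, ht⟩ := h1
  rw [ht, Ideal.submodule_span_eq, Ideal.map_span, Set.image_singleton]
  exact ⟨_, rfl⟩

theorem isPrincipal_maximalIdeal_stalk {S : Scheme.{0}} (q : S ⟶ Spec (CommRingCat.of ℂ))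
    [SmoothOfRelativeDimension 1 q] (s : S) :
    (IsLocalRing.maximalIdeal (S.presheaf.stalk s)).IsPrincipal := by
  obtain ⟨U, hU, V, hV, hsV, e, h⟩ :=
    SmoothOfRelativeDimension.exists_isStandardSmoothOfRelativeDimension (n := 1) (f := q) s
  have hUtop : U = ⊤ := by
    have : Subsingleton (Spec (CommRingCat.of ℂ)) :=
      inferInstanceAs (Subsingleton (PrimeSpectrum ℂ))
    ext x
    simpa [Subsingleton.elim x (q s)] using e hsV
  subst hUtop
  have hfield : IsField Γ(Spec (CommRingCat.of ℂ), ⊤) :=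
    (Scheme.ΓSpecIso (CommRingCat.of ℂ)).commRingCatIsoToRingEquiv.toMulEquiv.isField
      (Field.toIsField ℂ)
  let := hfield.toField
  let := S.presheaf.algebra_section_stalk (⟨s, hsV⟩ : V)
  have := hV.isLocalization_stalk ⟨s, hsV⟩
  exact isPrincipal_maximalIdeal_of_isStandardSmooth h (hV.primeIdealOf ⟨s, hsV⟩).asIdeal _

/-! ### A partial inverse of multiplication, built on words. -/

section UniversalSection

variable {T N ι : Type*} [CommRing T] [AddCommGroup N] [Module T N]
  (Z : ι → ι → T) (n₀ : N) (m : ι → N)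

/-- The value of the section on a word in the variables: two letters at a time are traded for an
entry of `Z`. -/
def wordValue : List ι → N
  | [] => n₀
  | [a] => m a
  | a :: b :: l => Z a b • wordValue l

variable {Z n₀ m}

/-- For the empty word this is `hn`. A single letter needs three applications of `hm`, and in a
longer word the first pair factors out. -/
theorem wordValue_exchange_zero (hsymm : ∀ a b, Z a b = Z b a)
    (hn : ∀ a b c d, (Z a b * Z c d) • n₀ = (Z c b * Z a d) • n₀)
    (hm : ∀ a b c, Z a b • m c = Z a c • m b) (a b c d : ι) (l : List ι) :
    (Z a b * Z c d) • wordValue Z n₀ m l = (Z c b * Z a d) • wordValue Z n₀ m l := by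
  induction l using wordValue.induct with
  | case1 => exact hn a b c d
  | case2 e =>
    change (Z a b * Z c d) • m e = (Z c b * Z a d) • m e
    calc (Z a b * Z c d) • m e = Z d c • Z b a • m e := by
          rw [mul_comm, mul_smul, hsymm a b, hsymm c d]
      _ = Z b e • Z d a • m c := by rw [hm b a e, smul_comm, hm d c a]
      _ = (Z c b * Z a d) • m e := by
        rw [smul_comm, hm b e c, smul_smul, mul_comm, hsymm b c, hsymm d a]
  | case3 e f l ih =>
    change (Z a b * Z c d) • Z e f • wordValue Z n₀ m l =
      (Z c b * Z a d) • Z e f • wordValue Z n₀ m l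
    rw [smul_comm, ih, smul_comm]

theorem wordValue_exchange (hsymm : ∀ a b, Z a b = Z b a)
    (hn : ∀ a b c d, (Z a b * Z c d) • n₀ = (Z c b * Z a d) • n₀)
    (hm : ∀ a b c, Z a b • m c = Z a c • m b) (a b c : ι) (l : List ι) :
    Z a b • wordValue Z n₀ m (c :: l) = Z a c • wordValue Z n₀ m (b :: l) := by
  cases l with
  | nil => exact hm a b c
  | cons d l =>
    change Z a b • Z c d • wordValue Z n₀ m l = Z a c • Z b d • wordValue Z n₀ m l
    rw [smul_smul, smul_smul, hsymm a b, wordValue_exchange_zero hsymm hn hm b a c d l, hsymm c a]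

/-- A new first letter changes every pair of the word, so the induction must carry the invariance of
the prefixed words along. -/
theorem wordValue_perm (hsymm : ∀ a b, Z a b = Z b a)
    (hn : ∀ a b c d, (Z a b * Z c d) • n₀ = (Z c b * Z a d) • n₀)
    (hm : ∀ a b c, Z a b • m c = Z a c • m b) {l l' : List ι} (h : l.Perm l') :
    wordValue Z n₀ m l = wordValue Z n₀ m l' ∧
      ∀ c, wordValue Z n₀ m (c :: l) = wordValue Z n₀ m (c :: l') := by
  induction h with
  | nil => exact ⟨rfl, fun _ => rfl⟩
  | cons a _ ih => exact ⟨ih.2 a, fun c => congrArg (Z c a • ·) ih.1⟩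
  | swap a b l =>
    refine ⟨?_, fun c => wordValue_exchange hsymm hn hm c b a l⟩
    change Z b a • wordValue Z n₀ m l = Z a b • wordValue Z n₀ m l
    rw [hsymm]
  | trans _ _ h1 h2 => exact ⟨h1.1.trans h2.1, fun c => (h1.2 c).trans (h2.2 c)⟩

/-- A monomial receives the value of any word spelling it, which is well defined by
`wordValue_perm`. The conditions `hn` and `hm` are what the minors, respectively the Koszul-type
relations, provide in the two quotients used for `N` below. -/
theorem exists_section (hsymm : ∀ a b, Z a b = Z b a)
    (hn : ∀ a b c d, (Z a b * Z c d) • n₀ = (Z c b * Z a d) • n₀)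
    (hm : ∀ a b c, Z a b • m c = Z a c • m b) :
    ∃ L : MvPolynomial ι T →ₗ[T] N, L 1 = n₀ ∧ (∀ a, L (MvPolynomial.X a) = m a) ∧
      ∀ a b p, L (MvPolynomial.X a * MvPolynomial.X b * p) = Z a b • L p := by
  classical
  let F : (ι →₀ ℕ) → N := fun d => wordValue Z n₀ m d.toMultiset.toList
  have hF : ∀ (d : ι →₀ ℕ) (l : List ι), d.toMultiset = l → F d = wordValue Z n₀ m l := by
    intro d l h
    refine (wordValue_perm hsymm hn hm ?_).1
    rw [← Multiset.coe_eq_coe, Multiset.coe_toList, h]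
  let L := (MvPolynomial.basisMonomials ι T).constr T F
  have hL : ∀ d, L (MvPolynomial.monomial d 1) = F d := fun d => by
    have h := Module.Basis.constr_basis (MvPolynomial.basisMonomials ι T) T F d
    rwa [MvPolynomial.coe_basisMonomials] at h
  refine ⟨L, ?_, fun a => ?_, fun a b p => ?_⟩
  · exact (hL 0).trans (hF 0 [] (by simp))
  · exact (hL _).trans (hF _ [a] (by simp [Finsupp.toMultiset_single]))
  · induction p using MvPolynomial.induction_on' with
    | add p q hp hq => rw [mul_add, map_add, map_add, smul_add, hp, hq]
    | monomial d r =>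
      have h1 : MvPolynomial.X a * MvPolynomial.X b * MvPolynomial.monomial d r =
          r • (MvPolynomial.monomial (Finsupp.single a 1 + Finsupp.single b 1 + d) (1 : T)) := by
        rw [MvPolynomial.X, MvPolynomial.X, MvPolynomial.monomial_mul, MvPolynomial.monomial_mul,
          MvPolynomial.smul_monomial]
        simp
      have h2 : MvPolynomial.monomial d r = r • MvPolynomial.monomial d (1 : T) := by
        rw [MvPolynomial.smul_monomial]
        simp
      rw [h1, h2, map_smul, map_smul, hL, hL, smul_comm]
      congr 1
      refine (hF _ (a :: b :: d.toMultiset.toList) ?_).trans rfl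
      simp [Finsupp.toMultiset_single, ← Multiset.cons_coe]

end UniversalSection

/-! ### Presentations with one quadratic relation. -/

/-- The weights of the variables `x₁, x₂, x₃` (`some a`) and `y` (`none`). -/
abbrev varWeight : Option (Fin 3) → ℕ := fun o => o.elim 2 fun _ => 1

/-- The values of the variables `x₁, x₂, x₃` and `y`. -/
abbrev varPoint {P : Type*} (x : Fin 3 → P) (y : P) : Option (Fin 3) → P := fun o => o.elim y x

section Weights

open MvPolynomial

theorem exists_eq_single_add {σ : Type*} (w : σ → ℕ) {d : σ →₀ ℕ} (hd : d ≠ 0) :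
    ∃ i d', d = Finsupp.single i 1 + d' ∧ Finsupp.weight w d = w i + Finsupp.weight w d' := by
  obtain ⟨i, hi⟩ := Finsupp.ne_iff.1 hd
  have h : Finsupp.single i 1 ≤ d := Finsupp.single_le_iff.2 (Nat.one_le_iff_ne_zero.2 hi)
  obtain ⟨d', rfl⟩ := exists_add_of_le h
  refine ⟨i, d', rfl, ?_⟩
  rw [map_add, Finsupp.weight_single, one_smul]

section Positive

variable {σ : Type*} {w : σ → ℕ} {d : σ →₀ ℕ}

theorem eq_zero_of_weight_eq_zero_of_pos (hw : ∀ i, 1 ≤ w i)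
    (h : Finsupp.weight w d = 0) : d = 0 := by
  by_contra hd
  obtain ⟨i, d', -, h'⟩ := exists_eq_single_add w hd
  have := hw i
  omega

theorem exists_of_weight_eq_one_of_pos (hw : ∀ i, 1 ≤ w i) (h : Finsupp.weight w d = 1) :
    ∃ i, w i = 1 ∧ d = Finsupp.single i 1 := by
  have hd : d ≠ 0 := by
    rintro rfl
    simp at h
  obtain ⟨i, d', rfl, h'⟩ := exists_eq_single_add w hd
  have := hw i
  have h0 : d' = 0 := eq_zero_of_weight_eq_zero_of_pos hw (by omega)
  subst h0
  exact ⟨i, by simpa [Finsupp.weight_single] using h, by simp⟩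

theorem exists_of_weight_eq_two_of_pos (hw : ∀ i, 1 ≤ w i) (h : Finsupp.weight w d = 2) :
    (∃ i, w i = 2 ∧ d = Finsupp.single i 1) ∨
      ∃ i j, w i = 1 ∧ w j = 1 ∧ d = Finsupp.single i 1 + Finsupp.single j 1 := by
  have hd : d ≠ 0 := by
    rintro rfl
    simp at h
  obtain ⟨i, d', rfl, h'⟩ := exists_eq_single_add w hd
  have h1 := hw i
  rcases Nat.lt_or_ge (w i) 2 with hi | hi
  · obtain ⟨j, hj, rfl⟩ := exists_of_weight_eq_one_of_pos hw (d := d') (by omega)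
    exact Or.inr ⟨i, j, by omega, hj, rfl⟩
  · have h0 : d' = 0 := eq_zero_of_weight_eq_zero_of_pos hw (by omega)
    subst h0
    exact Or.inl ⟨i, by simpa [Finsupp.weight_single] using h, by simp⟩

end Positive

theorem one_le_varWeight (i : Option (Fin 3)) : 1 ≤ varWeight i := by
  cases i <;> simp [varWeight]

theorem eq_zero_of_weight_eq_zero {d : Option (Fin 3) →₀ ℕ}
    (h : Finsupp.weight varWeight d = 0) : d = 0 :=
  eq_zero_of_weight_eq_zero_of_pos one_le_varWeight h

theorem exists_of_weight_eq_two {d : Option (Fin 3) →₀ ℕ}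
    (h : Finsupp.weight varWeight d = 2) : d = Finsupp.single none 1 ∨
      ∃ a b, d = Finsupp.single (some a) 1 + Finsupp.single (some b) 1 := by
  rcases exists_of_weight_eq_two_of_pos one_le_varWeight h with
    ⟨_ | a, h1, rfl⟩ | ⟨_ | a, _ | b, h1, h2, rfl⟩
  · exact Or.inl rfl
  · exact absurd h1 (by simp [varWeight])
  · exact absurd h1 (by decide)
  · exact absurd h1 (by decide)
  · exact absurd h2 (by decide)
  · exact Or.inr ⟨a, b, rfl⟩

variable {B : Type*} [CommRing B]

theorem mem_span_of_isWeightedHomogeneous_two {p : MvPolynomial (Option (Fin 3)) B}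
    (hp : p.IsWeightedHomogeneous varWeight 2) :
    p ∈ Submodule.span B (insert (X none)
      (Set.range fun ab : Fin 3 × Fin 3 => X (some ab.1) * X (some ab.2))) := by
  rw [p.as_sum]
  refine Submodule.sum_mem _ fun d hd => ?_
  have h : monomial d (coeff d p) = coeff d p • monomial d (1 : B) := by simp [smul_monomial]
  rw [h]
  refine Submodule.smul_mem _ _ (Submodule.subset_span ?_)
  rcases exists_of_weight_eq_two (hp (mem_support_iff.1 hd)) with rfl | ⟨a, b, rfl⟩
  · exact Or.inl rfl
  · exact Or.inr ⟨(a, b), by simp [X, monomial_mul]⟩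

end Weights

/-- `x₁, x₂, x₃` generate `E_1`, together with `y` they generate `E_2`, and `G` generates their
relations. -/
structure IsPresentation {B P : Type*} [CommRing B] [CommRing P] [Algebra B P]
    (E : ℕ → Submodule B P) (x : Fin 3 → P) (y : P) (G : MvPolynomial (Option (Fin 3)) B) :
    Prop where
  homog : G.IsWeightedHomogeneous varWeight 2
  aeval_eq : MvPolynomial.aeval (varPoint x y) G = 0
  one_eq : E 1 = Submodule.span B (Set.range x)
  two_eq : E 2 = Submodule.span B (insert y
    (Set.range fun ab : Fin 3 × Fin 3 => x ab.1 * x ab.2))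
  dvd : ∀ (n : ℕ) (p : MvPolynomial (Option (Fin 3)) B), p.IsWeightedHomogeneous varWeight n →
    MvPolynomial.aeval (varPoint x y) p = 0 → G ∣ p

namespace IsPresentation

open MvPolynomial

variable {B P : Type*} [CommRing B] [CommRing P] [Algebra B P] {E : ℕ → Submodule B P}
  {x : Fin 3 → P} {y : P} {G : MvPolynomial (Option (Fin 3)) B} (h : IsPresentation E x y G)

/-- The element `x_a x_b` of `E_2`. -/
def quad (a b : Fin 3) : E 2 :=
  ⟨x a * x b, h.two_eq ▸ Submodule.subset_span (Or.inr ⟨(a, b), rfl⟩)⟩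

/-- The element `y` of `E_2`. -/
def genY : E 2 := ⟨y, h.two_eq ▸ Submodule.subset_span (Or.inl rfl)⟩

/-- The element `x_a` of `E_1`. -/
def gen (a : Fin 3) : E 1 := ⟨x a, h.one_eq ▸ Submodule.subset_span ⟨a, rfl⟩⟩

theorem quad_comm (a b : Fin 3) : h.quad a b = h.quad b a := Subtype.ext (mul_comm _ _)

variable {N : Type*} [AddCommGroup N] [Module (SymmetricAlgebra B (E 2)) N] [Module B N]
  [IsScalarTower B (SymmetricAlgebra B (E 2)) N]

/-- A linear map from the polynomial ring to a module over `Sym(E_2)` which is linear with respect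
to the part of even degree. -/
structure IsSection (s : MvPolynomial (Option (Fin 3)) B →ₗ[B] N) : Prop where
  quad_smul : ∀ a b q, s (X (some a) * X (some b) * q) = SymmetricAlgebra.ι B (E 2) (h.quad a b) • s q
  genY_smul : ∀ q, s (X none * q) = SymmetricAlgebra.ι B (E 2) h.genY • s q

/-- The variable y becomes a scalar of Sym(E_2) while the x_a remain variables, and `exists_section`
is applied over Sym(E_2). -/
theorem exists_isSection (n₀ : N) (m : Fin 3 → N)
    (hn : ∀ a b c d, (SymmetricAlgebra.ι B (E 2) (h.quad a b) *
      SymmetricAlgebra.ι B (E 2) (h.quad c d)) • n₀ = (SymmetricAlgebra.ι B (E 2) (h.quad c b) *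
      SymmetricAlgebra.ι B (E 2) (h.quad a d)) • n₀)
    (hm : ∀ a b c, SymmetricAlgebra.ι B (E 2) (h.quad a b) • m c =
      SymmetricAlgebra.ι B (E 2) (h.quad a c) • m b) :
    ∃ s : MvPolynomial (Option (Fin 3)) B →ₗ[B] N, h.IsSection s ∧ s 1 = n₀ ∧
      ∀ a, s (X (some a)) = m a := by
  obtain ⟨L, hL1, hLX, hL⟩ := exists_section
    (Z := fun a b => SymmetricAlgebra.ι B (E 2) (h.quad a b)) (n₀ := n₀) (m := m)
    (fun a b => by rw [h.quad_comm]) hn hm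
  let φ : MvPolynomial (Option (Fin 3)) B →ₐ[B]
      MvPolynomial (Fin 3) (SymmetricAlgebra B (E 2)) :=
    aeval fun o => o.elim (C (SymmetricAlgebra.ι B (E 2) h.genY)) X
  refine ⟨L.restrictScalars B ∘ₗ φ.toLinearMap, ⟨fun a b q => ?_, fun q => ?_⟩, ?_, fun a => ?_⟩
  · simpa [φ] using hL a b (φ q)
  · simp [φ, ← smul_eq_C_mul]
  · simpa using hL1
  · simpa [φ] using hLX a

variable {h} {s : MvPolynomial (Option (Fin 3)) B →ₗ[B] N}

theorem IsSection.exists_poly (hs : h.IsSection s) (e : E 2) :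
    ∃ p : MvPolynomial (Option (Fin 3)) B,
    p.IsWeightedHomogeneous varWeight 2 ∧ aeval (varPoint x y) p = (e : P) ∧
      ∀ q, s (p * q) = SymmetricAlgebra.ι B (E 2) e • s q := by
  obtain ⟨e, he⟩ := e
  have he' := he
  rw [h.two_eq] at he'
  induction he' using Submodule.span_induction with
  | mem e he' =>
    rcases he' with rfl | ⟨⟨a, b⟩, rfl⟩
    · exact ⟨X none, isWeightedHomogeneous_X _ _ _, by simp, hs.genY_smul⟩
    · refine ⟨X (some a) * X (some b), ?_, by simp, hs.quad_smul a b⟩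
      exact (isWeightedHomogeneous_X _ _ _).mul (isWeightedHomogeneous_X _ _ _)
  | zero =>
    refine ⟨0, isWeightedHomogeneous_zero _ _ _, by simp, fun q => ?_⟩
    have : (⟨0, he⟩ : E 2) = 0 := rfl
    rw [this, map_zero, zero_smul, zero_mul, map_zero]
  | add e f he' hf' h1 h2 =>
    obtain ⟨p, hp, hpe, hps⟩ := h1 (h.two_eq ▸ he')
    obtain ⟨p', hp', hpe', hps'⟩ := h2 (h.two_eq ▸ hf')
    refine ⟨p + p', hp.add hp', by rw [map_add, hpe, hpe'], fun q => ?_⟩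
    rw [add_mul, map_add, hps, hps', ← add_smul, ← map_add]
    rfl
  | smul c e he' h1 =>
    obtain ⟨p, hp, hpe, hps⟩ := h1 (h.two_eq ▸ he')
    refine ⟨c • p, ?_, by rw [map_smul, hpe], fun q => ?_⟩
    · rw [smul_eq_C_mul]
      exact hp.C_mul c
    · have hce : (⟨c • e, he⟩ : E 2) = c • ⟨e, h.two_eq ▸ he'⟩ := rfl
      rw [smul_mul_assoc, map_smul, hps, hce, map_smul, smul_assoc]

theorem IsSection.exists_poly_pow (hs : h.IsSection s) (n : ℕ) {u : SymmetricAlgebra B (E 2)}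
    (hu : u ∈ SymPow B (E 2) n) : ∃ p : MvPolynomial (Option (Fin 3)) B,
    p.IsWeightedHomogeneous varWeight (2 * n) ∧
      aeval (varPoint x y) p = SymmetricAlgebra.lift (E 2).subtype u ∧
      ∀ q, s (p * q) = u • s q := by
  induction n generalizing u with
  | zero =>
    rw [SymPow, pow_zero, Submodule.mem_one] at hu
    obtain ⟨c, rfl⟩ := hu
    refine ⟨C c, isWeightedHomogeneous_C _ _, ?_, fun q => ?_⟩
    · rw [AlgHom.commutes, ← algebraMap_eq, AlgHom.commutes]
    · rw [← smul_eq_C_mul, map_smul, algebraMap_smul]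
  | succ n ih =>
    rw [SymPow, pow_succ'] at hu
    induction hu using Submodule.mul_induction_on' with
    | mem_mul_mem a ha b hb =>
      obtain ⟨e, rfl⟩ := ha
      obtain ⟨p, hp, hpe, hps⟩ := hs.exists_poly e
      obtain ⟨p', hp', hpe', hps'⟩ := ih hb
      refine ⟨p * p', ?_, ?_, fun q => ?_⟩
      · convert hp.mul hp' using 1
        ring
      · rw [map_mul, map_mul, hpe, hpe', SymmetricAlgebra.lift_ι_apply]
        rfl
      · rw [mul_assoc, hps, hps', smul_smul]
    | add a _ b _ ha hb =>
      obtain ⟨p, hp, hpe, hps⟩ := ha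
      obtain ⟨p', hp', hpe', hps'⟩ := hb
      exact ⟨p + p', hp.add hp', by rw [map_add, map_add, hpe, hpe'], fun q => by
        rw [add_mul, map_add, hps, hps', ← add_smul]⟩

/-- The point of the construction: `s` turns multiplication by a quadratic form into multiplication
by its value in E_2. A quadratic relation has value zero, so all its multiples are killed. -/
theorem IsSection.relation_mul (hs : h.IsSection s) {p : MvPolynomial (Option (Fin 3)) B}
    (hp : p.IsWeightedHomogeneous varWeight 2) (hp0 : aeval (varPoint x y) p = 0)
    (q : MvPolynomial (Option (Fin 3)) B) : s (p * q) = 0 := by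
  suffices H : ∃ e : E 2, (e : P) = aeval (varPoint x y) p ∧
      s (p * q) = SymmetricAlgebra.ι B (E 2) e • s q by
    obtain ⟨e, he, hes⟩ := H
    have : e = 0 := Subtype.ext (he.trans hp0)
    rw [hes, this, map_zero, zero_smul]
  clear hp0
  have hp' := mem_span_of_isWeightedHomogeneous_two hp
  clear hp
  induction hp' using Submodule.span_induction with
  | mem p hp =>
    rcases hp with rfl | ⟨⟨a, b⟩, rfl⟩
    · exact ⟨h.genY, by simp [genY], hs.genY_smul q⟩
    · exact ⟨h.quad a b, by simp [quad], hs.quad_smul a b q⟩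
  | zero => exact ⟨0, by simp, by simp⟩
  | add p p' _ _ h1 h2 =>
    obtain ⟨e, he, hes⟩ := h1
    obtain ⟨e', he', hes'⟩ := h2
    exact ⟨e + e', by rw [map_add, ← he, ← he']; rfl, by
      rw [add_mul, map_add, hes, hes', map_add, add_smul]⟩
  | smul c p _ h1 =>
    obtain ⟨e, he, hes⟩ := h1
    exact ⟨c • e, by rw [map_smul, ← he]; rfl, by
      rw [smul_mul_assoc, map_smul, hes, map_smul, smul_assoc]⟩

theorem IsSection.eq_zero_of_aeval_eq_zero (hs : h.IsSection s) (n : ℕ)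
    {p : MvPolynomial (Option (Fin 3)) B}
    (hp : p.IsWeightedHomogeneous varWeight n) (hp0 : aeval (varPoint x y) p = 0) : s p = 0 := by
  obtain ⟨q, rfl⟩ := h.dvd n p hp hp0
  exact hs.relation_mul h.homog h.aeval_eq q

end IsPresentation

/-! ### Homogeneous parts of the symmetric algebra. -/

section SymComponent

variable (B M : Type*) [CommRing B] [AddCommGroup M] [Module B M]

/-- The grading of the symmetric algebra, as a coaction. -/
noncomputable def symGrading : SymmetricAlgebra B M →ₐ[B] Polynomial (SymmetricAlgebra B M) :=
  SymmetricAlgebra.lift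
    ((Polynomial.monomial 1).restrictScalars B ∘ₗ SymmetricAlgebra.ι B M)

variable {B M}

theorem symGrading_ι (m : M) : symGrading B M (SymmetricAlgebra.ι B M m) =
    Polynomial.monomial 1 (SymmetricAlgebra.ι B M m) := by
  rw [symGrading, SymmetricAlgebra.lift_ι_apply]
  rfl

theorem symGrading_of_mem (n : ℕ) {u : SymmetricAlgebra B M} (hu : u ∈ SymPow B M n) :
    symGrading B M u = Polynomial.monomial n u := by
  induction n generalizing u with
  | zero =>
    rw [SymPow, pow_zero, Submodule.mem_one] at hu
    obtain ⟨c, rfl⟩ := hu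
    rw [AlgHom.commutes, Polynomial.algebraMap_apply]
    rfl
  | succ n ih =>
    rw [SymPow, pow_succ'] at hu
    induction hu using Submodule.mul_induction_on' with
    | mem_mul_mem a ha b hb =>
      obtain ⟨m, rfl⟩ := ha
      rw [map_mul, symGrading_ι, ih hb, Polynomial.monomial_mul_monomial, add_comm]
    | add a _ b _ ha hb => rw [map_add, map_add, ha, hb]

theorem coeff_symGrading_mem (u : SymmetricAlgebra B M) (n : ℕ) :
    (symGrading B M u).coeff n ∈ SymPow B M n := by
  induction u using SymmetricAlgebra.induction generalizing n with
  | algebraMap c =>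
    rw [AlgHom.commutes, Polynomial.algebraMap_apply, Polynomial.coeff_C]
    split_ifs with h
    · subst h
      rw [SymPow, pow_zero]
      exact Submodule.algebraMap_mem c
    · exact zero_mem _
  | ι m =>
    rw [symGrading_ι, Polynomial.coeff_monomial]
    split_ifs with h
    · subst h
      rw [SymPow, pow_one]
      exact ⟨m, rfl⟩
    · exact zero_mem _
  | mul a b ha hb =>
    rw [map_mul, Polynomial.coeff_mul]
    refine Submodule.sum_mem _ fun k hk => ?_
    rw [← Finset.HasAntidiagonal.mem_antidiagonal.1 hk, SymPow, pow_add]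
    exact Submodule.mul_mem_mul (ha _) (hb _)
  | add a b ha hb =>
    rw [map_add, Polynomial.coeff_add]
    exact add_mem (ha n) (hb n)

variable (B M) in
/-- The projection of the symmetric algebra to its part of degree `n`. -/
noncomputable def symComponent (n : ℕ) : SymmetricAlgebra B M →ₗ[B] SymmetricAlgebra B M :=
  (Polynomial.lcoeff (SymmetricAlgebra B M) n).restrictScalars B ∘ₗ (symGrading B M).toLinearMap

theorem symComponent_mem (n : ℕ) (u : SymmetricAlgebra B M) :
    symComponent B M n u ∈ SymPow B M n := coeff_symGrading_mem u n

theorem symComponent_of_mem {n : ℕ} {u : SymmetricAlgebra B M} (hu : u ∈ SymPow B M n) :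
    symComponent B M n u = u := by
  change (symGrading B M u).coeff n = u
  rw [symGrading_of_mem n hu, Polynomial.coeff_monomial, if_pos rfl]

theorem symComponent_mul {k d : ℕ} (t : SymmetricAlgebra B M) {u : SymmetricAlgebra B M}
    (hu : u ∈ SymPow B M d) : symComponent B M (k + d) (t * u) = symComponent B M k t * u := by
  change (symGrading B M (t * u)).coeff (k + d) = (symGrading B M t).coeff k * u
  rw [map_mul, symGrading_of_mem d hu, Polynomial.coeff_mul_monomial]

/-- Applying the degree projection `D` to an expression of `u` replaces its coefficients by their
parts of degree `k`. This turns membership in an ideal or submodule into a statement in one degree.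
-/
theorem mem_span_smul_of_mem_span {V : Type*} [AddCommGroup V] [Module (SymmetricAlgebra B M) V]
    [Module B V] (S : Set V) (k : ℕ) (D : V →ₗ[B] V)
    (hD : ∀ (t : SymmetricAlgebra B M), ∀ v ∈ S, D (t • v) = symComponent B M k t • v)
    {u : V} (hu : u ∈ Submodule.span (SymmetricAlgebra B M) S) (hDu : D u = u) :
    u ∈ Submodule.span B {w | ∃ v ∈ S, ∃ r ∈ SymPow B M k, w = r • v} := by
  obtain ⟨n, f, g, h⟩ := Submodule.mem_span_set'.1 hu
  rw [← hDu, ← h, map_sum]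
  refine Submodule.sum_mem _ fun i _ => Submodule.subset_span ?_
  exact ⟨g i, (g i).2, _, symComponent_mem k (f i), hD _ _ (g i).2⟩

end SymComponent

/-! ### The kernels of multiplication in even and odd degree. -/

namespace IsPresentation

open MvPolynomial

variable {B P : Type*} [CommRing B] [CommRing P] [Algebra B P] {E : ℕ → Submodule B P}
  {x : Fin 3 → P} {y : P} {G : MvPolynomial (Option (Fin 3)) B} (h : IsPresentation E x y G)

/-- Modulo the ideal J of the minors there is a section s with s(1) = 1. A polynomial lift p of u
satisfies s(p) = u mod J, and s(p) = 0 because p is a relation; hence u ∈ J, and the parts of the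
right degree are extracted. -/
theorem even_kernel {n : ℕ} (hn : 2 ≤ n) {u : SymmetricAlgebra B (E 2)}
    (hu : u ∈ SymPow B (E 2) n) (hu0 : SymmetricAlgebra.lift (E 2).subtype u = 0) :
    u ∈ Submodule.span B {v | ∃ (a b c d : Fin 3), ∃ r ∈ SymPow B (E 2) (n - 2),
      v = (SymmetricAlgebra.ι B (E 2) (h.quad a c) * SymmetricAlgebra.ι B (E 2) (h.quad b d) -
        SymmetricAlgebra.ι B (E 2) (h.quad a d) * SymmetricAlgebra.ι B (E 2) (h.quad b c)) * r} := by
  let ζ : Fin 3 → Fin 3 → SymmetricAlgebra B (E 2) :=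
    fun a b => SymmetricAlgebra.ι B (E 2) (h.quad a b)
  let S : Set (SymmetricAlgebra B (E 2)) :=
    {v | ∃ a b c d, v = ζ a c * ζ b d - ζ a d * ζ b c}
  let J := Ideal.span S
  obtain ⟨s, hs, hs1, -⟩ := h.exists_isSection (N := SymmetricAlgebra B (E 2) ⧸ J) 1 0
    (fun a b c d => by
      rw [← sub_eq_zero, ← sub_smul]
      change Ideal.Quotient.mk J ((ζ a b * ζ c d - ζ c b * ζ a d) * 1) = 0
      rw [mul_one, Ideal.Quotient.eq_zero_iff_mem]
      exact Ideal.subset_span ⟨a, c, b, d, by ring⟩)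
    (fun a b c => by simp)
  obtain ⟨p, hp, hpu, hps⟩ := hs.exists_poly_pow n hu
  have h0 := hs.eq_zero_of_aeval_eq_zero _ hp (hpu.trans hu0)
  have h1 := hps 1
  rw [mul_one, h0, hs1] at h1
  have huJ : u ∈ J := by
    have h2 : Ideal.Quotient.mk J (u * 1) = 0 := h1.symm
    rwa [mul_one, Ideal.Quotient.eq_zero_iff_mem] at h2
  have h3 := mem_span_smul_of_mem_span S (n - 2) (symComponent B (E 2) n) (fun t v hv => by
    obtain ⟨a, b, c, d, rfl⟩ := hv
    have h4 := symComponent_mul (B := B) (M := E 2) (k := n - 2) (d := 2) t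
      (u := ζ a c * ζ b d - ζ a d * ζ b c) (by
        rw [SymPow, pow_two]
        exact sub_mem (Submodule.mul_mem_mul ⟨_, rfl⟩ ⟨_, rfl⟩)
          (Submodule.mul_mem_mul ⟨_, rfl⟩ ⟨_, rfl⟩))
    rwa [Nat.sub_add_cancel hn] at h4) huJ (symComponent_of_mem hu)
  refine Submodule.span_mono ?_ h3
  rintro _ ⟨_, ⟨a, b, c, d, rfl⟩, r, hr, rfl⟩
  exact ⟨a, b, c, d, r, hr, mul_comm _ _⟩

/-- The same argument in Sym(E_2)³ modulo the Koszul-type relations, with s(1) = 0 and s(x_a) the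
a-th unit vector. For lifts p_a of the u_a, the value of s on ∑ x_a p_a is the class of u, and this
polynomial is a relation. -/
theorem odd_kernel {n : ℕ} (hn : 1 ≤ n) {u : Fin 3 → SymmetricAlgebra B (E 2)}
    (hu : ∀ a, u a ∈ SymPow B (E 2) n)
    (hu0 : ∑ a, x a * SymmetricAlgebra.lift (E 2).subtype (u a) = 0) :
    u ∈ Submodule.span B {v | ∃ (a b l : Fin 3), ∃ r ∈ SymPow B (E 2) (n - 1),
      v = Pi.single a (SymmetricAlgebra.ι B (E 2) (h.quad b l) * r) -
        Pi.single b (SymmetricAlgebra.ι B (E 2) (h.quad a l) * r)} := by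
  let ζ : Fin 3 → Fin 3 → SymmetricAlgebra B (E 2) :=
    fun a b => SymmetricAlgebra.ι B (E 2) (h.quad a b)
  let S : Set (Fin 3 → SymmetricAlgebra B (E 2)) :=
    {v | ∃ a b l, v = Pi.single a (ζ b l) - Pi.single b (ζ a l)}
  let R := Submodule.span (SymmetricAlgebra B (E 2)) S
  obtain ⟨s, hs, -, hsX⟩ := h.exists_isSection
    (N := (Fin 3 → SymmetricAlgebra B (E 2)) ⧸ R) 0 (fun a => R.mkQ (Pi.single a 1))
    (fun a b c d => by simp)
    (fun a b c => by
      rw [← map_smul, ← map_smul, ← sub_eq_zero, ← map_sub, ← LinearMap.mem_ker,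
        Submodule.ker_mkQ]
      refine Submodule.subset_span ⟨c, b, a, ?_⟩
      rw [← Pi.single_smul, ← Pi.single_smul, smul_eq_mul, smul_eq_mul, mul_one, mul_one,
        h.quad_comm a b, h.quad_comm a c])
  choose p hp hpu hps using fun a => hs.exists_poly_pow n (hu a)
  have h0 : s (∑ a, X (some a) * p a) = 0 := by
    refine hs.eq_zero_of_aeval_eq_zero (1 + 2 * n) ?_ ?_
    · exact IsWeightedHomogeneous.sum _ _ _ fun a _ => (isWeightedHomogeneous_X _ _ _).mul (hp a)
    · rw [map_sum, ← hu0]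
      refine Finset.sum_congr rfl fun a _ => ?_
      rw [map_mul, aeval_X, hpu]
      rfl
  have huR : u ∈ R := by
    rw [← Submodule.ker_mkQ R, LinearMap.mem_ker, ← h0, map_sum, pi_eq_sum_univ' u, map_sum]
    refine Finset.sum_congr rfl fun a _ => ?_
    rw [mul_comm, hps, hsX, map_smul]
  have h3 := mem_span_smul_of_mem_span S (n - 1)
    (LinearMap.pi fun a => symComponent B (E 2) n ∘ₗ LinearMap.proj a) (fun t v hv => by
    obtain ⟨a, b, l, rfl⟩ := hv
    have h4 : ∀ b l, symComponent B (E 2) n (t * ζ b l) = symComponent B (E 2) (n - 1) t * ζ b l := by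
      intro b l
      have h5 := symComponent_mul (B := B) (M := E 2) (k := n - 1) (d := 1) t (u := ζ b l) (by
        rw [SymPow, pow_one]
        exact ⟨_, rfl⟩)
      rwa [Nat.sub_add_cancel hn] at h5
    have h6 : ∀ a b l c, symComponent B (E 2) n (t * (Pi.single a (ζ b l) :
        Fin 3 → SymmetricAlgebra B (E 2)) c) = symComponent B (E 2) (n - 1) t *
          (Pi.single a (ζ b l) : Fin 3 → SymmetricAlgebra B (E 2)) c := by
      intro a b l c
      by_cases hc : c = a
      · subst hc
        simp only [Pi.single_eq_same, h4]
      · simp [Pi.single_eq_of_ne hc]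
    ext1 c
    simp only [LinearMap.pi_apply, LinearMap.comp_apply, LinearMap.proj_apply, Pi.smul_apply,
      Pi.sub_apply, mul_sub, map_sub, smul_eq_mul, h6]) huR (funext fun a => symComponent_of_mem (hu a))
  refine Submodule.span_mono ?_ h3
  rintro _ ⟨_, ⟨a, b, l, rfl⟩, r, hr, rfl⟩
  refine ⟨a, b, l, r, hr, ?_⟩
  rw [smul_sub, ← Pi.single_smul, ← Pi.single_smul, smul_eq_mul, smul_eq_mul, mul_comm r,
    mul_comm r]

end IsPresentation

/-! ### Exterior and symmetric squares. -/

section Multilinear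

variable {B M N : Type*} [CommRing B] [AddCommGroup M] [Module B M] [AddCommGroup N] [Module B N]

theorem ιMulti_eq_wedge (v : Fin 2 → M) : exteriorPower.ιMulti B 2 v = wedge B (v 0) (v 1) := by
  rw [wedge]
  congr 1
  ext i
  fin_cases i <;> rfl

theorem wedge_hom_ext {f g : ⋀[B]^2 M →ₗ[B] N} (h : ∀ a b, f (wedge B a b) = g (wedge B a b)) :
    f = g := by
  refine exteriorPower.linearMap_ext ?_
  ext v
  simp only [LinearMap.compAlternatingMap_apply, ιMulti_eq_wedge]
  exact h _ _

theorem wedge_self (a : M) : wedge B a a = 0 :=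
  (exteriorPower.ιMulti B 2).map_eq_zero_of_eq ![a, a] (i := 0) (j := 1) rfl (by decide)

theorem wedge_swap (a b : M) : wedge B b a = -wedge B a b := by
  have h := (exteriorPower.ιMulti B 2).map_swap (v := ![a, b]) (i := 0) (j := 1) (by decide)
  rw [ιMulti_eq_wedge, ιMulti_eq_wedge] at h
  simpa using h

theorem span_wedge_of_span {x : Fin 3 → M} (hx : Submodule.span B (Set.range x) = ⊤) :
    Submodule.span B {w : ⋀[B]^2 M | w = wedge B (x 0) (x 1) ∨ w = wedge B (x 0) (x 2) ∨
      w = wedge B (x 1) (x 2)} = ⊤ := by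
  rw [eq_top_iff, ← exteriorPower.ιMulti_span_of_span B 2 M hx, Submodule.span_le]
  rintro _ ⟨v, hv, rfl⟩
  rw [ιMulti_eq_wedge]
  obtain ⟨i, hi⟩ := hv ⟨0, rfl⟩
  obtain ⟨j, hj⟩ := hv ⟨1, rfl⟩
  rw [← hi, ← hj]
  generalize hW : Submodule.span B {w : ⋀[B]^2 M | w = wedge B (x 0) (x 1) ∨
    w = wedge B (x 0) (x 2) ∨ w = wedge B (x 1) (x 2)} = W
  have h01 : wedge B (x 0) (x 1) ∈ W := hW ▸ Submodule.subset_span (Or.inl rfl)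
  have h02 : wedge B (x 0) (x 2) ∈ W := hW ▸ Submodule.subset_span (Or.inr (Or.inl rfl))
  have h12 : wedge B (x 1) (x 2) ∈ W := hW ▸ Submodule.subset_span (Or.inr (Or.inr rfl))
  have hself : ∀ a, wedge B (x a) (x a) ∈ W := fun a => by
    rw [wedge_self]
    exact zero_mem _
  have hswap : ∀ a b, wedge B (x a) (x b) ∈ W → wedge B (x b) (x a) ∈ W := fun a b h => by
    rw [wedge_swap]
    exact neg_mem h
  match i, j with
  | 0, 0 => exact hself 0
  | 1, 1 => exact hself 1
  | 2, 2 => exact hself 2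
  | 0, 1 => exact h01
  | 0, 2 => exact h02
  | 1, 2 => exact h12
  | 1, 0 => exact hswap _ _ h01
  | 2, 0 => exact hswap _ _ h02
  | 2, 1 => exact hswap _ _ h12

/-- A bilinear map vanishing on the diagonal, as a linear map on the exterior square. -/
noncomputable def wedgeLift (g : M →ₗ[B] M →ₗ[B] N) (hg : ∀ a, g a a = 0) : ⋀[B]^2 M →ₗ[B] N :=
  exteriorPower.alternatingMapLinearEquiv
    { toFun := fun v => g (v 0) (v 1)
      map_update_add' := fun v i a b => by fin_cases i <;> simp
      map_update_smul' := fun v i c a => by fin_cases i <;> simp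
      map_eq_zero_of_eq' := fun v i j hv hij => by
        have h01 : v 0 = v 1 := by
          fin_cases i <;> fin_cases j <;> first | exact absurd rfl hij | exact hv | exact hv.symm
        rw [h01, hg] }

theorem wedgeLift_wedge (g : M →ₗ[B] M →ₗ[B] N) (hg : ∀ a, g a a = 0) (a b : M) :
    wedgeLift g hg (wedge B a b) = g a b :=
  exteriorPower.alternatingMapLinearEquiv_apply_ιMulti _ _

theorem span_mk₂_of_span {W : Set M} (hW : Submodule.span B W = ⊤) :
    Submodule.span B {v : SymPow B M 2 | ∃ a ∈ W, ∃ b ∈ W, v = SymPow.mk₂ B a b} = ⊤ := by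
  refine Submodule.map_injective_of_injective (Submodule.subtype_injective (SymPow B M 2)) ?_
  have h1 : LinearMap.range (SymmetricAlgebra.ι B M) =
      Submodule.span B (SymmetricAlgebra.ι B M '' W) := by
    rw [← Submodule.map_span, hW, Submodule.map_top]
  rw [Submodule.map_span, Submodule.map_top, Submodule.range_subtype]
  change _ = LinearMap.range (SymmetricAlgebra.ι B M) ^ 2
  rw [h1, pow_two, Submodule.span_mul_span]
  congr 1
  ext v
  constructor
  · rintro ⟨_, ⟨a, ha, b, hb, rfl⟩, rfl⟩
    exact Set.mul_mem_mul ⟨a, ha, rfl⟩ ⟨b, hb, rfl⟩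
  · rintro ⟨_, ⟨a, ha, rfl⟩, _, ⟨b, hb, rfl⟩, rfl⟩
    exact ⟨_, ⟨a, ha, b, hb, rfl⟩, rfl⟩

/-- `SymPow` is a submodule of the symmetric algebra rather than a quotient of the tensor square.
Freeness makes that algebra a polynomial ring, where a linear map can be prescribed on monomials. -/
theorem exists_symPow_two_lift [Module.Free B M] (b : M →ₗ[B] M →ₗ[B] N)
    (hb : ∀ m m', b m m' = b m' m) :
    ∃ φ : SymPow B M 2 →ₗ[B] N, ∀ m m', φ (SymPow.mk₂ B m m') = b m m' := by
  classical
  let e := Module.Free.chooseBasis B M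
  let ψ := SymmetricAlgebra.equivMvPolynomial e
  -- Monomials of other degrees get the junk value zero; the arbitrary order of the two letters is
  -- harmless because `b` is symmetric.
  let wd : List (Module.Free.ChooseBasisIndex B M) → N := fun l =>
    match l with
    | [i, j] => b (e i) (e j)
    | _ => 0
  let L := (MvPolynomial.basisMonomials (Module.Free.ChooseBasisIndex B M) B).constr B
    (fun d => wd d.toMultiset.toList)
  have hL : ∀ i j, L (MvPolynomial.X i * MvPolynomial.X j) = b (e i) (e j) := by
    intro i j
    have h1 := Module.Basis.constr_basis
      (MvPolynomial.basisMonomials (Module.Free.ChooseBasisIndex B M) B) B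
      (fun d => wd d.toMultiset.toList) (Finsupp.single i 1 + Finsupp.single j 1)
    rw [MvPolynomial.coe_basisMonomials] at h1
    rw [MvPolynomial.X, MvPolynomial.X, MvPolynomial.monomial_mul, one_mul]
    refine h1.trans ?_
    have h2 : (Finsupp.toMultiset (Finsupp.single i 1 + Finsupp.single j 1)).toList.Perm [i, j] := by
      rw [← Multiset.coe_eq_coe, Multiset.coe_toList]
      simp [Finsupp.toMultiset_single, ← Multiset.cons_coe]
    rcases List.perm_pair.1 h2 with h3 | h3
    · simp only [h3, wd]
    · simp only [h3, wd]
      exact hb _ _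
  refine ⟨(L ∘ₗ ψ.toLinearMap) ∘ₗ (SymPow B M 2).subtype, fun m m' => ?_⟩
  have h1 : ((LinearMap.mul B (SymmetricAlgebra B M)).compl₁₂ (SymmetricAlgebra.ι B M)
      (SymmetricAlgebra.ι B M)).compr₂ (L ∘ₗ ψ.toLinearMap) = b := by
    refine e.ext fun i => e.ext fun j => ?_
    simp only [LinearMap.compr₂_apply, LinearMap.compl₁₂_apply, LinearMap.mul_apply',
      LinearMap.comp_apply, AlgEquiv.toLinearMap_apply, map_mul]
    rw [SymmetricAlgebra.equivMvPolynomial_ι_apply, SymmetricAlgebra.equivMvPolynomial_ι_apply, hL]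
  exact congr($h1 m m')

end Multilinear

/-! ### The graded pieces of A. -/

section Graded

variable {B P : Type*} [CommRing B] [CommRing P] [Algebra B P]
  (E : ℕ → Submodule B P) [SetLike.GradedMonoid E]

/-- The products of at most one factor in `E_1` with factors in `E_2`. -/
def evenOddPart (n : ℕ) : Submodule B P := E 1 ^ (n % 2) * E 2 ^ (n / 2)

/-- Two odd factors leave over a product of two elements of E_1, which E_2 absorbs. -/
theorem evenOddPart_mul_le (m n : ℕ) :
    evenOddPart E m * evenOddPart E n ≤ evenOddPart E (m + n) := by
  have h11 : E 1 * E 1 ≤ E 2 := Submodule.mul_le.2 fun a ha b hb => SetLike.GradedMul.mul_mem ha hb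
  have key : evenOddPart E m * evenOddPart E n =
      (E 1 ^ (m % 2) * E 1 ^ (n % 2)) * E 2 ^ (m / 2 + n / 2) := by
    rw [evenOddPart, evenOddPart, pow_add]
    ring
  rw [key]
  rcases Nat.mod_two_eq_zero_or_one m with hm | hm <;>
    rcases Nat.mod_two_eq_zero_or_one n with hn | hn
  · have h1 : (m + n) % 2 = 0 := by omega
    have h2 : (m + n) / 2 = m / 2 + n / 2 := by omega
    rw [evenOddPart, hm, hn, h1, h2, pow_zero, one_mul]
  · have h1 : (m + n) % 2 = 1 := by omega
    have h2 : (m + n) / 2 = m / 2 + n / 2 := by omega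
    rw [evenOddPart, hm, hn, h1, h2, pow_zero, one_mul]
  · have h1 : (m + n) % 2 = 1 := by omega
    have h2 : (m + n) / 2 = m / 2 + n / 2 := by omega
    rw [evenOddPart, hm, hn, h1, h2, pow_zero, mul_one]
  · have h1 : (m + n) % 2 = 0 := by omega
    have h2 : (m + n) / 2 = m / 2 + n / 2 + 1 := by omega
    rw [evenOddPart, hm, hn, h1, h2, pow_zero, one_mul, pow_one, pow_succ']
    exact mul_le_mul_left h11 _

/-- The elements all of whose components are such products form a subalgebra containing the
generators of A. Both multiplication maps are surjective for this reason. -/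
theorem coe_mem_evenOddPart {n : ℕ} {a : E n} (ha : a ∈ gradedA E n) :
    (a : P) ∈ evenOddPart E n := by
  have key : ∀ f ∈ subalgebraA E, ∀ n, (f n : P) ∈ evenOddPart E n := by
    intro f hf
    induction hf using Algebra.adjoin_induction with
    | mem f hf =>
      intro n
      rcases hf with ⟨a, rfl⟩ | ⟨a, rfl⟩
      · rw [DirectSum.lof_eq_of, DirectSum.coe_of_apply]
        split_ifs with h
        · subst h
          simp [evenOddPart]
        · exact zero_mem _
      · rw [DirectSum.lof_eq_of, DirectSum.coe_of_apply]
        split_ifs with h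
        · subst h
          simp [evenOddPart]
        · exact zero_mem _
    | algebraMap c =>
      intro n
      have h1 : algebraMap B (⨁ n, E n) c =
        DirectSum.lof B ℕ (fun n => E n) 0 (c • ⟨1, SetLike.GradedOne.one_mem⟩) := by
        rw [map_smul, Algebra.algebraMap_eq_smul_one]
        rfl
      rw [h1, DirectSum.lof_eq_of, DirectSum.coe_of_apply]
      split_ifs with h
      · subst h
        simp only [evenOddPart, Nat.zero_mod, Nat.zero_div, pow_zero, mul_one]
        exact Submodule.smul_mem _ _ (Submodule.one_le.1 le_rfl)
      · exact zero_mem _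
    | add f g _ _ hf hg =>
      intro n
      rw [DirectSum.add_apply]
      exact add_mem (hf n) (hg n)
    | mul f g _ _ hf hg =>
      intro n
      classical
      rw [DirectSum.coe_mul_apply]
      refine Submodule.sum_mem _ fun k hk => ?_
      rw [← (Finset.mem_filter.1 hk).2]
      exact evenOddPart_mul_le E _ _ (Submodule.mul_mem_mul (hf _) (hg _))
  have h1 := key _ ha n
  rwa [DirectSum.lof_eq_of, DirectSum.of_eq_same] at h1

theorem exists_lift_eq_of_mem_pow (E : ℕ → Submodule B P) (n : ℕ) {a : P} (ha : a ∈ E 2 ^ n) :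
    ∃ u ∈ SymPow B (E 2) n, SymmetricAlgebra.lift (E 2).subtype u = a := by
  have h2 : (SymmetricAlgebra.lift (E 2).subtype).toLinearMap ∘ₗ SymmetricAlgebra.ι B (E 2) =
      (E 2).subtype := SymmetricAlgebra.lift_comp_ι _
  have h3 : E 2 ^ n = (SymPow B (E 2) n).map
      (SymmetricAlgebra.lift (E 2).subtype).toLinearMap := by
    rw [SymPow, Submodule.map_pow, ← LinearMap.range_comp, h2, Submodule.range_subtype]
  rw [h3] at ha
  obtain ⟨u, hu, rfl⟩ := ha
  exact ⟨u, hu, rfl⟩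

theorem coe_evenMap (n : ℕ) (u : SymPow B (E 2) n) :
    ((evenMap E n u : E (2 * n)) : P) = SymmetricAlgebra.lift (E 2).subtype u := rfl

theorem coe_sigmaTwo (a b : E 1) : ((sigmaTwo E (SymPow.mk₂ B a b) : E 2) : P) = a * b := by
  change SymmetricAlgebra.lift (E 1).subtype
    (SymmetricAlgebra.ι B (E 1) a * SymmetricAlgebra.ι B (E 1) b) = _
  rw [map_mul, SymmetricAlgebra.lift_ι_apply, SymmetricAlgebra.lift_ι_apply]
  rfl

theorem evenMap_surjective (n : ℕ) : Function.Surjective (evenMap E n) := by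
  intro a
  have h1 := coe_mem_evenOddPart E a.2
  have h2 : 2 * n % 2 = 0 := by omega
  have h3 : 2 * n / 2 = n := by omega
  rw [evenOddPart, h2, h3, pow_zero, one_mul] at h1
  obtain ⟨u, hu, hua⟩ := exists_lift_eq_of_mem_pow E n h1
  exact ⟨⟨u, hu⟩, Subtype.ext (Subtype.ext hua)⟩

theorem coe_oddMap_tmul (n : ℕ) (a : E 1) (r : gradedA E (2 * n)) :
    ((oddMap E n (a ⊗ₜ r) : E (2 * n + 1)) : P) = a * ((r : E (2 * n)) : P) := rfl

theorem oddMap_surjective (n : ℕ) : Function.Surjective (oddMap E n) := by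
  intro a
  have h1 := coe_mem_evenOddPart E a.2
  have h2 : (2 * n + 1) % 2 = 1 := by omega
  have h3 : (2 * n + 1) / 2 = n := by omega
  rw [evenOddPart, h2, h3, pow_one] at h1
  suffices H : ∀ b ∈ E 1 * E 2 ^ n, ∃ w, ((oddMap E n w : E (2 * n + 1)) : P) = b by
    obtain ⟨w, hw⟩ := H _ h1
    exact ⟨w, Subtype.ext (Subtype.ext hw)⟩
  intro b hb
  induction hb using Submodule.mul_induction_on' with
  | mem_mul_mem b hb c hc =>
    obtain ⟨u, hu, rfl⟩ := exists_lift_eq_of_mem_pow E n hc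
    exact ⟨(⟨b, hb⟩ : E 1) ⊗ₜ evenMap E n ⟨u, hu⟩, rfl⟩
  | add b _ c _ hb hc =>
    obtain ⟨w, hw⟩ := hb
    obtain ⟨w', hw'⟩ := hc
    exact ⟨w + w', by rw [map_add, ← hw, ← hw']; rfl⟩

end Graded

namespace IsPresentation

open MvPolynomial

variable {B P : Type*} [CommRing B] [CommRing P] [Algebra B P] {E : ℕ → Submodule B P}
  {x : Fin 3 → P} {y : P} {G : MvPolynomial (Option (Fin 3)) B} (h : IsPresentation E x y G)

/-- A linear relation has weight one; as a multiple of `G`, which has weight two, it must vanish. -/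
theorem linearIndependent_gen : LinearIndependent B h.gen := by
  refine LinearIndependent.of_comp (E 1).subtype (Fintype.linearIndependent_iff.2 fun c hc a => ?_)
  have hc' : ∑ a, c a • x a = 0 := hc
  obtain ⟨q, hq⟩ := h.dvd 1 (∑ a, c a • X (some a)) (by
    refine IsWeightedHomogeneous.sum _ _ _ fun a _ => ?_
    rw [smul_eq_C_mul]
    exact (isWeightedHomogeneous_X _ _ _).C_mul _) (by
    rw [map_sum, ← hc']
    refine Finset.sum_congr rfl fun a _ => ?_
    rw [map_smul, aeval_X]
    rfl)
  have h1 := congrArg (coeff (Finsupp.single (some a) 1)) hq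
  rw [coeff_sum, coeff_mul] at h1
  rw [Finset.sum_eq_single a, Finset.sum_eq_zero] at h1
  · simpa using h1
  · intro d hd
    rw [h.homog.coeff_eq_zero, zero_mul]
    intro h2
    have h3 := congrArg (Finsupp.weight varWeight) (Finset.HasAntidiagonal.mem_antidiagonal.1 hd)
    rw [map_add, h2, Finsupp.weight_single] at h3
    have : varWeight (some a) = 1 := rfl
    rw [this] at h3
    simp at h3
    omega
  · intro b _ hb
    simp [coeff_X, Finsupp.single_left_inj, hb]
  · simp

theorem span_gen : Submodule.span B (Set.range h.gen) = ⊤ := by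
  refine Submodule.map_injective_of_injective (Submodule.subtype_injective (E 1)) ?_
  rw [Submodule.map_span, Submodule.map_top, Submodule.range_subtype, ← Set.range_comp]
  exact h.one_eq.symm

/-- The basis `x₁, x₂, x₃` of `E_1`. -/
noncomputable def basis : Module.Basis (Fin 3) B (E 1) :=
  .mk h.linearIndependent_gen h.span_gen.ge

theorem basis_apply (a : Fin 3) : h.basis a = h.gen a := Module.Basis.mk_apply _ _ a

end IsPresentation

/-! ### The maps i_n and j_n. -/

section Minors

variable {B M T : Type*} [CommRing B] [AddCommGroup M] [Module B M] [CommRing T] [Algebra B T]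
  (Z : M →ₗ[B] M →ₗ[B] T)

/-- The minors with rows `a` and `b`, as a linear map on the exterior square. -/
noncomputable def rowMinor (a b : M) : ⋀[B]^2 M →ₗ[B] T :=
  wedgeLift (LinearMap.mk₂ B (fun c d => Z a c * Z b d - Z a d * Z b c)
    (fun c c' d => by simp only [map_add]; ring)
    (fun r c d => by simp only [map_smul, smul_mul_assoc, mul_smul_comm, smul_sub])
    (fun c d d' => by simp only [map_add]; ring)
    (fun r c d => by simp only [map_smul, smul_mul_assoc, mul_smul_comm, smul_sub]))
    (fun c => by simp [LinearMap.mk₂_apply])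

theorem rowMinor_wedge (a b c d : M) :
    rowMinor Z a b (wedge B c d) = Z a c * Z b d - Z a d * Z b c := by
  rw [rowMinor, wedgeLift_wedge, LinearMap.mk₂_apply]

/-- The bilinear form `(a ∧ b, c ∧ d) ↦ Z(a,c) Z(b,d) - Z(a,d) Z(b,c)`. -/
noncomputable def minorForm : ⋀[B]^2 M →ₗ[B] ⋀[B]^2 M →ₗ[B] T :=
  wedgeLift (LinearMap.mk₂ B (rowMinor Z)
    (fun a a' b => wedge_hom_ext fun c d => by
      simp only [LinearMap.add_apply, rowMinor_wedge, map_add]; ring)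
    (fun r a b => wedge_hom_ext fun c d => by
      simp only [LinearMap.smul_apply, rowMinor_wedge, map_smul, smul_mul_assoc, smul_sub])
    (fun a b b' => wedge_hom_ext fun c d => by
      simp only [LinearMap.add_apply, rowMinor_wedge, map_add]; ring)
    (fun r a b => wedge_hom_ext fun c d => by
      simp only [LinearMap.smul_apply, rowMinor_wedge, map_smul, mul_smul_comm, smul_sub]))
    (fun a => wedge_hom_ext fun c d => by
      simp only [LinearMap.mk₂_apply, rowMinor_wedge, LinearMap.zero_apply]; ring)

theorem minorForm_wedge (a b c d : M) :
    minorForm Z (wedge B a b) (wedge B c d) = Z a c * Z b d - Z a d * Z b c := by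
  rw [minorForm, wedgeLift_wedge, LinearMap.mk₂_apply, rowMinor_wedge]

variable {Z} in
theorem minorForm_comm (hZ : ∀ a b, Z a b = Z b a) (v w : ⋀[B]^2 M) :
    minorForm Z v w = minorForm Z w v := by
  suffices H : minorForm Z = (minorForm Z).flip from congr($H v w)
  refine wedge_hom_ext fun a b => wedge_hom_ext fun c d => ?_
  rw [LinearMap.flip_apply, minorForm_wedge, minorForm_wedge, hZ a c, hZ b d, hZ a d, hZ b c]
  ring

variable (B M) in
theorem span_wedge : Submodule.span B {w : ⋀[B]^2 M | ∃ a b, w = wedge B a b} = ⊤ := by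
  rw [eq_top_iff, ← exteriorPower.ιMulti_span B 2 M, Submodule.span_le]
  rintro _ ⟨v, rfl⟩
  exact Submodule.subset_span ⟨_, _, ιMulti_eq_wedge v⟩

variable (B M) in
theorem span_mk₂_wedge : Submodule.span B {v : SymPow B (⋀[B]^2 M) 2 |
      ∃ a b c d, v = SymPow.mk₂ B (wedge B a b) (wedge B c d)} = ⊤ := by
  rw [eq_top_iff, ← span_mk₂_of_span (span_wedge B M), Submodule.span_le]
  rintro _ ⟨_, ⟨a, b, rfl⟩, _, ⟨c, d, rfl⟩, rfl⟩
  exact Submodule.subset_span ⟨a, b, c, d, rfl⟩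

variable {Z} in
theorem exists_minorLift [Module.Free B M] (hZ : ∀ a b, Z a b = Z b a) :
    ∃ φ : SymPow B (⋀[B]^2 M) 2 →ₗ[B] T, ∀ a b c d,
      φ (SymPow.mk₂ B (wedge B a b) (wedge B c d)) = Z a c * Z b d - Z a d * Z b c := by
  obtain ⟨φ, hφ⟩ := exists_symPow_two_lift (minorForm Z) (minorForm_comm hZ)
  exact ⟨φ, fun a b c d => by rw [hφ, minorForm_wedge]⟩

variable {Z} in
/-- The bilinear form `minorForm`, as a linear map on the symmetric square. -/
noncomputable def minorLift [Module.Free B M] (hZ : ∀ a b, Z a b = Z b a) :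
    SymPow B (⋀[B]^2 M) 2 →ₗ[B] T := (exists_minorLift hZ).choose

variable {Z} in
theorem minorLift_apply [Module.Free B M] (hZ : ∀ a b, Z a b = Z b a) (a b c d : M) :
    minorLift hZ (SymPow.mk₂ B (wedge B a b) (wedge B c d)) = Z a c * Z b d - Z a d * Z b c :=
  (exists_minorLift hZ).choose_spec a b c d

theorem minorLift_mem (W : Submodule B T) (φ : SymPow B (⋀[B]^2 M) 2 →ₗ[B] T)
    (h : ∀ a b c d, φ (SymPow.mk₂ B (wedge B a b) (wedge B c d)) ∈ W)
    (v : SymPow B (⋀[B]^2 M) 2) : φ v ∈ W := by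
  have hv : v ∈ (⊤ : Submodule B (SymPow B (⋀[B]^2 M) 2)) := trivial
  rw [← span_mk₂_wedge] at hv
  change v ∈ W.comap φ
  refine Submodule.span_le.2 ?_ hv
  rintro _ ⟨a, b, c, d, rfl⟩
  exact h a b c d

theorem symPow_tensor_hom_eq_zero {N A : Type*} [AddCommGroup N] [Module B N] [AddCommGroup A]
    [Module B A] {f : SymPow B (⋀[B]^2 M) 2 ⊗[B] A →ₗ[B] N}
    (h : ∀ a b c d r, f (SymPow.mk₂ B (wedge B a b) (wedge B c d) ⊗ₜ r) = 0) : f = 0 := by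
  refine TensorProduct.ext' fun v r => ?_
  suffices H : f ∘ₗ (TensorProduct.mk B _ _).flip r = 0 from congr($H v)
  refine LinearMap.ext_on (span_mk₂_wedge B M) ?_
  rintro _ ⟨a, b, c, d, rfl⟩
  exact h a b c d r

theorem symPow_mul_mem {n : ℕ} (hn : 2 ≤ n)
    {v r : SymmetricAlgebra B M} (hv : v ∈ SymPow B M 2) (hr : r ∈ SymPow B M (n - 2)) :
    v * r ∈ SymPow B M n := by
  have h := Submodule.mul_mem_mul hv hr
  rwa [SymPow, SymPow, ← pow_add, Nat.add_sub_cancel' hn] at h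

/-- Multiplication by the values of a linear map to the symmetric square. -/
noncomputable def symPowMul {C : Type*} [AddCommGroup C] [Module B C] {n : ℕ} (hn : 2 ≤ n)
    (φ : C →ₗ[B] SymmetricAlgebra B M) (hφ : ∀ v, φ v ∈ SymPow B M 2) :
    C ⊗[B] SymPow B M (n - 2) →ₗ[B] SymPow B M n :=
  TensorProduct.lift (LinearMap.mk₂ B
    (fun v r => ⟨φ v * r, symPow_mul_mem hn (hφ v) r.2⟩)
    (fun v v' r => Subtype.ext (by simp only [map_add, add_mul]; rfl))
    (fun c v r => Subtype.ext (by simp only [map_smul, smul_mul_assoc]; rfl))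
    (fun v r r' => Subtype.ext (by simp only [Submodule.coe_add, mul_add]))
    (fun c v r => Subtype.ext (by simp only [Submodule.coe_smul, mul_smul_comm])))

theorem coe_symPowMul_tmul {C : Type*} [AddCommGroup C] [Module B C] {n : ℕ} (hn : 2 ≤ n)
    (φ : C →ₗ[B] SymmetricAlgebra B M) (hφ : ∀ v, φ v ∈ SymPow B M 2) (v : C)
    (r : SymPow B M (n - 2)) :
    (symPowMul hn φ hφ (v ⊗ₜ r) : SymmetricAlgebra B M) = φ v * r := rfl

end Minors

section Koszul

variable {B M A A' : Type*} [CommRing B] [AddCommGroup M] [Module B M] [AddCommGroup A]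
  [Module B A] [AddCommGroup A'] [Module B A']

/-- The map `(a, b) ↦ (l, r) ↦ a ⊗ μ(b, l) r - b ⊗ μ(a, l) r`. -/
noncomputable def koszulForm (μ : M →ₗ[B] M →ₗ[B] A →ₗ[B] A') :
    M →ₗ[B] M →ₗ[B] M →ₗ[B] A →ₗ[B] M ⊗[B] A' :=
  LinearMap.mk₂ B (fun a b => LinearMap.mk₂ B
      (fun l r => a ⊗ₜ μ b l r - b ⊗ₜ μ a l r)
      (fun l l' r => by
        simp only [map_add, LinearMap.add_apply, TensorProduct.tmul_add]; abel)
      (fun c l r => by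
        simp only [map_smul, LinearMap.smul_apply, TensorProduct.tmul_smul, smul_sub])
      (fun l r r' => by
        simp only [map_add, TensorProduct.tmul_add]; abel)
      (fun c l r => by
        simp only [map_smul, TensorProduct.tmul_smul, smul_sub]))
    (fun a a' b => by
      ext1 l; ext1 r
      simp only [LinearMap.mk₂_apply, LinearMap.add_apply, map_add, TensorProduct.tmul_add,
        TensorProduct.add_tmul]
      abel)
    (fun c a b => by
      ext1 l; ext1 r
      simp only [LinearMap.mk₂_apply, LinearMap.smul_apply, map_smul, TensorProduct.tmul_smul,
        ← TensorProduct.smul_tmul', smul_sub])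
    (fun a b b' => by
      ext1 l; ext1 r
      simp only [LinearMap.mk₂_apply, LinearMap.add_apply, map_add, TensorProduct.tmul_add,
        TensorProduct.add_tmul]
      abel)
    (fun c a b => by
      ext1 l; ext1 r
      simp only [LinearMap.mk₂_apply, LinearMap.smul_apply, map_smul, TensorProduct.tmul_smul,
        ← TensorProduct.smul_tmul', smul_sub])

theorem koszulForm_apply (μ : M →ₗ[B] M →ₗ[B] A →ₗ[B] A') (a b l : M) (r : A) :
    koszulForm μ a b l r = a ⊗ₜ μ b l r - b ⊗ₜ μ a l r := rfl

/-- The linear map `l ⊗ (a ∧ b) ⊗ r ↦ a ⊗ μ(b, l) r - b ⊗ μ(a, l) r`. -/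
noncomputable def koszulMap (μ : M →ₗ[B] M →ₗ[B] A →ₗ[B] A') :
    M ⊗[B] (⋀[B]^2 M ⊗[B] A) →ₗ[B] M ⊗[B] A' :=
  TensorProduct.lift
    { toFun := fun l => TensorProduct.lift ((wedgeLift (B := B) (M := M)
        (N := M →ₗ[B] A →ₗ[B] M ⊗[B] A') (koszulForm μ) (fun a => by
          ext1 l; ext1 r
          rw [koszulForm_apply, sub_self]
          rfl)).flip l)
      map_add' := fun l l' => TensorProduct.ext' fun w r => by simp
      map_smul' := fun c l => TensorProduct.ext' fun w r => by simp }

theorem koszulMap_tmul (μ : M →ₗ[B] M →ₗ[B] A →ₗ[B] A') (l a b : M) (r : A) :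
    koszulMap μ (l ⊗ₜ (wedge B a b ⊗ₜ r)) = a ⊗ₜ μ b l r - b ⊗ₜ μ a l r := by
  rw [koszulMap, TensorProduct.lift.tmul]
  change TensorProduct.lift _ (wedge B a b ⊗ₜ[B] r) = _
  rw [TensorProduct.lift.tmul, LinearMap.flip_apply, wedgeLift_wedge, koszulForm_apply]

theorem koszul_hom_eq_zero {N : Type*} [AddCommGroup N] [Module B N]
    {f : M ⊗[B] (⋀[B]^2 M ⊗[B] A) →ₗ[B] N} (h : ∀ l a b r, f (l ⊗ₜ (wedge B a b ⊗ₜ r)) = 0) :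
    f = 0 := by
  refine TensorProduct.ext' fun l z => ?_
  suffices H : f ∘ₗ TensorProduct.mk B _ _ l = 0 from congr($H z)
  refine TensorProduct.ext' fun w r => ?_
  suffices H : (f ∘ₗ TensorProduct.mk B _ _ l) ∘ₗ (TensorProduct.mk B _ _).flip r = 0 from
    congr($H w)
  exact wedge_hom_ext fun a b => h l a b r

end Koszul

section RelationMaps

variable {B P : Type*} [CommRing B] [CommRing P] [Algebra B P]
  (E : ℕ → Submodule B P) [SetLike.GradedMonoid E]

/-- The bilinear map `E_1 × E_1 → E_2` induced by `σ₂`. -/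
noncomputable def sigmaBilin : E 1 →ₗ[B] E 1 →ₗ[B] E 2 :=
  LinearMap.mk₂ B (fun a b => sigmaTwo E (SymPow.mk₂ B a b))
    (fun a a' b => Subtype.ext (by
      simp only [coe_sigmaTwo, Submodule.coe_add, add_mul]))
    (fun c a b => Subtype.ext (by
      simp only [coe_sigmaTwo, Submodule.coe_smul, smul_mul_assoc]))
    (fun a b b' => Subtype.ext (by
      simp only [coe_sigmaTwo, Submodule.coe_add, mul_add]))
    (fun c a b => Subtype.ext (by
      simp only [coe_sigmaTwo, Submodule.coe_smul, mul_smul_comm]))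

theorem sigmaBilin_apply (a b : E 1) :
    sigmaBilin E a b = sigmaTwo E (SymPow.mk₂ B a b) := rfl

theorem sigmaBilin_comm (a b : E 1) : sigmaBilin E a b = sigmaBilin E b a :=
  Subtype.ext (by simp only [sigmaBilin_apply, coe_sigmaTwo, mul_comm])

/-- The bilinear map `E_1 × E_1 → Sym(E_2)` induced by `σ₂`. -/
noncomputable def symEntry : E 1 →ₗ[B] E 1 →ₗ[B] SymmetricAlgebra B (E 2) :=
  (sigmaBilin E).compr₂ (SymmetricAlgebra.ι B (E 2))

theorem symEntry_comm (a b : E 1) : symEntry E a b = symEntry E b a :=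
  congrArg (SymmetricAlgebra.ι B (E 2)) (sigmaBilin_comm E a b)

theorem symEntry_mem (a b : E 1) : symEntry E a b ∈ LinearMap.range (SymmetricAlgebra.ι B (E 2)) :=
  ⟨_, rfl⟩

theorem symEntry_minor_mem (a b c d : E 1) :
    symEntry E a c * symEntry E b d - symEntry E a d * symEntry E b c ∈ SymPow B (E 2) 2 := by
  rw [SymPow, pow_two]
  exact sub_mem (Submodule.mul_mem_mul (symEntry_mem E _ _) (symEntry_mem E _ _))
    (Submodule.mul_mem_mul (symEntry_mem E _ _) (symEntry_mem E _ _))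

section

variable [Module.Free B (E 1)]

/-- The map `Sym²(E_1 ∧ E_1) → Sym(E_2)` underlying `i_n`. -/
noncomputable def minorMap : SymPow B (⋀[B]^2 (E 1)) 2 →ₗ[B] SymmetricAlgebra B (E 2) :=
  minorLift (B := B) (M := E 1) (T := SymmetricAlgebra B (E 2)) (symEntry_comm E)

theorem minorMap_apply (a b c d : E 1) :
    minorMap E (SymPow.mk₂ B (wedge B a b) (wedge B c d)) =
      symEntry E a c * symEntry E b d - symEntry E a d * symEntry E b c :=
  minorLift_apply (B := B) (M := E 1) (T := SymmetricAlgebra B (E 2)) (symEntry_comm E) a b c d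

theorem minorMap_mem (v : SymPow B (⋀[B]^2 (E 1)) 2) : minorMap E v ∈ SymPow B (E 2) 2 :=
  minorLift_mem (B := B) (M := E 1) (T := SymmetricAlgebra B (E 2)) _ (minorMap E)
    (fun a b c d => (minorMap_apply E a b c d).symm ▸ symEntry_minor_mem E a b c d) v

/-- The map `i_n`. -/
noncomputable def evenRelationMap {n : ℕ} (hn : 2 ≤ n) :
    SymPow B (⋀[B]^2 (E 1)) 2 ⊗[B] SymPow B (E 2) (n - 2) →ₗ[B] SymPow B (E 2) n :=
  symPowMul (B := B) (M := E 2) hn (minorMap E) (minorMap_mem E)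

theorem coe_evenRelationMap_tmul {n : ℕ} (hn : 2 ≤ n) (v : SymPow B (⋀[B]^2 (E 1)) 2)
    (r : SymPow B (E 2) (n - 2)) :
    (evenRelationMap E hn (v ⊗ₜ r) : SymmetricAlgebra B (E 2)) = minorMap E v * r :=
  coe_symPowMul_tmul (B := B) (M := E 2) hn (minorMap E) (minorMap_mem E) v r

theorem isEvenRelationMap_evenRelationMap {n : ℕ} (hn : 2 ≤ n) :
    IsEvenRelationMap E n (evenRelationMap E hn) := by
  intro a b c d r
  rw [coe_evenRelationMap_tmul, minorMap_apply]
  rfl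

end

/-- In the commutative ring `P` one has (ac)(bd) = (ad)(bc). -/
theorem evenMap_comp_relation {n : ℕ}
    {i : SymPow B (⋀[B]^2 (E 1)) 2 ⊗[B] SymPow B (E 2) (n - 2) →ₗ[B] SymPow B (E 2) n}
    (hi : IsEvenRelationMap E n i) : evenMap E n ∘ₗ i = 0 := by
  refine symPow_tensor_hom_eq_zero (B := B) (M := E 1) (A := SymPow B (E 2) (n - 2))
    (N := gradedA E (2 * n)) (f := evenMap E n ∘ₗ i) fun a b c d r => Subtype.ext (Subtype.ext ?_)
  change SymmetricAlgebra.lift (E 2).subtype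
    (i (SymPow.mk₂ B (wedge B a b) (wedge B c d) ⊗ₜ[B] r) : SymmetricAlgebra B (E 2)) = 0
  rw [hi]
  simp only [map_mul, map_sub, SymmetricAlgebra.lift_ι_apply, Submodule.subtype_apply,
    coe_sigmaTwo]
  ring

/-- The map `j_n`. -/
noncomputable def oddRelationMap {n : ℕ} (hn : 1 ≤ n) :
    E 1 ⊗[B] (⋀[B]^2 (E 1) ⊗[B] gradedA E (2 * n - 2)) →ₗ[B] E 1 ⊗[B] gradedA E (2 * n) :=
  koszulMap (B := B) (M := E 1) (A := gradedA E (2 * n - 2)) (A' := gradedA E (2 * n))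
    ((sigmaBilin E).compr₂ (mulA E 2 (2 * n - 2) (2 * n) (Or.inr rfl) (by omega)))

theorem isOddRelationMap_oddRelationMap {n : ℕ} (hn : 1 ≤ n) :
    IsOddRelationMap E n hn (oddRelationMap E hn) := by
  intro l a b r
  exact koszulMap_tmul (B := B) (M := E 1) (A := gradedA E (2 * n - 2))
    (A' := gradedA E (2 * n)) _ l a b r

theorem oddMap_comp_relation {n : ℕ} (hn : 1 ≤ n)
    {j : E 1 ⊗[B] (⋀[B]^2 (E 1) ⊗[B] gradedA E (2 * n - 2)) →ₗ[B] E 1 ⊗[B] gradedA E (2 * n)}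
    (hj : IsOddRelationMap E n hn j) : oddMap E n ∘ₗ j = 0 := by
  refine koszul_hom_eq_zero (B := B) (M := E 1) (A := gradedA E (2 * n - 2))
    (N := gradedA E (2 * n + 1)) (f := oddMap E n ∘ₗ j) fun l a b r => Subtype.ext (Subtype.ext ?_)
  change ((oddMap E n (j (l ⊗ₜ[B] (wedge B a b ⊗ₜ[B] r))) : E (2 * n + 1)) : P) = 0
  rw [hj, map_sub]
  change (a : P) * (((sigmaTwo E (SymPow.mk₂ B b l) : E 2) : P) * ((r : E (2 * n - 2)) : P)) -
    b * (((sigmaTwo E (SymPow.mk₂ B a l) : E 2) : P) * ((r : E (2 * n - 2)) : P)) = 0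
  rw [coe_sigmaTwo, coe_sigmaTwo]
  ring

end RelationMaps

theorem ι_mul_mem {B M : Type*} [CommRing B] [AddCommGroup M] [Module B M] {n : ℕ}
    (hn : 1 ≤ n) (e : M) {r : SymmetricAlgebra B M}
    (hr : r ∈ SymPow B M (n - 1)) : SymmetricAlgebra.ι B M e * r ∈ SymPow B M n := by
  have h1 := Submodule.mul_mem_mul (LinearMap.mem_range_self (SymmetricAlgebra.ι B M) e) hr
  rwa [SymPow, ← pow_succ', Nat.sub_add_cancel hn] at h1

/-! ### Exactness of the two sequences. -/

namespace IsPresentation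

variable {B P : Type*} [CommRing B] [CommRing P] [Algebra B P] {E : ℕ → Submodule B P}
  {x : Fin 3 → P} {y : P} {G : MvPolynomial (Option (Fin 3)) B}

theorem free (h : IsPresentation E x y G) : Module.Free B (E 1) := .of_basis h.basis

variable [SetLike.GradedMonoid E]

theorem sigmaTwo_gen (h : IsPresentation E x y G) (a b : Fin 3) :
    sigmaTwo E (SymPow.mk₂ B (h.gen a) (h.gen b)) = h.quad a b :=
  Subtype.ext (coe_sigmaTwo E _ _)

theorem even_mem_range (h : IsPresentation E x y G) {n : ℕ} (hn : 2 ≤ n)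
    {i : SymPow B (⋀[B]^2 (E 1)) 2 ⊗[B] SymPow B (E 2) (n - 2) →ₗ[B] SymPow B (E 2) n}
    (hi : IsEvenRelationMap E n i) {u : SymPow B (E 2) n} (hu : evenMap E n u = 0) :
    u ∈ LinearMap.range i := by
  have h0 : SymmetricAlgebra.lift (E 2).subtype (u : SymmetricAlgebra B (E 2)) = 0 := by
    rw [← coe_evenMap, hu]
    rfl
  have h1 := h.even_kernel hn u.2 h0
  have h2 : (u : SymmetricAlgebra B (E 2)) ∈ (LinearMap.range i).map (SymPow B (E 2) n).subtype := by
    refine Submodule.span_le.2 ?_ h1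
    rintro _ ⟨a, b, c, d, r, hr, rfl⟩
    refine ⟨_, ⟨SymPow.mk₂ B (wedge B (h.gen a) (h.gen b)) (wedge B (h.gen c) (h.gen d)) ⊗ₜ
      ⟨r, hr⟩, rfl⟩, ?_⟩
    rw [Submodule.subtype_apply, hi, h.sigmaTwo_gen, h.sigmaTwo_gen, h.sigmaTwo_gen,
      h.sigmaTwo_gen]
  obtain ⟨v, hv, hvu⟩ := h2
  rwa [← Subtype.ext hvu]

theorem exact_even (h : IsPresentation E x y G) {n : ℕ} (hn : 2 ≤ n)
    {i : SymPow B (⋀[B]^2 (E 1)) 2 ⊗[B] SymPow B (E 2) (n - 2) →ₗ[B] SymPow B (E 2) n}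
    (hi : IsEvenRelationMap E n i) : Function.Exact i (evenMap E n) := by
  intro u
  refine ⟨fun hu => h.even_mem_range hn hi hu, ?_⟩
  rintro ⟨z, rfl⟩
  exact congr($(evenMap_comp_relation E hi) z)

theorem exists_sum_tmul (h : IsPresentation E x y G) (n : ℕ) (w : E 1 ⊗[B] gradedA E (2 * n)) :
    ∃ α : Fin 3 → gradedA E (2 * n), w = ∑ a, h.gen a ⊗ₜ α a := by
  induction w using TensorProduct.induction_on with
  | zero => exact ⟨0, by simp⟩
  | tmul e r =>
    refine ⟨fun a => h.basis.repr e a • r, ?_⟩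
    conv_lhs => rw [← h.basis.sum_repr e, TensorProduct.sum_tmul]
    refine Finset.sum_congr rfl fun a _ => ?_
    rw [h.basis_apply, TensorProduct.smul_tmul]
  | add w w' hw hw' =>
    obtain ⟨α, rfl⟩ := hw
    obtain ⟨α', rfl⟩ := hw'
    exact ⟨α + α', by simp only [Pi.add_apply, TensorProduct.tmul_add, Finset.sum_add_distrib]⟩

/-- The map `(u_a) ↦ ∑ x_a ⊗ u_a`. -/
noncomputable def sumTmul (h : IsPresentation E x y G) (n : ℕ) :
    (Fin 3 → SymPow B (E 2) n) →ₗ[B] E 1 ⊗[B] gradedA E (2 * n) :=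
  LinearMap.lsum B (fun _ => SymPow B (E 2) n) B
    fun a => TensorProduct.mk B (E 1) (gradedA E (2 * n)) (h.gen a) ∘ₗ evenMap E n

theorem sumTmul_apply (h : IsPresentation E x y G) (n : ℕ) (u : Fin 3 → SymPow B (E 2) n) :
    h.sumTmul n u = ∑ a, h.gen a ⊗ₜ evenMap E n (u a) := by
  rw [sumTmul, LinearMap.lsum_apply, LinearMap.sum_apply]
  rfl

theorem sumTmul_single (h : IsPresentation E x y G) (n : ℕ) (a : Fin 3) (u : SymPow B (E 2) n) :
    h.sumTmul n (Pi.single a u) = h.gen a ⊗ₜ evenMap E n u := by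
  rw [sumTmul, LinearMap.lsum_piSingle]
  rfl

/-- Write w = ∑ x_a ⊗ α_a and lift each α_a to u_a in Sym^n(E_2). By `odd_kernel` the vector of the
u_a is a combination of Koszul-type relations, whose images in E_1 ⊗ A_{2n} are values of `j`. -/
theorem odd_mem_range (h : IsPresentation E x y G) {n : ℕ} (hn : 1 ≤ n)
    {j : E 1 ⊗[B] (⋀[B]^2 (E 1) ⊗[B] gradedA E (2 * n - 2)) →ₗ[B] E 1 ⊗[B] gradedA E (2 * n)}
    (hj : IsOddRelationMap E n hn j) {w : E 1 ⊗[B] gradedA E (2 * n)} (hw : oddMap E n w = 0) :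
    w ∈ LinearMap.range j := by
  obtain ⟨α, rfl⟩ := h.exists_sum_tmul n w
  choose u hu using fun a => evenMap_surjective E n (α a)
  have h0 : ∑ a, x a * SymmetricAlgebra.lift (E 2).subtype (u a : SymmetricAlgebra B (E 2)) = 0 := by
    have h1 := congrArg (fun z : gradedA E (2 * n + 1) => ((z : E (2 * n + 1)) : P)) hw
    simp only [map_sum, Submodule.coe_sum, coe_oddMap_tmul, Submodule.coe_zero] at h1
    rw [← h1]
    refine Finset.sum_congr rfl fun a _ => ?_
    rw [← hu a]
    rfl
  have h1 := h.odd_kernel hn (fun a => (u a).2) h0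
  let incl : (Fin 3 → SymPow B (E 2) n) →ₗ[B] (Fin 3 → SymmetricAlgebra B (E 2)) :=
    LinearMap.pi fun a => (SymPow B (E 2) n).subtype ∘ₗ LinearMap.proj a
  have hincl : Function.Injective incl := fun v v' hv =>
    funext fun a => Subtype.ext (congrFun hv a)
  have hsingle : ∀ a (v : SymPow B (E 2) n), incl (Pi.single a v) =
      Pi.single a (v : SymmetricAlgebra B (E 2)) := fun a v => by
    ext1 b
    change ((Pi.single a v : Fin 3 → SymPow B (E 2) n) b : SymmetricAlgebra B (E 2)) = _
    by_cases hb : b = a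
    · subst hb
      simp
    · simp [Pi.single_eq_of_ne hb]
  have h2 : incl u ∈ ((LinearMap.range j).comap (h.sumTmul n)).map incl := by
    refine Submodule.span_le.2 ?_ h1
    rintro _ ⟨a, b, l, r, hr, rfl⟩
    have hk : 2 * n - 2 = 2 * (n - 1) := by omega
    refine ⟨Pi.single a ⟨_, ι_mul_mem hn (h.quad b l) hr⟩ -
      Pi.single b ⟨_, ι_mul_mem hn (h.quad a l) hr⟩, ?_, ?_⟩
    · have hr' : (symMult E 2 (n - 1) (2 * n - 2) (by omega) ⟨r, hr⟩) ∈ gradedA E (2 * n - 2) :=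
        symMult_mem_gradedA E _ _ _ _
      refine ⟨h.gen l ⊗ₜ (wedge B (h.gen a) (h.gen b) ⊗ₜ ⟨_, hr'⟩), ?_⟩
      rw [hj, map_sub, h.sumTmul_single, h.sumTmul_single, h.sigmaTwo_gen, h.sigmaTwo_gen]
      have key : ∀ e : E 2, mulA E 2 (2 * n - 2) (2 * n) (Or.inr rfl) (by omega) e ⟨_, hr'⟩ =
          evenMap E n ⟨_, ι_mul_mem hn e hr⟩ := fun e => Subtype.ext (Subtype.ext (by
        change (e : P) * SymmetricAlgebra.lift (E 2).subtype r =
          SymmetricAlgebra.lift (E 2).subtype (SymmetricAlgebra.ι B (E 2) e * r)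
        rw [map_mul, SymmetricAlgebra.lift_ι_apply]
        rfl))
      rw [key, key]
    · rw [map_sub, hsingle, hsingle]
  obtain ⟨v, hv, hvu⟩ := h2
  rw [hincl hvu] at hv
  have h3 : h.sumTmul n u ∈ LinearMap.range j := hv
  rw [sumTmul_apply] at h3
  simpa only [hu] using h3

theorem exact_odd (h : IsPresentation E x y G) {n : ℕ} (hn : 1 ≤ n)
    {j : E 1 ⊗[B] (⋀[B]^2 (E 1) ⊗[B] gradedA E (2 * n - 2)) →ₗ[B] E 1 ⊗[B] gradedA E (2 * n)}
    (hj : IsOddRelationMap E n hn j) : Function.Exact j (oddMap E n) := by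
  intro w
  refine ⟨fun hw => h.odd_mem_range hn hj hw, ?_⟩
  rintro ⟨z, rfl⟩
  exact congr($(oddMap_comp_relation E hn hj) z)

end IsPresentation

/-! ### Injectivity of i₂. -/

section WeightedPolynomials

open MvPolynomial

variable {σ τ R : Type*} [CommRing R] {w : σ → ℕ} {v : τ → ℕ}

theorem weightedHomogeneousComponent_mul_left {g : MvPolynomial σ R} {m n : ℕ}
    (hg : g.IsWeightedHomogeneous w m) (hmn : m ≤ n) (q : MvPolynomial σ R) :
    weightedHomogeneousComponent w n (g * q) = g * weightedHomogeneousComponent w (n - m) q := by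
  let _ := weightedGradedAlgebra R w
  have h := DirectSum.coe_decompose_mul_of_left_mem_of_le (weightedHomogeneousSubmodule R w)
    (b := q) ((mem_weightedHomogeneousSubmodule R w m g).2 hg) hmn
  have key : ∀ p k, (DirectSum.decompose (weightedHomogeneousSubmodule R w) p k : MvPolynomial σ R) =
    weightedHomogeneousComponent w k p := fun p k => weightedDecomposition.decompose'_apply R w p k
  rwa [key, key] at h

/-- Any cofactor may be replaced by its component of weight `n - m`. -/
theorem exists_eq_mul_of_dvd {g p : MvPolynomial σ R} {m n : ℕ}
    (hg : g.IsWeightedHomogeneous w m) (hp : p.IsWeightedHomogeneous w n) (hmn : m ≤ n)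
    (h : g ∣ p) : ∃ q, q.IsWeightedHomogeneous w (n - m) ∧ p = g * q := by
  obtain ⟨q, rfl⟩ := h
  refine ⟨_, weightedHomogeneousComponent_isWeightedHomogeneous (n - m) q, ?_⟩
  rw [← weightedHomogeneousComponent_mul_left hg hmn, hp.weightedHomogeneousComponent_same]

theorem isWeightedHomogeneous_aeval {A : Type*} [CommRing A] [Algebra R A] (c : ℕ)
    {f : σ → MvPolynomial τ A}
    (hf : ∀ i, (f i).IsWeightedHomogeneous v (c * w i)) {p : MvPolynomial σ R} {n : ℕ}
    (hp : p.IsWeightedHomogeneous w n) : (aeval f p).IsWeightedHomogeneous v (c * n) := by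
  rw [p.as_sum, map_sum]
  refine IsWeightedHomogeneous.sum _ _ _ fun d hd => ?_
  have h1 := hp (mem_support_iff.1 hd)
  rw [aeval_monomial, IsScalarTower.algebraMap_apply R A, algebraMap_eq]
  refine IsWeightedHomogeneous.C_mul ?_ _
  have h2 := IsWeightedHomogeneous.prod d.support (fun i => f i ^ d i) (fun i => d i • (c * w i))
    (fun i _ => (hf i).pow (d i))
  have h3 : ∑ i ∈ d.support, d i • (c * w i) = c * n := by
    rw [← h1, Finsupp.weight_apply, Finsupp.sum, Finset.mul_sum]
    refine Finset.sum_congr rfl fun i _ => ?_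
    simp only [smul_eq_mul]
    ring
  rwa [h3] at h2

end WeightedPolynomials

section QuadraticMonomials

open MvPolynomial

/-- The exponents of the monomials of degree two in the `x_a` (indexed by pairs) and `y`. -/
noncomputable def quadExp : Option (Sym2 (Fin 3)) → Option (Fin 3) →₀ ℕ
  | none => Finsupp.single none 1
  | some z => Sym2.lift ⟨fun a b => Finsupp.single (some a) 1 + Finsupp.single (some b) 1,
      fun _ _ => add_comm _ _⟩ z

theorem quadExp_some (a b : Fin 3) :
    quadExp (some s(a, b)) = Finsupp.single (some a) 1 + Finsupp.single (some b) 1 := rfl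

theorem quadExp_injective : Function.Injective quadExp := by
  have h1 : ∀ z, quadExp (some z) none = 0 := fun z => by
    induction z using Sym2.ind with
    | _ a b => simp [quadExp_some]
  have h2 : quadExp none none = 1 := by simp [quadExp]
  rintro (_ | z) (_ | z') h
  · rfl
  · rw [h, h1] at h2
    exact absurd h2 zero_ne_one
  · rw [← h, h1] at h2
    exact absurd h2 zero_ne_one
  · induction z using Sym2.ind with
    | _ a b =>
      induction z' using Sym2.ind with
      | _ a' b' =>
        rw [quadExp_some, quadExp_some,
          Finsupp.single_add_single_eq_single_add_single one_ne_zero one_ne_zero] at h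
        rcases h with ⟨h1, h2⟩ | ⟨-, h1, h2⟩ | ⟨h, -⟩
        · rw [Option.some.inj h1, Option.some.inj h2]
        · rw [Option.some.inj h1, Option.some.inj h2, Sym2.eq_swap]
        · exact absurd h (by decide)

theorem weight_quadExp (j : Option (Sym2 (Fin 3))) : Finsupp.weight varWeight (quadExp j) = 2 := by
  cases j with
  | none => rw [quadExp, Finsupp.weight_single]; rfl
  | some z =>
    induction z using Sym2.ind with
    | _ a b =>
      rw [quadExp_some, map_add, Finsupp.weight_single, Finsupp.weight_single]; rfl

variable {B : Type*} [CommRing B]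

variable (B) in
/-- The substitution of the monomials of degree two. -/
noncomputable def quadSubst : MvPolynomial (Option (Sym2 (Fin 3))) B →ₐ[B]
    MvPolynomial (Option (Fin 3)) B :=
  aeval fun j => monomial (quadExp j) 1

theorem quadSubst_X (j : Option (Sym2 (Fin 3))) :
    quadSubst B (X j) = monomial (quadExp j) 1 := aeval_X _ _

theorem quadSubst_X_some (a b : Fin 3) :
    quadSubst B (X (some s(a, b))) = X (some a) * X (some b) := by
  rw [quadSubst_X, quadExp_some, X, X, monomial_mul, one_mul]

variable (B) in
/-- The linear forms. -/
noncomputable def linForm : (Option (Sym2 (Fin 3)) →₀ B) →ₗ[B]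
    MvPolynomial (Option (Sym2 (Fin 3))) B := Finsupp.linearCombination B X

theorem linForm_single (j : Option (Sym2 (Fin 3))) (b : B) :
    linForm B (Finsupp.single j b) = b • X j := Finsupp.linearCombination_single _ _ _

theorem quadSubst_linForm (l : Option (Sym2 (Fin 3)) →₀ B) :
    quadSubst B (linForm B l) = Finsupp.linearCombination B (fun j => monomial (quadExp j) 1) l := by
  rw [linForm, ← AlgHom.toLinearMap_apply, LinearMap.map_finsupp_linearCombination]
  congr 2
  ext1 j
  exact quadSubst_X j

theorem quadSubst_linForm_injective : Function.Injective fun l => quadSubst B (linForm B l) := by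
  have h := (basisMonomials (Option (Fin 3)) B).linearIndependent.comp quadExp quadExp_injective
  rw [coe_basisMonomials] at h
  intro l l' hl
  simp only [quadSubst_linForm] at hl
  exact h hl

theorem linForm_homog (l : Option (Sym2 (Fin 3)) →₀ B) : (linForm B l).IsHomogeneous 1 := by
  rw [← mem_homogeneousSubmodule]
  have h := Finsupp.range_linearCombination B
    (v := (X : Option (Sym2 (Fin 3)) → MvPolynomial (Option (Sym2 (Fin 3))) B))
  rw [homogeneousSubmodule_one_eq_span_X, ← h]
  exact ⟨l, rfl⟩

theorem exists_linForm_eq {p : MvPolynomial (Option (Sym2 (Fin 3))) B} (hp : p.IsHomogeneous 1) :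
    ∃ l, linForm B l = p := by
  rw [← mem_homogeneousSubmodule, homogeneousSubmodule_one_eq_span_X,
    ← Finsupp.range_linearCombination] at hp
  exact hp

theorem exists_quadSubst_linForm_eq {p : MvPolynomial (Option (Fin 3)) B}
    (hp : p.IsWeightedHomogeneous varWeight 2) : ∃ l, quadSubst B (linForm B l) = p := by
  have h : Submodule.span B (insert (X none)
      (Set.range fun ab : Fin 3 × Fin 3 => X (some ab.1) * X (some ab.2))) ≤
      LinearMap.range ((quadSubst B).toLinearMap ∘ₗ linForm B) := by
    refine Submodule.span_le.2 ?_
    rintro _ (rfl | ⟨⟨a, b⟩, rfl⟩)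
    · refine ⟨Finsupp.single none 1, ?_⟩
      rw [LinearMap.comp_apply, linForm_single, one_smul]
      exact quadSubst_X none
    · refine ⟨Finsupp.single (some s(a, b)) 1, ?_⟩
      rw [LinearMap.comp_apply, linForm_single, one_smul]
      exact quadSubst_X_some a b
  exact h (mem_span_of_isWeightedHomogeneous_two hp)

variable (B) in
/-- The minors of the generic symmetric matrix. -/
noncomputable def genericMinor (a b c d : Fin 3) : MvPolynomial (Option (Sym2 (Fin 3))) B :=
  X (some s(a, c)) * X (some s(b, d)) - X (some s(a, d)) * X (some s(b, c))

theorem genericMinor_homog (a b c d : Fin 3) : (genericMinor B a b c d).IsHomogeneous 2 :=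
  ((isHomogeneous_X _ _).mul (isHomogeneous_X _ _)).sub
    ((isHomogeneous_X _ _).mul (isHomogeneous_X _ _))

theorem quadSubst_genericMinor (a b c d : Fin 3) : quadSubst B (genericMinor B a b c d) = 0 := by
  simp only [genericMinor, map_sub, map_mul, quadSubst_X_some]
  ring

/-- The indices of a basis of the space of minors. -/
def minorIndex : Fin 6 → Fin 3 × Fin 3 × Fin 3 × Fin 3 :=
  ![(0, 1, 0, 1), (0, 2, 0, 2), (1, 2, 1, 2), (0, 1, 0, 2), (0, 1, 1, 2), (0, 2, 1, 2)]

variable (B) in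
/-- A linear combination of the minors. -/
noncomputable def minorComb (c : Fin 6 → B) : MvPolynomial (Option (Sym2 (Fin 3))) B :=
  ∑ i, c i • genericMinor B (minorIndex i).1 (minorIndex i).2.1 (minorIndex i).2.2.1
    (minorIndex i).2.2.2

/-- Evaluate at points with at most two nonzero coordinates. A single off-diagonal entry isolates
each principal minor; then a diagonal entry together with the opposite off-diagonal one isolates
each of the other three. -/
theorem eq_zero_of_minorComb_eq_zero {c : Fin 6 → B} (hc : minorComb B c = 0) : c = 0 := by
  have key : ∀ z z' : Sym2 (Fin 3), eval (fun j : Option (Sym2 (Fin 3)) =>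
      if j = some z ∨ j = some z' then (1 : B) else 0) (minorComb B c) = 0 := fun z z' => by
    rw [hc, map_zero]
  simp only [minorComb, Fin.sum_univ_six, minorIndex, genericMinor, map_add, map_sub, map_mul,
    smul_eval, eval_X] at key
  have h1 := key s(0, 1) s(0, 1)
  have h2 := key s(0, 2) s(0, 2)
  have h3 := key s(1, 2) s(1, 2)
  have h4 := key s(0, 0) s(1, 2)
  have h5 := key s(1, 1) s(0, 2)
  have h6 := key s(2, 2) s(0, 1)
  simp at h1 h2 h3 h4 h5 h6
  ext i
  fin_cases i <;> simp_all

/-- Minors vanish when the quadratic monomials are substituted. If a combination of them is a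
product of two linear forms, one factor vanishes under the substitution, since polynomials over `B`
form a domain; that factor is zero because distinct monomials are independent. -/
theorem minorComb_eq_zero_of_mem [IsDomain B] {c : Fin 6 → B} {g : Option (Sym2 (Fin 3)) →₀ B}
    (h : linForm B g ∣ minorComb B c) : minorComb B c = 0 := by
  have hhom : (minorComb B c).IsHomogeneous 2 := by
    refine IsHomogeneous.sum _ _ _ fun i _ => ?_
    rw [smul_eq_C_mul]
    exact (genericMinor_homog _ _ _ _).C_mul _
  obtain ⟨l, hl, h1⟩ := exists_eq_mul_of_dvd (linForm_homog g) hhom one_le_two h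
  obtain ⟨l, rfl⟩ := exists_linForm_eq (p := l) hl
  have h2 : quadSubst B (minorComb B c) = 0 := by
    rw [minorComb, map_sum]
    exact Finset.sum_eq_zero fun i _ => by rw [map_smul, quadSubst_genericMinor, smul_zero]
  rw [h1, map_mul, mul_eq_zero] at h2
  have key : ∀ l : Option (Sym2 (Fin 3)) →₀ B, quadSubst B (linForm B l) = 0 → linForm B l = 0 := by
    intro l hl
    rw [quadSubst_linForm_injective (a₁ := l) (a₂ := 0) (by simpa using hl), map_zero]
  rw [h1]
  rcases h2 with h2 | h2
  · rw [key _ h2, zero_mul]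
  · rw [key _ h2, mul_zero]

end QuadraticMonomials

theorem mk₂_comm {B M : Type*} [CommRing B] [AddCommGroup M] [Module B M] (a b : M) :
    SymPow.mk₂ B a b = SymPow.mk₂ B b a := Subtype.ext (mul_comm _ _)

theorem exists_sum_smul_mk₂_wedge {B M : Type*} [CommRing B] [AddCommGroup M] [Module B M]
    {x : Fin 3 → M} (hx : Submodule.span B (Set.range x) = ⊤) (v : SymPow B (⋀[B]^2 M) 2) :
    ∃ c : Fin 6 → B, ∑ i, c i • SymPow.mk₂ B
      (wedge B (x (minorIndex i).1) (x (minorIndex i).2.1))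
      (wedge B (x (minorIndex i).2.2.1) (x (minorIndex i).2.2.2)) = v := by
  rw [← Submodule.mem_span_range_iff_exists_fun]
  generalize hW : Submodule.span B (Set.range fun i => SymPow.mk₂ B
      (wedge B (x (minorIndex i).1) (x (minorIndex i).2.1))
      (wedge B (x (minorIndex i).2.2.1) (x (minorIndex i).2.2.2))) = W
  have hm : ∀ i, SymPow.mk₂ B
      (wedge B (x (minorIndex i).1) (x (minorIndex i).2.1))
      (wedge B (x (minorIndex i).2.2.1) (x (minorIndex i).2.2.2)) ∈ W :=
    fun i => hW ▸ Submodule.subset_span ⟨i, rfl⟩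
  suffices H : (⊤ : Submodule B (SymPow B (⋀[B]^2 M) 2)) ≤ W from H trivial
  rw [← span_mk₂_of_span (span_wedge_of_span hx), Submodule.span_le]
  rintro _ ⟨_, rfl | rfl | rfl, _, rfl | rfl | rfl, rfl⟩
  · exact hm 0
  · exact hm 3
  · exact hm 4
  · rw [mk₂_comm]
    exact hm 3
  · exact hm 1
  · exact hm 5
  · rw [mk₂_comm]
    exact hm 4
  · rw [mk₂_comm]
    exact hm 5
  · exact hm 2

theorem injective_of_minors {B M A : Type*} [CommRing B] [AddCommGroup M] [Module B M]
    [AddCommGroup A] [Module B A] {x : Fin 3 → M} (hx : Submodule.span B (Set.range x) = ⊤)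
    (φ : SymPow B (⋀[B]^2 M) 2 →ₗ[B] A)
    (h : ∀ c : Fin 6 → B, ∑ i, c i • φ (SymPow.mk₂ B
      (wedge B (x (minorIndex i).1) (x (minorIndex i).2.1))
      (wedge B (x (minorIndex i).2.2.1) (x (minorIndex i).2.2.2))) = 0 → c = 0) :
    Function.Injective φ := by
  rw [injective_iff_map_eq_zero]
  intro v hv
  obtain ⟨c, rfl⟩ := exists_sum_smul_mk₂_wedge hx v
  rw [map_sum] at hv
  simp only [map_smul] at hv
  rw [h c hv]
  exact Finset.sum_eq_zero fun i _ => zero_smul _ _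

theorem exists_comp_eq_of_surjective {B L M N : Type*} [CommRing B] [AddCommGroup L] [Module B L]
    [AddCommGroup M] [Module B M] [AddCommGroup N] [Module B N] {p : L →ₗ[B] M}
    (hp : Function.Surjective p) (T : L →ₗ[B] N) (h : ∀ l, p l = 0 → T l = 0) :
    ∃ θ : M →ₗ[B] N, ∀ l, θ (p l) = T l := by
  refine ⟨(LinearMap.ker p).liftQ T h ∘ₗ (p.quotKerEquivOfSurjective hp).symm.toLinearMap,
    fun l => ?_⟩
  have h1 : (p.quotKerEquivOfSurjective hp).symm (p l) = Submodule.Quotient.mk l := by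
    rw [LinearEquiv.symm_apply_eq]
    rfl
  rw [LinearMap.comp_apply, LinearEquiv.coe_coe, h1]
  rfl

/-- The second tensor factor is the symmetric power of exponent zero, that is, the multiples of 1,
so every tensor is of the form v ⊗ 1. -/
theorem injective_symPowMul {B M C : Type*} [CommRing B] [AddCommGroup M] [Module B M]
    [AddCommGroup C] [Module B C] (φ : C →ₗ[B] SymmetricAlgebra B M)
    (hφ : ∀ v, φ v ∈ SymPow B M 2) (h : Function.Injective φ) :
    Function.Injective (symPowMul le_rfl φ hφ) := by
  have h1 : (1 : SymmetricAlgebra B M) ∈ SymPow B M (2 - 2) := by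
    rw [SymPow, Nat.sub_self, pow_zero]
    exact Submodule.one_le.1 le_rfl
  have h2 : ∀ z : C ⊗[B] SymPow B M (2 - 2), ∃ v, z = v ⊗ₜ ⟨1, h1⟩ := by
    intro z
    induction z using TensorProduct.induction_on with
    | zero => exact ⟨0, by rw [TensorProduct.zero_tmul]⟩
    | tmul v r =>
      obtain ⟨r, hr⟩ := r
      have hr' := hr
      rw [SymPow, Nat.sub_self, pow_zero, Submodule.mem_one] at hr'
      obtain ⟨c, rfl⟩ := hr'
      refine ⟨c • v, ?_⟩
      rw [TensorProduct.smul_tmul]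
      congr 1
      exact Subtype.ext (Algebra.algebraMap_eq_smul_one c)
    | add z z' hz hz' =>
      obtain ⟨v, rfl⟩ := hz
      obtain ⟨v', rfl⟩ := hz'
      exact ⟨v + v', by rw [TensorProduct.add_tmul]⟩
  rw [injective_iff_map_eq_zero]
  intro z hz
  obtain ⟨v, rfl⟩ := h2 z
  have h3 : φ v * 1 = 0 := congrArg Subtype.val hz
  rw [mul_one] at h3
  rw [(injective_iff_map_eq_zero φ).1 h v h3, TensorProduct.zero_tmul]

namespace IsPresentation

open MvPolynomial

variable {B P : Type*} [CommRing B] [CommRing P] [Algebra B P] {E : ℕ → Submodule B P}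
  {x : Fin 3 → P} {y : P} {G : MvPolynomial (Option (Fin 3)) B}

/-- The generators of `E_2`. -/
def quadPoint (h : IsPresentation E x y G) : Option (Sym2 (Fin 3)) → E 2
  | none => h.genY
  | some z => Sym2.lift ⟨h.quad, h.quad_comm⟩ z

theorem aeval_quadExp (h : IsPresentation E x y G) (j : Option (Sym2 (Fin 3))) :
    aeval (varPoint x y) (monomial (quadExp j) (1 : B)) = (h.quadPoint j : P) := by
  cases j with
  | none => exact aeval_X _ _
  | some z =>
    induction z using Sym2.ind with
    | _ a b =>
      rw [← quadSubst_X, quadSubst_X_some, map_mul, aeval_X, aeval_X]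
      rfl

theorem aeval_quadSubst (h : IsPresentation E x y G) (l : Option (Sym2 (Fin 3)) →₀ B) :
    aeval (varPoint x y) (quadSubst B (linForm B l)) =
      (Finsupp.linearCombination B h.quadPoint l : P) := by
  rw [quadSubst_linForm, ← AlgHom.toLinearMap_apply, LinearMap.map_finsupp_linearCombination,
    ← Submodule.subtype_apply, LinearMap.map_finsupp_linearCombination]
  congr 2
  ext1 j
  exact h.aeval_quadExp j

theorem linearCombination_quadPoint_surjective (h : IsPresentation E x y G) :
    Function.Surjective (Finsupp.linearCombination B h.quadPoint) := by
  rintro ⟨e, he⟩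
  have he' := he
  rw [h.two_eq] at he'
  have h1 : Submodule.span B (insert y (Set.range fun ab : Fin 3 × Fin 3 => x ab.1 * x ab.2)) ≤
      LinearMap.range ((E 2).subtype ∘ₗ Finsupp.linearCombination B h.quadPoint) := by
    refine Submodule.span_le.2 ?_
    rintro _ (rfl | ⟨⟨a, b⟩, rfl⟩)
    · exact ⟨Finsupp.single none 1, by simp [quadPoint, genY]⟩
    · exact ⟨Finsupp.single (some s(a, b)) 1, by simp [quadPoint, quad]⟩
  obtain ⟨l, hl⟩ := h1 he'
  exact ⟨l, Subtype.ext hl⟩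

/-- The quadratic form `G` is a linear form in the seven generators of E_2. A linear relation
between these is a multiple of `G` with cofactor of weight zero, that is, a constant. -/
theorem exists_forall_dvd_linForm (h : IsPresentation E x y G) :
    ∃ g, ∀ l, Finsupp.linearCombination B h.quadPoint l = 0 → linForm B g ∣ linForm B l := by
  obtain ⟨g, hg⟩ := exists_quadSubst_linForm_eq h.homog
  refine ⟨g, fun l hl => ?_⟩
  have h1 := h.aeval_quadSubst l
  rw [hl, Submodule.coe_zero] at h1
  have h2 : (quadSubst B (linForm B l)).IsWeightedHomogeneous varWeight 2 := by
    rw [quadSubst_linForm]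
    have h3 : Finsupp.linearCombination B (fun j => monomial (quadExp j) (1 : B)) l ∈
        Submodule.span B (Set.range fun j => monomial (quadExp j) (1 : B)) := by
      rw [← Finsupp.range_linearCombination]
      exact LinearMap.mem_range_self _ l
    refine (Submodule.span_le (p := weightedHomogeneousSubmodule B varWeight 2)).2 ?_ h3
    rintro _ ⟨j, rfl⟩
    exact isWeightedHomogeneous_monomial _ _ _ (weight_quadExp j)
  obtain ⟨q, hq, hlq⟩ := exists_eq_mul_of_dvd h.homog h2 le_rfl (h.dvd 2 _ h2 h1)
  obtain ⟨c, rfl⟩ : ∃ c, q = C c := by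
    refine ⟨coeff 0 q, ?_⟩
    ext d
    rw [coeff_C]
    split_ifs with hd
    · rw [hd]
    · exact hq.coeff_eq_zero _ fun h0 => hd (eq_zero_of_weight_eq_zero h0).symm
  have h3 : l = c • g := quadSubst_linForm_injective (by
    simp only [map_smul]
    rw [hlq, hg, smul_eq_C_mul, mul_comm])
  rw [h3, map_smul, smul_eq_C_mul]
  exact dvd_mul_left _ _

/-- The relations between the seven generators being multiples of `g`, E_2 maps to the polynomial
ring in seven variables modulo `linForm B g`, and this extends to Sym(E_2). Minors go to generic
minors, so a vanishing combination is divisible by `linForm B g`, and `minorComb_eq_zero_of_mem`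
applies. -/
theorem minorMap_injective [IsDomain B] [SetLike.GradedMonoid E] [Module.Free B (E 1)]
    (h : IsPresentation E x y G) : Function.Injective (minorMap E) := by
  refine injective_of_minors (B := B) (M := E 1) h.span_gen (minorMap E) fun c hv => ?_
  simp only [minorMap_apply] at hv
  obtain ⟨g, hg⟩ := h.exists_forall_dvd_linForm
  let π := Ideal.Quotient.mkₐ B (Ideal.span {linForm B g})
  obtain ⟨θ, hθ⟩ := exists_comp_eq_of_surjective h.linearCombination_quadPoint_surjective
    (π.toLinearMap ∘ₗ linForm B) fun l hl =>
      Ideal.Quotient.eq_zero_iff_mem.2 (Ideal.mem_span_singleton.2 (hg l hl))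
  have hZ : ∀ a b, SymmetricAlgebra.lift θ (symEntry E (h.gen a) (h.gen b)) =
      π (X (some s(a, b))) := by
    intro a b
    have h1 : sigmaBilin E (h.gen a) (h.gen b) =
        Finsupp.linearCombination B h.quadPoint (Finsupp.single (some s(a, b)) 1) := by
      rw [Finsupp.linearCombination_single, one_smul]
      exact h.sigmaTwo_gen a b
    rw [symEntry, LinearMap.compr₂_apply, SymmetricAlgebra.lift_ι_apply, h1, hθ,
      LinearMap.comp_apply, linForm_single, one_smul]
    rfl
  have h2 : π (minorComb B c) = 0 := by
    rw [← map_zero (SymmetricAlgebra.lift θ), ← hv, map_sum, minorComb, map_sum]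
    refine Finset.sum_congr rfl fun i _ => ?_
    rw [map_smul, map_smul, genericMinor]
    simp only [map_sub, map_mul, hZ]
  have h3 : linForm B g ∣ minorComb B c :=
    Ideal.mem_span_singleton.1 (Ideal.Quotient.eq_zero_iff_mem.1 h2)
  exact eq_zero_of_minorComb_eq_zero (minorComb_eq_zero_of_mem h3)

theorem evenRelationMap_injective [IsDomain B] [SetLike.GradedMonoid E] [Module.Free B (E 1)]
    (h : IsPresentation E x y G) : Function.Injective (evenRelationMap E le_rfl) :=
  injective_symPowMul (B := B) (M := E 2) (minorMap E) (minorMap_mem E) h.minorMap_injective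

/-- The exact sequences for the algebra with the given presentation. -/
theorem exact_sequences [IsDomain B] [SetLike.GradedMonoid E] (h : IsPresentation E x y G) :
    (∀ n : ℕ, 2 ≤ n →
      ∃ i : SymPow B (⋀[B]^2 (E 1)) 2 ⊗[B] SymPow B (E 2) (n - 2) →ₗ[B] SymPow B (E 2) n,
        IsEvenRelationMap E n i ∧ Function.Exact i (evenMap E n) ∧
        Function.Surjective (evenMap E n) ∧ (n = 2 → Function.Injective i)) ∧
    (∀ (n : ℕ) (hn : 1 ≤ n),
      ∃ j : E 1 ⊗[B] (⋀[B]^2 (E 1) ⊗[B] gradedA E (2 * n - 2)) →ₗ[B] E 1 ⊗[B] gradedA E (2 * n),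
        IsOddRelationMap E n hn j ∧ Function.Exact j (oddMap E n) ∧
        Function.Surjective (oddMap E n)) := by
  have := h.free
  refine ⟨fun n hn => ⟨evenRelationMap E hn, isEvenRelationMap_evenRelationMap E hn,
    h.exact_even hn (isEvenRelationMap_evenRelationMap E hn), evenMap_surjective E n, ?_⟩,
    fun n hn => ⟨oddRelationMap E hn, isOddRelationMap_oddRelationMap E hn,
      h.exact_odd hn (isOddRelationMap_oddRelationMap E hn), oddMap_surjective E n⟩⟩
  rintro rfl
  exact h.evenRelationMap_injective

end IsPresentation

/-! ### Passing to a generization. -/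

section Transfer

open MvPolynomial

theorem isWeightedHomogeneous_map {σ B B' : Type*} [CommRing B] [CommRing B'] (f : B →+* B')
    {w : σ → ℕ} {n : ℕ} {p : MvPolynomial σ B} (hp : p.IsWeightedHomogeneous w n) :
    (map f p).IsWeightedHomogeneous w n := by
  intro d hd
  refine hp fun h0 => hd ?_
  rw [coeff_map, h0, map_zero]

theorem weightedHomogeneousComponent_map {σ B B' : Type*} [CommRing B] [CommRing B'] (f : B →+* B')
    (w : σ → ℕ) (n : ℕ) (p : MvPolynomial σ B) :
    weightedHomogeneousComponent w n (map f p) = map f (weightedHomogeneousComponent w n p) := by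
  classical
  ext d
  rw [coeff_weightedHomogeneousComponent, coeff_map, coeff_map, coeff_weightedHomogeneousComponent]
  split_ifs
  · rfl
  · rw [map_zero]

theorem exists_C_mul_eq_map {σ B B' : Type*} [CommRing B] [CommRing B'] [Algebra B B']
    (hB : ∀ c : B', ∃ a b : B, IsUnit (algebraMap B B' b) ∧ c * algebraMap B B' b = algebraMap B B' a)
    (p : MvPolynomial σ B') : ∃ (b : B) (r : MvPolynomial σ B), IsUnit (algebraMap B B' b) ∧
      C (algebraMap B B' b) * p = map (algebraMap B B') r := by
  induction p using MvPolynomial.monomial_add_induction_on with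
  | C c =>
    obtain ⟨a, b, hb, h⟩ := hB c
    exact ⟨b, C a, hb, by rw [map_C, ← h, ← C_mul, mul_comm]⟩
  | monomial_add d c p _ _ hp =>
    obtain ⟨a, b, hb, h⟩ := hB c
    obtain ⟨b', r, hb', hr⟩ := hp
    refine ⟨b * b', monomial d (b' * a) + C b * r, ?_, ?_⟩
    · rw [map_mul]
      exact hb.mul hb'
    · rw [(algebraMap B B').map_mul b b', map_add, map_monomial, (algebraMap B B').map_mul b' a,
        (map (algebraMap B B')).map_mul, map_C, ← h, ← hr, mul_add, C_mul_monomial, C_mul,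
        mul_assoc, mul_left_comm, mul_comm (algebraMap B B' b) c, mul_assoc]

/-- A relation over `B'` comes from one over `B` after multiplication by an element that is a unit
in `B'`, so divisibility by `G` carries over. -/
theorem IsPresentation.of_span {B B' P : Type*} [CommRing B] [CommRing B'] [CommRing P]
    [Algebra B P] [Algebra B' P] [Algebra B B'] [IsScalarTower B B' P]
    {E : ℕ → Submodule B P} {E' : ℕ → Submodule B' P} {x : Fin 3 → P} {y : P}
    {G : MvPolynomial (Option (Fin 3)) B} (h : IsPresentation E x y G)
    (hE : ∀ n, E' n = Submodule.span B' (E n))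
    (hB : ∀ c : B', ∃ a b : B, IsUnit (algebraMap B B' b) ∧
      c * algebraMap B B' b = algebraMap B B' a) :
    IsPresentation E' x y (map (algebraMap B B') G) where
  homog := isWeightedHomogeneous_map _ h.homog
  aeval_eq := by rw [aeval_map_algebraMap, h.aeval_eq]
  one_eq := by rw [hE, h.one_eq, Submodule.span_span_of_tower]
  two_eq := by rw [hE, h.two_eq, Submodule.span_span_of_tower]
  dvd n p hp hp0 := by
    obtain ⟨b, r, hb, hr⟩ := exists_C_mul_eq_map hB p
    -- The map from `B` to `B'` is not assumed injective, so `r` need not be homogeneous; its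
    -- component of weight `n` has the same image.
    have h1 : map (algebraMap B B') (weightedHomogeneousComponent varWeight n r) =
        C (algebraMap B B' b) * p := by
      rw [← weightedHomogeneousComponent_map, ← hr]
      exact (hp.C_mul _).weightedHomogeneousComponent_same
    have h2 : aeval (varPoint x y) (weightedHomogeneousComponent varWeight n r) = 0 := by
      rw [← aeval_map_algebraMap B', h1, map_mul, hp0, mul_zero]
    have h3 := map_dvd (map (algebraMap B B'))
      (h.dvd n _ (weightedHomogeneousComponent_isWeightedHomogeneous n r) h2)
    rw [h1] at h3
    exact (IsUnit.dvd_mul_left (hb.map C)).1 h3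

end Transfer

/-! ### Presentations of the hyperelliptic and unigonal fibres. -/

section Elimination

open MvPolynomial

/-- Elimination of z, the variable `none`: modulo `g` the ideal is generated by z² - h, monic of
degree two in z, and a z-free multiple of it must be zero. -/
theorem dvd_of_rename_some_mem {τ k : Type*} [CommRing k] {g h p : MvPolynomial τ k}
    (hp : rename some p ∈ Ideal.span {(X none ^ 2 - rename some h : MvPolynomial (Option τ) k),
      rename some g}) : g ∣ p := by
  by_cases hg : IsUnit g
  · exact hg.dvd
  let A := MvPolynomial τ k ⧸ Ideal.span {g}
  have : Nontrivial A := Ideal.Quotient.nontrivial_iff.2 fun h0 =>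
    hg (Ideal.span_singleton_eq_top.1 h0)
  let ψ : MvPolynomial (Option τ) k →+* Polynomial A :=
    (Polynomial.mapRingHom (Ideal.Quotient.mk (Ideal.span {g}))).comp
      (optionEquivLeft k τ).toAlgHom.toRingHom
  have hψ : ∀ q : MvPolynomial τ k, ψ (rename some q) =
      Polynomial.C (Ideal.Quotient.mk (Ideal.span {g}) q) := by
    intro q
    have h1 : optionEquivLeft k τ (rename some q) = Polynomial.C q := by
      induction q using MvPolynomial.induction_on with
      | C a => simp [optionEquivLeft_C]
      | add p q hp hq => simp only [map_add, hp, hq]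
      | mul_X p i hp => simp only [map_mul, hp, rename_X, optionEquivLeft_X_some]
    change Polynomial.map _ (optionEquivLeft k τ (rename some q)) = _
    rw [h1, Polynomial.map_C]
  have hX : ψ (X none) = Polynomial.X := by
    change Polynomial.map _ (optionEquivLeft k τ (X none)) = _
    rw [optionEquivLeft_X_none, Polynomial.map_X]
  have h1 := Ideal.mem_map_of_mem ψ hp
  have hg0 : Ideal.Quotient.mk (Ideal.span {g}) g = 0 :=
    Ideal.Quotient.eq_zero_iff_mem.2 (Ideal.mem_span_singleton_self g)
  rw [Ideal.map_span, Set.image_pair, map_sub, map_pow, hψ, hψ, hψ, hX, hg0, map_zero,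
    Ideal.mem_span_pair] at h1
  obtain ⟨a, b, h2⟩ := h1
  rw [mul_zero, add_zero] at h2
  set f : Polynomial A := Polynomial.X ^ 2 - Polynomial.C (Ideal.Quotient.mk (Ideal.span {g}) h)
  have hf : f.Monic := Polynomial.monic_X_pow_sub_C _ two_ne_zero
  have hdeg : f.natDegree = 2 := Polynomial.natDegree_X_pow_sub_C
  by_contra hpg
  refine hf.not_dvd_of_natDegree_lt (q := Polynomial.C (Ideal.Quotient.mk (Ideal.span {g}) p))
    (fun h0 => hpg ?_) (by rw [hdeg, Polynomial.natDegree_C]; norm_num) ⟨a, h2.symm.trans (mul_comm a f)⟩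
  rw [← Ideal.mem_span_singleton, ← Ideal.Quotient.eq_zero_iff_mem]
  exact Polynomial.C_eq_zero.1 h0

end Elimination

section GradedQuotient

open MvPolynomial

variable {σ k R : Type*} [Field k] [CommRing R] [Algebra k R] {w : σ → ℕ}
  {F : ℕ → Submodule k R} {φ : MvPolynomial σ k →ₐ[k] R}

/-- The submodules are independent: there are projections to each of them. -/
def HasProjections (F : ℕ → Submodule k R) : Prop :=
  ∀ n, ∃ f : R →ₗ[k] R, (∀ a ∈ F n, f a = a) ∧ ∀ m, m ≠ n → ∀ a ∈ F m, f a = 0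

/-- In any preimage of `a`, the components of other weights map to other degrees and are removed by
the projection to `F n`. -/
theorem exists_homogeneous_of_mem (hF : HasProjections F) (hφ : Function.Surjective φ)
    (hw : ∀ n p, IsWeightedHomogeneous w p n → φ p ∈ F n) {n : ℕ} {a : R} (ha : a ∈ F n) :
    ∃ p, IsWeightedHomogeneous w p n ∧ φ p = a := by
  obtain ⟨f, hf, hf0⟩ := hF n
  obtain ⟨p, rfl⟩ := hφ a
  refine ⟨weightedHomogeneousComponent w n p, weightedHomogeneousComponent_isWeightedHomogeneous n p,
    ?_⟩
  rw [← hf _ ha, p.as_sum, map_sum, map_sum, map_sum, map_sum]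
  refine Finset.sum_congr rfl fun d _ => ?_
  have hd : IsWeightedHomogeneous w (monomial d (coeff d p)) (Finsupp.weight w d) :=
    isWeightedHomogeneous_monomial _ _ _ rfl
  by_cases h : Finsupp.weight w d = n
  · rw [h] at hd
    rw [hd.weightedHomogeneousComponent_same, hf _ (hw _ _ hd)]
  · rw [hd.weightedHomogeneousComponent_ne _ (Ne.symm h), hf0 _ h _ (hw _ _ hd), map_zero]

/-- All weights being positive, a monomial of weight one or two involves no variable of weight
three: z plays no part in these degrees. -/
theorem IsPresentation.of_surjective (hF : HasProjections F) (hφ : Function.Surjective φ)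
    (hw : ∀ n p, IsWeightedHomogeneous w p n → φ p ∈ F n) (hpos : ∀ i, 1 ≤ w i)
    {x : Fin 3 → R} {y : R} {G : MvPolynomial (Option (Fin 3)) k}
    (hx : ∀ a, ∃ p, IsWeightedHomogeneous w p 1 ∧ φ p = x a)
    (hy : ∃ p, IsWeightedHomogeneous w p 2 ∧ φ p = y)
    (hone : ∀ i, w i = 1 → ∃ a, φ (X i) = x a) (htwo : ∀ i, w i = 2 → φ (X i) = y)
    (homog : G.IsWeightedHomogeneous varWeight 2) (haeval : aeval (varPoint x y) G = 0)
    (hdvd : ∀ p, aeval (varPoint x y) p = 0 → G ∣ p) : IsPresentation F x y G where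
  homog := homog
  aeval_eq := haeval
  one_eq := by
    refine le_antisymm (fun a ha => ?_) (Submodule.span_le.2 ?_)
    · obtain ⟨p, hp, rfl⟩ := exists_homogeneous_of_mem hF hφ hw ha
      rw [p.as_sum, map_sum]
      refine Submodule.sum_mem _ fun d hd => ?_
      obtain ⟨i, hi, rfl⟩ := exists_of_weight_eq_one_of_pos hpos (hp (mem_support_iff.1 hd))
      obtain ⟨a, ha⟩ := hone i hi
      rw [← C_mul_X_eq_monomial, ← smul_eq_C_mul, map_smul, ha]
      exact Submodule.smul_mem _ _ (Submodule.subset_span ⟨a, rfl⟩)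
    · rintro _ ⟨a, rfl⟩
      obtain ⟨p, hp, hpx⟩ := hx a
      exact hpx ▸ hw _ _ hp
  two_eq := by
    refine le_antisymm (fun a ha => ?_) (Submodule.span_le.2 ?_)
    · obtain ⟨p, hp, rfl⟩ := exists_homogeneous_of_mem hF hφ hw ha
      rw [p.as_sum, map_sum]
      refine Submodule.sum_mem _ fun d hd => ?_
      rcases exists_of_weight_eq_two_of_pos hpos (hp (mem_support_iff.1 hd)) with
        ⟨i, hi, rfl⟩ | ⟨i, j, hi, hj, rfl⟩
      · rw [← C_mul_X_eq_monomial, ← smul_eq_C_mul, map_smul, htwo i hi]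
        exact Submodule.smul_mem _ _ (Submodule.subset_span (Or.inl rfl))
      · obtain ⟨a, ha⟩ := hone i hi
        obtain ⟨b, hb⟩ := hone j hj
        have h1 : monomial (Finsupp.single i 1 + Finsupp.single j 1) 
            (coeff (Finsupp.single i 1 + Finsupp.single j 1) p) =
            (coeff (Finsupp.single i 1 + Finsupp.single j 1) p) • (X i * X j) := by
          rw [X, X, monomial_mul, smul_monomial]
          simp
        rw [h1, map_smul, map_mul, ha, hb]
        exact Submodule.smul_mem _ _ (Submodule.subset_span (Or.inr ⟨(a, b), rfl⟩))
    · rintro _ (rfl | ⟨⟨a, b⟩, rfl⟩)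
      · obtain ⟨p, hp, hpy⟩ := hy
        exact hpy ▸ hw _ _ hp
      · obtain ⟨p, hp, hpx⟩ := hx a
        obtain ⟨q, hq, hqx⟩ := hx b
        have h1 := hw _ _ (hp.mul hq)
        rw [map_mul, hpx, hqx] at h1
        exact h1
  dvd _ p _ hp0 := hdvd p hp0

/-- No generator of degree two is needed, so y = 0 with relation G = y. If p is a relation, p(x, 0)
is a z-free element of the ideal (z² - f₆), hence zero, and y divides p. -/
theorem exists_isPresentation_of_hyperelliptic (hF : HasProjections F) (f₆ : MvPolynomial (Fin 3) k)
    (e : (MvPolynomial (Fin 4) k ⧸ Ideal.span {(X 3 ^ 2 - rename ![0, 1, 2] f₆ :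
          MvPolynomial (Fin 4) k)}) ≃ₐ[k] R)
    (he : ∀ (n : ℕ) (p : MvPolynomial (Fin 4) k),
        p.IsWeightedHomogeneous (![1, 1, 1, 3] : Fin 4 → ℕ) n → e (Ideal.Quotient.mk _ p) ∈ F n) :
    ∃ x y G, IsPresentation F x y G := by
  let I := Ideal.span {(X 3 ^ 2 - rename ![0, 1, 2] f₆ : MvPolynomial (Fin 4) k)}
  let φ : MvPolynomial (Fin 4) k →ₐ[k] R := e.toAlgHom.comp (Ideal.Quotient.mkₐ k I)
  have hφ : Function.Surjective φ := e.surjective.comp Ideal.Quotient.mk_surjective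
  refine ⟨fun a => φ (X (![0, 1, 2] a)), 0, X none, .of_surjective hF hφ he ?_ ?_ ?_ ?_ ?_
    (isWeightedHomogeneous_X _ _ _) (aeval_X _ _) fun p hp => ?_⟩
  · intro i
    fin_cases i <;> simp
  · intro a
    refine ⟨_, ?_, rfl⟩
    fin_cases a <;> exact isWeightedHomogeneous_X _ _ _
  · exact ⟨0, isWeightedHomogeneous_zero _ _ _, map_zero _⟩
  · intro i hi
    fin_cases i
    · exact ⟨0, rfl⟩
    · exact ⟨1, rfl⟩
    · exact ⟨2, rfl⟩
    · simp at hi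
  · intro i hi
    fin_cases i <;> simp at hi
  · let ε : MvPolynomial (Option (Fin 3)) k →ₐ[k] MvPolynomial (Fin 3) k :=
      aeval fun o => o.elim 0 X
    have hε : aeval (varPoint (fun a => φ (X (![0, 1, 2] a))) 0) =
        (φ.comp (rename ![0, 1, 2])).comp ε := by
      ext o
      cases o <;> simp [ε]
    rw [hε] at hp
    have h1 : rename ![0, 1, 2] (ε p) ∈ I := by
      rw [← Ideal.Quotient.eq_zero_iff_mem]
      exact (map_eq_zero_iff e e.injective).1 hp
    let ρ : Fin 4 → Option (Fin 3) := ![some 0, some 1, some 2, none]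
    have h2 := Ideal.mem_map_of_mem (rename ρ) h1
    rw [Ideal.map_span, Set.image_singleton, map_sub, map_pow, rename_X, rename_rename,
      rename_rename] at h2
    have h3 : ρ ∘ ![0, 1, 2] = some := by
      ext1 i
      fin_cases i <;> rfl
    rw [h3] at h2
    -- With `g = 0`, elimination says that `ε p` is divisible by zero.
    have h4 := dvd_of_rename_some_mem (g := 0) (h := f₆) (p := ε p)
      (Ideal.span_mono (t := {(X none ^ 2 - rename some f₆ : MvPolynomial (Option (Fin 3)) k),
        rename some 0}) (Set.singleton_subset_iff.2 (Set.mem_insert _ _)) h2)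
    rw [zero_dvd_iff] at h4
    have h5 : ∀ q : MvPolynomial (Option (Fin 3)) k, X none ∣ q - rename some (ε q) := by
      intro q
      induction q using MvPolynomial.induction_on with
      | C a => simp [ε]
      | add p q hp hq =>
        rw [map_add, map_add, add_sub_add_comm]
        exact dvd_add hp hq
      | mul_X p i hp =>
        cases i with
        | none => simp [ε]
        | some a =>
          have h6 : ε (X (some a)) = X a := aeval_X _ _
          rw [map_mul, map_mul, h6, rename_X, ← sub_mul]
          exact hp.mul_right _
    simpa [h4] using h5 p

/-- Here G = g₂: a relation between the x_a and y is a z-free element of (z² - g₆, g₂), so g₂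
divides it. -/
theorem exists_isPresentation_of_unigonal (hF : HasProjections F) (g₆ : MvPolynomial (Fin 4) k)
    (g₂ : MvPolynomial (Fin 3) k) (hg₂ : g₂.IsHomogeneous 2)
    (e : (MvPolynomial (Fin 5) k ⧸ Ideal.span {(X 4 ^ 2 - rename ![0, 1, 2, 3] g₆ :
          MvPolynomial (Fin 5) k), rename ![0, 1, 2] g₂}) ≃ₐ[k] R)
    (he : ∀ (n : ℕ) (p : MvPolynomial (Fin 5) k),
        p.IsWeightedHomogeneous (![1, 1, 1, 2, 3] : Fin 5 → ℕ) n → e (Ideal.Quotient.mk _ p) ∈ F n) :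
    ∃ x y G, IsPresentation F x y G := by
  let I := Ideal.span {(X 4 ^ 2 - rename ![0, 1, 2, 3] g₆ : MvPolynomial (Fin 5) k),
    rename ![0, 1, 2] g₂}
  let φ : MvPolynomial (Fin 5) k →ₐ[k] R := e.toAlgHom.comp (Ideal.Quotient.mkₐ k I)
  have hφ : Function.Surjective φ := e.surjective.comp Ideal.Quotient.mk_surjective
  let ν : Option (Fin 3) → Fin 5 := fun o => o.elim 3 ![0, 1, 2]
  have hν : aeval (varPoint (fun a => φ (X (![0, 1, 2] a))) (φ (X 3))) =
      φ.comp (rename ν) := by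
    ext o
    cases o <;> simp [ν]
  have hmem : ∀ p, φ p = 0 ↔ p ∈ I := fun p => by
    rw [← Ideal.Quotient.eq_zero_iff_mem]
    exact map_eq_zero_iff e e.injective
  refine ⟨fun a => φ (X (![0, 1, 2] a)), φ (X 3), rename some g₂, .of_surjective hF hφ he
    ?_ ?_ ?_ ?_ ?_ ?_ ?_ fun p hp => ?_⟩
  · intro i
    fin_cases i <;> simp
  · intro a
    refine ⟨_, ?_, rfl⟩
    fin_cases a <;> exact isWeightedHomogeneous_X _ _ _
  · exact ⟨_, isWeightedHomogeneous_X _ _ _, rfl⟩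
  · intro i hi
    fin_cases i
    · exact ⟨0, rfl⟩
    · exact ⟨1, rfl⟩
    · exact ⟨2, rfl⟩
    · simp at hi
    · simp at hi
  · intro i hi
    fin_cases i
    · simp at hi
    · simp at hi
    · simp at hi
    · rfl
    · simp at hi
  · have h1 := isWeightedHomogeneous_aeval 1 (w := 1) (v := varWeight)
      (f := fun a : Fin 3 => (X (some a) : MvPolynomial (Option (Fin 3)) k))
      (fun a => isWeightedHomogeneous_X _ _ _) hg₂
    rw [one_mul] at h1
    have h2 : rename (R := k) (some : Fin 3 → Option (Fin 3)) = aeval fun a => X (some a) := by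
      ext a
      simp
    rwa [h2]
  · rw [hν, AlgHom.comp_apply, rename_rename, hmem]
    have h3 : ν ∘ some = ![0, 1, 2] := rfl
    rw [h3]
    exact Ideal.subset_span (Or.inr rfl)
  · rw [hν, AlgHom.comp_apply, hmem] at hp
    let ρ : Fin 5 → Option (Option (Fin 3)) :=
      ![some (some 0), some (some 1), some (some 2), some none, none]
    have h2 := Ideal.mem_map_of_mem (rename ρ) hp
    rw [Ideal.map_span, Set.image_pair, map_sub, map_pow, rename_X, rename_rename,
      rename_rename, rename_rename] at h2
    have h3 : ρ ∘ ν = some := by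
      ext1 i
      match i with
      | none => rfl
      | some 0 => rfl
      | some 1 => rfl
      | some 2 => rfl
    have h4 : ρ ∘ ![0, 1, 2] = some ∘ some := by
      ext1 i
      fin_cases i <;> rfl
    have h5 : ρ ∘ ![0, 1, 2, 3] =
        some ∘ ![some 0, some 1, some 2, none] := by
      ext1 i
      fin_cases i <;> rfl
    rw [h3, h4, h5, ← rename_rename, ← rename_rename] at h2
    exact dvd_of_rename_some_mem h2

end GradedQuotient

/-! ### The fibre of the algebra and Nakayama's lemma. -/

section FibreProjections

variable {B P : Type*} [CommRing B] [CommRing P] [Algebra B P] (E : ℕ → Submodule B P)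
  (k : Type*) [Field k] [Algebra B k]

/-- The map from the part of degree `n` to the fibre. -/
noncomputable def toFibre (n : ℕ) : E n →ₗ[B] Fibre E k :=
  TensorProduct.mk B k (⨁ n, E n) 1 ∘ₗ DirectSum.lof B ℕ (fun n => E n) n

theorem toFibre_apply (n : ℕ) (a : E n) :
    toFibre E k n a = 1 ⊗ₜ DirectSum.lof B ℕ (fun n => E n) n a := rfl

theorem toFibre_mul [SetLike.GradedMonoid E] {i j m : ℕ} (h : i + j = m) (a : E i) (b : E j) (c : E m)
    (hc : (c : P) = a * b) : toFibre E k m c = toFibre E k i a * toFibre E k j b := by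
  rw [toFibre_apply, toFibre_apply, toFibre_apply, Algebra.TensorProduct.tmul_mul_tmul, one_mul,
    lof_mul_lof E i j m h a b c hc]

/-- The projection of the fibre to its part of degree `n`. -/
noncomputable def fibreComponent (n : ℕ) : Fibre E k →ₗ[k] k ⊗[B] E n :=
  (DirectSum.component B ℕ (fun n => E n) n).baseChange k

theorem fibreComponent_baseChange_lof (n : ℕ) (z : k ⊗[B] E n) :
    fibreComponent E k n ((DirectSum.lof B ℕ (fun n => E n) n).baseChange k z) = z := by
  have h : DirectSum.component B ℕ (fun n => E n) n ∘ₗ DirectSum.lof B ℕ (fun n => E n) n =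
      LinearMap.id := LinearMap.ext fun a =>
    DirectSum.component.lof_self (M := fun n => E n) B n a
  rw [fibreComponent, ← LinearMap.comp_apply, ← LinearMap.baseChange_comp, h,
    LinearMap.baseChange_id, LinearMap.id_apply]

theorem fibreComponent_baseChange_lof_of_ne {m n : ℕ} (hmn : m ≠ n) (z : k ⊗[B] E m) :
    fibreComponent E k n ((DirectSum.lof B ℕ (fun n => E n) m).baseChange k z) = 0 := by
  have h : DirectSum.component B ℕ (fun n => E n) n ∘ₗ DirectSum.lof B ℕ (fun n => E n) m =
      0 := LinearMap.ext fun a => by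
    rw [LinearMap.comp_apply, DirectSum.component.of, dif_neg hmn, LinearMap.zero_apply]
  rw [fibreComponent, ← LinearMap.comp_apply, ← LinearMap.baseChange_comp, h,
    LinearMap.baseChange_zero, LinearMap.zero_apply]

theorem hasProjections_fibreDegree [SetLike.GradedMonoid E] : HasProjections (fibreDegree E k) := by
  refine fun n => ⟨(DirectSum.lof B ℕ (fun n => E n) n).baseChange k ∘ₗ fibreComponent E k n, ?_, ?_⟩
  · rintro _ ⟨z, rfl⟩
    rw [LinearMap.comp_apply, fibreComponent_baseChange_lof]
  · rintro m hm _ ⟨z, rfl⟩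
    rw [LinearMap.comp_apply, fibreComponent_baseChange_lof_of_ne E k hm, map_zero]

theorem toFibre_mem (n : ℕ) (a : E n) : toFibre E k n a ∈ fibreDegree E k n :=
  ⟨1 ⊗ₜ a, rfl⟩

theorem exists_toFibre_eq (hk : Function.Surjective (algebraMap B k)) {n : ℕ} {f : Fibre E k}
    (hf : f ∈ fibreDegree E k n) : ∃ a, toFibre E k n a = f := by
  obtain ⟨z, rfl⟩ := hf
  induction z using TensorProduct.induction_on with
  | zero => exact ⟨0, by rw [map_zero, map_zero]⟩
  | tmul c a =>
    obtain ⟨b, rfl⟩ := hk c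
    refine ⟨b • a, ?_⟩
    rw [LinearMap.baseChange_tmul, toFibre_apply, map_smul, ← TensorProduct.smul_tmul,
      Algebra.algebraMap_eq_smul_one]
  | add z z' hz hz' =>
    obtain ⟨a, ha⟩ := hz
    obtain ⟨a', ha'⟩ := hz'
    exact ⟨a + a', by rw [map_add, map_add, ha, ha']⟩

end FibreProjections

section ResidueField

open IsLocalRing

variable {B P : Type*} [CommRing B] [IsLocalRing B] [CommRing P] [Algebra B P]
  (E : ℕ → Submodule B P)

theorem mem_smul_top_of_tmul_eq_zero {M : Type*} [AddCommGroup M] [Module B M] {a : M}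
    (h : (1 : ResidueField B) ⊗ₜ[B] a = 0) : a ∈ maximalIdeal B • (⊤ : Submodule B M) := by
  have h1 := TensorProduct.quotTensorEquivQuotSMul_mk_one_tmul (maximalIdeal B) a
  rw [← Submodule.Quotient.mk_eq_zero, ← h1]
  exact (congrArg (TensorProduct.quotTensorEquivQuotSMul M (maximalIdeal B)) h).trans (map_zero _)

theorem mem_smul_top_of_toFibre_eq_zero {n : ℕ} {a : E n}
    (h : toFibre E (ResidueField B) n a = 0) : a ∈ maximalIdeal B • (⊤ : Submodule B (E n)) := by
  refine mem_smul_top_of_tmul_eq_zero ?_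
  have h1 := fibreComponent_baseChange_lof E (ResidueField B) n (1 ⊗ₜ a)
  rw [LinearMap.baseChange_tmul, ← toFibre_apply, h, map_zero] at h1
  exact h1.symm

/-- Nakayama's lemma: elements killed by the map to the fibre lie in 𝔪 E_n, so `Z` spans E_n modulo
𝔪 E_n. -/
theorem span_eq_top_of_fibreDegree_le {n : ℕ} (hE : (E n).FG) {Z : Set (E n)}
    (h : fibreDegree E (ResidueField B) n ≤
      Submodule.span (ResidueField B) (toFibre E (ResidueField B) n '' Z)) :
    Submodule.span B Z = ⊤ := by
  have h1 : ∀ f ∈ Submodule.span (ResidueField B) (toFibre E (ResidueField B) n '' Z),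
      ∃ a ∈ Submodule.span B Z, toFibre E (ResidueField B) n a = f := by
    intro f hf
    induction hf using Submodule.span_induction with
    | mem f hf =>
      obtain ⟨a, ha, rfl⟩ := hf
      exact ⟨a, Submodule.subset_span ha, rfl⟩
    | zero => exact ⟨0, zero_mem _, map_zero _⟩
    | add f g _ _ hf hg =>
      obtain ⟨a, ha, rfl⟩ := hf
      obtain ⟨b, hb, rfl⟩ := hg
      exact ⟨a + b, add_mem ha hb, map_add _ _ _⟩
    | smul c f _ hf =>
      obtain ⟨a, ha, rfl⟩ := hf
      obtain ⟨b, rfl⟩ := residue_surjective c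
      refine ⟨b • a, Submodule.smul_mem _ _ ha, ?_⟩
      rw [map_smul]
      exact (algebraMap_smul (ResidueField B) b _).symm
  rw [eq_top_iff]
  refine Submodule.le_of_le_smul_of_le_jacobson_bot (I := maximalIdeal B)
    (Module.finite_def.1 (Module.Finite.iff_fg.2 hE))
    (jacobson_eq_maximalIdeal _ bot_ne_top).ge fun a _ => ?_
  obtain ⟨b, hb, hab⟩ := h1 _ (h (toFibre_mem E _ n a))
  rw [← add_sub_cancel b a]
  refine Submodule.add_mem_sup hb (mem_smul_top_of_toFibre_eq_zero E ?_)
  rw [map_sub, hab, sub_self]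

end ResidueField

/-! ### Lifting the presentation from the fibre to the stalk. -/

section Lifting

open MvPolynomial IsLocalRing

theorem dvd_weightedHomogeneousComponent_mul {σ R : Type*} [CommRing R] {w : σ → ℕ}
    {g : MvPolynomial σ R} {m : ℕ} (hg : g.IsWeightedHomogeneous w m) (n : ℕ)
    (q : MvPolynomial σ R) : g ∣ weightedHomogeneousComponent w n (g * q) := by
  by_cases h : m ≤ n
  · exact ⟨_, weightedHomogeneousComponent_mul_left hg h q⟩
  · let _ := weightedGradedAlgebra R w
    have h1 := DirectSum.coe_decompose_mul_of_left_mem_of_not_le (weightedHomogeneousSubmodule R w)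
      (b := q) ((mem_weightedHomogeneousSubmodule R w m g).2 hg) h
    have key : ∀ p k, (DirectSum.decompose (weightedHomogeneousSubmodule R w) p k :
      MvPolynomial σ R) = weightedHomogeneousComponent w k p :=
        fun p k => weightedDecomposition.decompose'_apply R w p k
    rw [key] at h1
    exact h1 ▸ dvd_zero g

section Evaluation

variable {B P : Type*} [CommRing B] [CommRing P] [Algebra B P] (E : ℕ → Submodule B P)
  [SetLike.GradedMonoid E] (k : Type*) [Field k] [Algebra B k]

/-- The value of `p` lies in `E n` and is compatible with the map to the fibre. -/
def EvaluatesTo {σ : Type*} (z : σ → P) (z' : σ → Fibre E k) (n : ℕ) (p : MvPolynomial σ B) :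
    Prop :=
  ∃ e : E n, (e : P) = aeval z p ∧ toFibre E k n e = aeval z' (map (algebraMap B k) p)

variable {E k} {σ : Type*} {z : σ → P} {z' : σ → Fibre E k}

theorem EvaluatesTo.mul {i j n : ℕ} {p q : MvPolynomial σ B} (hp : EvaluatesTo E k z z' i p)
    (hq : EvaluatesTo E k z z' j q) (h : i + j = n) : EvaluatesTo E k z z' n (p * q) := by
  obtain ⟨a, ha, ha'⟩ := hp
  obtain ⟨b, hb, hb'⟩ := hq
  refine ⟨⟨a * b, h ▸ SetLike.GradedMul.mul_mem a.2 b.2⟩, ?_, ?_⟩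
  · rw [map_mul, ← ha, ← hb]
  · rw [toFibre_mul E k h a b _ rfl, map_mul, map_mul, ha', hb']

theorem EvaluatesTo.add {n : ℕ} {p q : MvPolynomial σ B} (hp : EvaluatesTo E k z z' n p)
    (hq : EvaluatesTo E k z z' n q) : EvaluatesTo E k z z' n (p + q) := by
  obtain ⟨a, ha, ha'⟩ := hp
  obtain ⟨b, hb, hb'⟩ := hq
  exact ⟨a + b, by rw [map_add, ← ha, ← hb]; rfl, by rw [map_add, map_add, map_add, ha', hb']⟩

theorem evaluatesTo_C (c : B) : EvaluatesTo E k z z' 0 (C c) := by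
  refine ⟨c • ⟨1, SetLike.GradedOne.one_mem⟩, ?_, ?_⟩
  · rw [← algebraMap_eq, AlgHom.commutes, Algebra.algebraMap_eq_smul_one]
    rfl
  · rw [map_C, ← algebraMap_eq, AlgHom.commutes, map_smul, Algebra.algebraMap_eq_smul_one,
      algebraMap_smul]
    rfl

theorem evaluatesTo_zero (n : ℕ) : EvaluatesTo E k z z' n 0 :=
  ⟨0, by rw [map_zero]; rfl, by rw [map_zero, map_zero, map_zero]⟩

theorem evaluatesTo_monomial {w : σ → ℕ} (hX : ∀ i, EvaluatesTo E k z z' (w i) (X i)) (d : σ →₀ ℕ) :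
    EvaluatesTo E k z z' (Finsupp.weight w d) (monomial d 1) := by
  induction d using Finsupp.induction_linear with
  | zero => rw [map_zero]; exact evaluatesTo_C 1
  | add d d' hd hd' =>
    have h : monomial (d + d') (1 : B) = monomial d 1 * monomial d' 1 := by
      rw [monomial_mul, one_mul]
    rw [h]
    exact hd.mul hd' (map_add _ _ _).symm
  | single i m =>
    induction m with
    | zero =>
      rw [Finsupp.single_zero, map_zero]
      exact evaluatesTo_C 1
    | succ m ih =>
      have h : monomial (Finsupp.single i (m + 1)) (1 : B) = monomial (Finsupp.single i m) 1 * X i := by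
        rw [X, monomial_mul, one_mul, Finsupp.single_add]
      rw [h]
      refine ih.mul (hX i) ?_
      rw [Finsupp.weight_single, Finsupp.weight_single, add_smul, one_smul]

theorem evaluatesTo_of_isWeightedHomogeneous {w : σ → ℕ}
    (hX : ∀ i, EvaluatesTo E k z z' (w i) (X i)) {n : ℕ} {p : MvPolynomial σ B}
    (hp : p.IsWeightedHomogeneous w n) : EvaluatesTo E k z z' n p := by
  rw [p.as_sum]
  refine Finset.sum_induction _ (EvaluatesTo E k z z' n) (fun _ _ => EvaluatesTo.add)
    (evaluatesTo_zero n) fun d hd => ?_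
  rw [← hp (mem_support_iff.1 hd)]
  have h : monomial d (coeff d p) = C (coeff d p) * monomial d 1 := by
    rw [C_mul_monomial, mul_one]
  rw [h]
  exact (evaluatesTo_C _).mul (evaluatesTo_monomial hX d) (zero_add _)

end Evaluation

theorem exists_homogeneous_map_eq {σ B k : Type*} [CommRing B] [CommRing k] {f : B →+* k}
    (hf : Function.Surjective f) {w : σ → ℕ} {n : ℕ} {p : MvPolynomial σ k}
    (hp : p.IsWeightedHomogeneous w n) : ∃ q, q.IsWeightedHomogeneous w n ∧ map f q = p := by
  obtain ⟨q, rfl⟩ := map_surjective f hf p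
  refine ⟨_, weightedHomogeneousComponent_isWeightedHomogeneous n q, ?_⟩
  rw [← weightedHomogeneousComponent_map, hp.weightedHomogeneousComponent_same]

theorem exists_poly_of_mem_span {B P : Type*} [CommRing B] [CommRing P] [Algebra B P]
    {x : Fin 3 → P} {y e : P}
    (he : e ∈ Submodule.span B (insert y (Set.range fun ab : Fin 3 × Fin 3 => x ab.1 * x ab.2))) :
    ∃ r : MvPolynomial (Option (Fin 3)) B, IsWeightedHomogeneous varWeight r 2 ∧
      aeval (varPoint x y) r = e := by
  have h : Submodule.span B (insert y (Set.range fun ab : Fin 3 × Fin 3 => x ab.1 * x ab.2)) ≤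
      (weightedHomogeneousSubmodule B varWeight 2).map (aeval (varPoint x y)).toLinearMap := by
    refine Submodule.span_le.2 ?_
    rintro _ (rfl | ⟨⟨a, b⟩, rfl⟩)
    · exact ⟨X none, isWeightedHomogeneous_X _ _ _, aeval_X _ _⟩
    · exact ⟨X (some a) * X (some b),
        (isWeightedHomogeneous_X _ _ _).mul (isWeightedHomogeneous_X _ _ _), by simp⟩
  exact h he

theorem coe_span_eq_of_span_eq_top {B P : Type*} [CommRing B] [AddCommGroup P] [Module B P]
    {M : Submodule B P} {Z : Set M} (h : Submodule.span B Z = ⊤) :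
    M = Submodule.span B (Subtype.val '' Z) := by
  have h1 := congrArg (Submodule.map M.subtype) h
  rw [Submodule.map_span, Submodule.map_top, Submodule.range_subtype] at h1
  exact h1.symm

variable {B P : Type*} [CommRing B] [IsLocalRing B] [CommRing P] [Algebra B P]
  {E : ℕ → Submodule B P} [SetLike.GradedMonoid E]

/-- Lifts of the generators generate by Nakayama's lemma, and the relation of the fibre is corrected
to a true relation G. The relations of weight n form a finitely generated module M, and a second use
of Nakayama's lemma reduces M ⊆ (G) to M ⊆ (G) + 𝔪 M. -/
theorem IsPresentation.exists_of_fibre [IsNoetherianRing B]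
    (hprin : (maximalIdeal B).IsPrincipal) (htf : ∀ (b : B) (a : P), b • a = 0 → b = 0 ∨ a = 0)
    (h₁ : (E 1).FG) (h₂ : (E 2).FG) {x' : Fin 3 → Fibre E (ResidueField B)}
    {y' : Fibre E (ResidueField B)} {G' : MvPolynomial (Option (Fin 3)) (ResidueField B)}
    (h : IsPresentation (fibreDegree E (ResidueField B)) x' y' G') :
    ∃ x y G, IsPresentation E x y G := by
  obtain ⟨t, ht⟩ := hprin
  have ht' : maximalIdeal B = Ideal.span {t} := ht
  have hsurj : Function.Surjective (algebraMap B (ResidueField B)) := residue_surjective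
  have htres : algebraMap B (ResidueField B) t = 0 := by
    refine (residue_eq_zero_iff t).2 ?_
    rw [ht']
    exact Ideal.mem_span_singleton_self t
  choose x hx using fun a => exists_toFibre_eq E (ResidueField B) hsurj
    (h.one_eq ▸ Submodule.subset_span ⟨a, rfl⟩ : x' a ∈ fibreDegree E (ResidueField B) 1)
  obtain ⟨y, hy⟩ := exists_toFibre_eq E (ResidueField B) hsurj
    (h.two_eq ▸ Submodule.subset_span (Or.inl rfl) : y' ∈ fibreDegree E (ResidueField B) 2)
  let xx : Fin 3 × Fin 3 → E 2 := fun ab => ⟨x ab.1 * x ab.2,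
    SetLike.GradedMul.mul_mem (x ab.1).2 (x ab.2).2⟩
  have hxx : ∀ ab, toFibre E (ResidueField B) 2 (xx ab) = x' ab.1 * x' ab.2 := fun ab => by
    rw [toFibre_mul E (ResidueField B) rfl (x ab.1) (x ab.2) _ rfl, hx, hx]
  have hone := span_eq_top_of_fibreDegree_le E h₁ (Z := Set.range x) (by
    rw [h.one_eq, ← Set.range_comp]
    exact Submodule.span_mono (by
      rintro _ ⟨a, rfl⟩
      exact ⟨a, hx a⟩))
  have htwo := span_eq_top_of_fibreDegree_le E h₂ (Z := insert y (Set.range xx)) (by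
    rw [h.two_eq, Set.image_insert_eq, ← Set.range_comp, hy]
    refine Submodule.span_mono (Set.insert_subset_insert ?_)
    rintro _ ⟨a, rfl⟩
    exact ⟨a, hxx a⟩)
  have hone' := coe_span_eq_of_span_eq_top hone
  have htwo' := coe_span_eq_of_span_eq_top htwo
  rw [← Set.range_comp] at hone'
  rw [Set.image_insert_eq, ← Set.range_comp] at htwo'
  let x₀ : Fin 3 → P := fun a => x a
  have hev : ∀ {n : ℕ} {p : MvPolynomial (Option (Fin 3)) B},
      p.IsWeightedHomogeneous varWeight n →
      EvaluatesTo E (ResidueField B) (varPoint x₀ (y : P)) (varPoint x' y') n p := by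
    intro n p hp
    refine evaluatesTo_of_isWeightedHomogeneous (w := varWeight) ?_ hp
    rintro (_ | a)
    · exact ⟨y, by rw [aeval_X]; rfl, by rw [map_X, aeval_X]; exact hy⟩
    · exact ⟨x a, by rw [aeval_X]; rfl, by rw [map_X, aeval_X]; exact hx a⟩
  obtain ⟨p₀, hp₀, hp₀G⟩ := exists_homogeneous_map_eq hsurj h.homog
  -- The value of `p₀` vanishes in the fibre, so it is `t` times an element of E_2; `r` is a
  -- quadratic form with that value. Then `p₀ - t r` is a relation which still reduces to `G'`.
  obtain ⟨r, hr, hre⟩ : ∃ r : MvPolynomial (Option (Fin 3)) B, IsWeightedHomogeneous varWeight r 2 ∧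
      t • aeval (varPoint x₀ (y : P)) r = aeval (varPoint x₀ (y : P)) p₀ := by
    obtain ⟨e, he, he'⟩ := hev hp₀
    rw [hp₀G, h.aeval_eq] at he'
    have h1 := mem_smul_top_of_toFibre_eq_zero E he'
    rw [ht', Submodule.ideal_span_singleton_smul, Submodule.mem_smul_pointwise_iff_exists] at h1
    obtain ⟨e', -, rfl⟩ := h1
    obtain ⟨r, hr, hre⟩ := exists_poly_of_mem_span (x := x₀) (y := (y : P)) (e := (e' : P))
      (htwo'.le e'.2)
    exact ⟨r, hr, by rw [hre, ← he]; rfl⟩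
  let G := p₀ - C t * r
  have hG : G.IsWeightedHomogeneous varWeight 2 := hp₀.sub (hr.C_mul t)
  have hG0 : aeval (varPoint x₀ (y : P)) G = 0 := by
    rw [map_sub, ← smul_eq_C_mul, map_smul, hre, sub_self]
  have hGG' : map (algebraMap B (ResidueField B)) G = G' := by
    rw [map_sub, map_mul, map_C, htres, C_0, zero_mul, sub_zero, hp₀G]
  refine ⟨x₀, y, G, hG, hG0, hone', htwo', fun n p hp hp0 => ?_⟩
  let M : Submodule B (MvPolynomial (Option (Fin 3)) B) :=
    weightedHomogeneousSubmodule B varWeight n ⊓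
      LinearMap.ker (aeval (varPoint x₀ (y : P))).toLinearMap
  have hMfg : M.FG := isNoetherian_submodule.1 (isNoetherian_of_fg_of_noetherian _
    (weightedHomogeneousSubmodule_fg B varWeight
      (fun i => Nat.one_le_iff_ne_zero.1 (one_le_varWeight i)) n)) M inf_le_left
  suffices H : M ≤ (Ideal.span {G}).restrictScalars B from
    Ideal.mem_span_singleton.1 (H ⟨hp, hp0⟩)
  refine Submodule.le_of_le_smul_of_le_jacobson_bot (I := maximalIdeal B) hMfg
    (jacobson_eq_maximalIdeal _ bot_ne_top).ge ?_
  clear hp0 hp p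
  rintro p ⟨hp, hp0⟩
  have hp' : p.IsWeightedHomogeneous varWeight n := hp
  have hp0' : aeval (varPoint x₀ (y : P)) p = 0 := hp0
  obtain ⟨q', hq'⟩ := h.dvd n _ (isWeightedHomogeneous_map _ hp') (by
    obtain ⟨e, he, he'⟩ := hev hp'
    rw [← he', Subtype.ext (he.trans hp0') (a2 := (0 : E n)), map_zero])
  obtain ⟨q, rfl⟩ := map_surjective _ hsurj q'
  -- Modulo 𝔪 = (t) the relation `p` is a multiple of `G'`, so lifting the cofactor leaves a
  -- remainder divisible by `t`.
  obtain ⟨s, hs⟩ : C t ∣ p - G * q := by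
    rw [C_dvd_iff_dvd_coeff]
    intro d
    rw [← Ideal.mem_span_singleton, ← ht', ← residue_eq_zero_iff]
    change algebraMap B (ResidueField B) _ = 0
    rw [← coeff_map, map_sub, map_mul, hq', hGG', sub_self, coeff_zero]
  have h1 : p = weightedHomogeneousComponent varWeight n (G * q) +
      t • weightedHomogeneousComponent varWeight n s := by
    rw [← map_smul, ← map_add, smul_eq_C_mul, ← hs, add_sub_cancel,
      hp'.weightedHomogeneousComponent_same]
  have h2 := dvd_weightedHomogeneousComponent_mul hG n q
  rw [h1]
  refine Submodule.add_mem_sup (Ideal.mem_span_singleton.2 h2) ?_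
  -- If `t` is zero there is no remainder. Otherwise torsion-freeness cancels `t`, which shows that
  -- the remainder is `t` times a relation.
  rcases eq_or_ne t 0 with rfl | ht0
  · rw [zero_smul]
    exact zero_mem _
  refine Submodule.smul_mem_smul (by rw [ht']; exact Ideal.mem_span_singleton_self t)
    ⟨weightedHomogeneousComponent_isWeightedHomogeneous n s, ?_⟩
  obtain ⟨u, hu⟩ := h2
  rw [h1, hu, map_add, map_mul, hG0, zero_mul, zero_add, map_smul] at hp0'
  exact (htf _ _ hp0').resolve_left ht0

theorem exists_isPresentation [IsNoetherianRing B]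
    (hprin : (maximalIdeal B).IsPrincipal) (htf : ∀ (b : B) (a : P), b • a = 0 → b = 0 ∨ a = 0)
    (h₁ : (E 1).FG) (h₂ : (E 2).FG)
    (h : IsHyperelliptic E (ResidueField B) ∨ IsUnigonal E (ResidueField B)) :
    ∃ x y G, IsPresentation E x y G := by
  have hF := hasProjections_fibreDegree E (ResidueField B)
  obtain ⟨x, y, G, h'⟩ : ∃ x y G, IsPresentation (fibreDegree E (ResidueField B)) x y G := by
    rcases h with ⟨f₆, -, e, he⟩ | ⟨g₆, g₂, -, hg₂, -, e, he⟩
    · exact exists_isPresentation_of_hyperelliptic hF f₆ e he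
    · exact exists_isPresentation_of_unigonal hF g₆ g₂ hg₂ e he
  exact h'.exists_of_fibre hprin htf h₁ h₂

end Lifting

/-! ### The presentation at an arbitrary point of S. -/

/-- The hypothesis on fibres concerns closed points only. Since S is quasi-compact, every point
specializes to a closed one, and the presentation found there localizes. -/
theorem exists_isPresentation_directImageStalk {S : Scheme.{0}} [AlgebraicGeometry.IsIntegral S]
    (q : S ⟶ Spec (CommRingCat.of ℂ)) [LocallyOfFiniteType q] [QuasiCompact q]
    [SmoothOfRelativeDimension 1 q] {X : Scheme.{0}} [AlgebraicGeometry.IsIntegral X] (π : X ⟶ S)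
    [Surjective π] (hproj : IsProjective π)
    (hnormal : ∀ x : X, IsIntegrallyClosed (X.presheaf.stalk x))
    (hdim : topologicalKrullDim X = 3) (D : WeilDivisor X) (hfibres : HasGoodFibres q π D) (s : S) :
    ∃ x y G, IsPresentation (directImageStalk q π D s) x y G := by
  have := hproj.isProper
  have : CompactSpace S := (quasiCompact_iff_compactSpace q).1 inferInstance
  have := LocallyOfFiniteType.isLocallyNoetherian q
  obtain ⟨s₀, hs₀, hs⟩ := exists_isClosed_specializes s
  obtain ⟨x, y, G, h⟩ := exists_isPresentation (E := directImageStalk q π D s₀)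
    (isPrincipal_maximalIdeal_stalk q s₀) (isTorsionFree_stalk q π s₀)
    (fg_directImageStalk q π hproj hnormal hdim D 1 s₀)
    (fg_directImageStalk q π hproj hnormal hdim D 2 s₀) (hfibres s₀ hs₀)
  let := stalkAlgebra hs
  have := isScalarTower_stalkAlgebra q π hs
  exact ⟨x, y, _, h.of_span
    (fun n => directImageStalk_eq_span_of_specializes q π hnormal hdim D n hs)
    (exists_stalkAlgebra_mul_eq hs)⟩

end K3Fibration

theorem proposition4p4
    -- a nonsingular complex curve `S`
    {S : Scheme.{0}} [AlgebraicGeometry.IsIntegral S] (q : S ⟶ Spec (CommRingCat.of ℂ))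
    [IsSeparated q] [LocallyOfFiniteType q] [QuasiCompact q] [SmoothOfRelativeDimension 1 q]
    -- a normal threefold `X`, projective over `S`
    {X : Scheme.{0}} [AlgebraicGeometry.IsIntegral X] (π : X ⟶ S) [Surjective π]
    (hproj : IsProjective π)
    (hnormal : ∀ x : X, IsIntegrallyClosed (X.presheaf.stalk x))
    (hdim : topologicalKrullDim X = 3)
    -- the divisorial sheaf `L = 𝒪_X(D)`
    (D : WeilDivisor X)
    (hfibres : HasGoodFibres q π D) (s : S) :
    (∀ n : ℕ, 2 ≤ n →
      ∃ i : SymPow (S.presheaf.stalk s) (⋀[S.presheaf.stalk s]^2 (directImageStalk q π D s 1)) 2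
            ⊗[S.presheaf.stalk s]
            SymPow (S.presheaf.stalk s) (directImageStalk q π D s 2) (n - 2)
          →ₗ[S.presheaf.stalk s] SymPow (S.presheaf.stalk s) (directImageStalk q π D s 2) n,
        IsEvenRelationMap (directImageStalk q π D s) n i ∧
        Function.Exact i (evenMap (directImageStalk q π D s) n) ∧
        Function.Surjective (evenMap (directImageStalk q π D s) n) ∧
        (n = 2 → Function.Injective i)) ∧
    (∀ (n : ℕ) (hn : 1 ≤ n),
      ∃ j : directImageStalk q π D s 1 ⊗[S.presheaf.stalk s]
            (⋀[S.presheaf.stalk s]^2 (directImageStalk q π D s 1) ⊗[S.presheaf.stalk s]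
              gradedA (directImageStalk q π D s) (2 * n - 2))
          →ₗ[S.presheaf.stalk s]
            directImageStalk q π D s 1 ⊗[S.presheaf.stalk s]
              gradedA (directImageStalk q π D s) (2 * n),
        IsOddRelationMap (directImageStalk q π D s) n hn j ∧
        Function.Exact j (oddMap (directImageStalk q π D s) n) ∧
        Function.Surjective (oddMap (directImageStalk q π D s) n)) := by
  have h := (exists_isPresentation_directImageStalk q π hproj hnormal hdim D hfibres
    s).choose_spec.choose_spec.choose_spec
  exact h.exact_sequences
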